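/- **Conventions.** A category $\mathcal C$ is *proto-abelian* if (1) it has a zero object; (2) every diagram $C \twoheadleftarrow A \hookrightarrow B$ (epimorphism, monomorphism) can be completed to a pushout square with $B \twoheadrightarrow D$ epi and $C \hookrightarrow D$ mono, and every diagram $C \hookrightarrow D \twoheadleftarrow B$ can be completed to a pullback square with $A \hookrightarrow B$ mono and $A \twoheadrightarrow C$ epi; (3) a commutative square with sides $A\hookrightarrow B$, $A\twoheadrightarrow C$, $B\twoheadrightarrow D$, $C\hookrightarrow D$ is a pushout square if and only if it is a pullback square (it is then called *biCartesian*). It is *finitary* if for all objects $A, A'$ the set $\mathrm{Hom}(A',A)$ and the set $\mathrm{Ext}(A',A)$ of equivalence classes of extensions $A \hookrightarrow B \twoheadrightarrow A'$ are finite. For $n \ge 0$ let $\mathcal S_n$ be the groupoid of diagrams $(A_{i,j})_{0\le i\le j\le n}$ in $\mathcal C$ with $A_{i,i} = 0$ (a fixed zero object), all maps $A_{i,j}\to A_{i,k}$ mono, all maps $A_{i,k}\to A_{j,k}$ epi and all squares biCartesian, and isomorphisms of such diagrams. A weakly monotone map $\{0,\dots,m\}\to\{0,\dots,n\}$ induces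 a functor $\mathcal S_n \to \mathcal S_m$; for $t\in\mathcal S_n$ write $t_{ij}\in \mathcal S_1$, $t_{ijk}\in\mathcal S_2$ for the images under the maps with values $i\le j$ and $i\le j\le k$. For a groupoid $\mathcal A$ let $\mathrm{Fun}(\mathcal A)$ be the category of functors from $\mathcal A$ to finite-dimensional complex vector spaces which are nonzero on only finitely many isomorphism classes. The pull-push functor along a span $\mathcal A \xleftarrow{L} \mathcal X \xrightarrow{R} \mathcal B$ is $R_!\circ L^* : \mathrm{Fun}(\mathcal A)\to\mathrm{Fun}(\mathcal B)$ (if it exists), where $L^*\varphi = \varphi\circ L \in \mathrm{Fun}(\mathcal X)$ and $R_!$ is (pointwise) left Kan extension along $R$; it is determined up to unique isomorphism. Let $\otimes: \mathrm{Fun}(\mathcal S_1)\times \mathrm{Fun}(\mathcal S_1)\to \mathrm{Fun}(\mathcal S_1)$ be the pointwise tensor product $(\varphi\boxtimes\psi)(a,b)=\varphi(a)\otimes\psi(b)$ followed by pull-push along $$\mathcal S_1\times \mathcal S_1 \longleftarrow \mathcal S_2 \longrightarrow \mathcal S_1,\qquad (t_{01},t_{12}) \longleftarrow t \longrightarrow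 t_{02},$$ and let $I\in \mathrm{Fun}(\mathcal S_1)$ be the image of $\mathbb C$ under pull-push along $\mathcal S_0 \xleftarrow{\mathrm{id}} \mathcal S_0 \xrightarrow{\sigma_0}\mathcal S_1$, where $\sigma_0$ is the degeneracy. **Theorem.** Let $\mathcal C$ be a finitary proto-abelian category. Then the pull-push functors along the two spans above, and along the span $\mathcal S_1\times\mathcal S_1\times\mathcal S_1\leftarrow \mathcal S_3\to \mathcal S_1$, $(t_{01},t_{12},t_{23})\leftarrow t\to t_{03}$, exist, and, for any choice of the first two, the datum $(\mathrm{Fun}(\mathcal S_1),\otimes, I)$ naturally extends to a monoidal structure on the category $\mathrm{Fun}(\mathcal S_1)$. More precisely, there is a monoidal structure with tensor product bifunctor $\otimes$ and unit object $I$ such that: * For all $\varphi,\psi,\xi$, let $\varphi\otimes\psi\otimes\xi$ be the pull-push of $\varphi\boxtimes\psi\boxtimes\xi$ along $\mathcal S_1^3\leftarrow \mathcal S_3\to\mathcal S_1$ (for any choice of this pull-push functor). Then there are isomorphisms $$(\varphi\otimes\psi)\otimes\xi \xleftarrow{\ \alpha_1\ }\varphi\otimes\psi\otimes\xi\xrightarrow{\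 \alpha_2\ }\varphi\otimes(\psi\otimes\xi)$$ such that, for all $t\in \mathcal S_3$, precomposing $\alpha_1$ and $\alpha_2$ at $t_{03}$ with the structure map $\varphi(t_{01})\otimes\psi(t_{12})\otimes\xi(t_{23})\to(\varphi\otimes\psi\otimes\xi)(t_{03})$ of the Kan extension gives the composites of the structure maps at the triangles $t_{012}, t_{023}$ and at $t_{123}, t_{013}$, respectively. The associator is $\alpha_2\circ\alpha_1^{-1}$. * The left and right unitors are compatible with degenerate triangles: for every $a \in \mathcal S_1$, the composites $\mathbb C\otimes\varphi(a)\to I(a_{00})\otimes\varphi(a_{01})\to (I\otimes\varphi)(a_{01})\to\varphi(a)$ and $\varphi(a)\otimes\mathbb C\to\varphi(a_{01})\otimes I(a_{11})\to(\varphi\otimes I)(a_{01})\to\varphi(a)$ of the structure maps of the Kan extensions at the degenerate triangles $a_{001}$, $a_{011}$ with the unitors are the canonical isomorphisms. -/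

import Mathlib

open CategoryTheory CategoryTheory.Limits MonoidalCategory
open scoped ZeroObject

universe v u v₁ u₁ v₂ u₂ v₃ u₃

noncomputable section

namespace HallMonoidal

/-! ### Finitary proto-abelian categories -/

section ProtoAbelian

variable (C : Type u) [Category.{v} C]

/-- A proto-abelian category: it is pointed, spans consisting of a mono and an epi can be completed
to pushout squares and cospans consisting of a mono and an epi can be completed to pullback squares,
in both cases with parallel sides mono resp. epi, and a commutative square with two parallel
mono sides and two parallel epi sides is a pushout iff it is a pullback. -/
class ProtoAbelian : Prop extends HasZeroObject C where
  exists_isPushout : ∀ {A B A' : C} (i : A ⟶ B) (p : A ⟶ A'), Mono i → Epi p →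
    ∃ (D : C) (q : B ⟶ D) (j : A' ⟶ D), Epi q ∧ Mono j ∧ IsPushout i p q j
  exists_isPullback : ∀ {B A' D : C} (q : B ⟶ D) (j : A' ⟶ D), Epi q → Mono j →
    ∃ (A : C) (i : A ⟶ B) (p : A ⟶ A'), Mono i ∧ Epi p ∧ IsPullback i p q j
  isPushout_iff_isPullback : ∀ {A B A' D : C} (i : A ⟶ B) (p : A ⟶ A') (q : B ⟶ D) (j : A' ⟶ D),
    Mono i → Epi p → Epi q → Mono j → CommSq i p q j → (IsPushout i p q j ↔ IsPullback i p q j)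

variable {C}

/-- An extension `A ↪ B ↠ A'` of `A'` by `A`, that is, a pushout square with sides
`A ↪ B`, `A ↠ 0`, `B ↠ A'`, `0 ↪ A'`. -/
structure Extension [HasZeroObject C] (A' A : C) where
  mid : C
  inl : A ⟶ mid
  proj : mid ⟶ A'
  mono : Mono inl
  epi : Epi proj
  isPushout : IsPushout inl ((isZero_zero C).from_ A) proj ((isZero_zero C).to_ A')

/-- Two extensions are equivalent if there is an isomorphism between the middle objects which is
compatible with the identities of `A` and `A'`. -/
def Extension.Equivalent [HasZeroObject C] {A' A : C} (E E' : Extension A' A) : Prop :=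
  ∃ e : E.mid ≅ E'.mid, E.inl ≫ e.hom = E'.inl ∧ e.hom ≫ E'.proj = E.proj

/-- The set `Ext(A', A)` of equivalence classes of extensions. -/
def ExtSet [HasZeroObject C] (A' A : C) : Type (max u v) :=
  Quot (Extension.Equivalent (A' := A') (A := A))

variable (C)

/-- A proto-abelian category is finitary if all the sets `Hom(A', A)` and `Ext(A', A)` are finite. -/
class Finitary [ProtoAbelian C] : Prop where
  finite_hom : ∀ A' A : C, Finite (A' ⟶ A)
  finite_ext : ∀ A' A : C, Finite (ExtSet A' A)

end ProtoAbelian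

/-! ### The groupoids of flags -/

section Flags

/-- The poset of pairs `i ≤ j` in `{0, …, n}`, with `(i, j) ≤ (i', j')` iff `i ≤ i'` and
`j ≤ j'`; it indexes the entries `A_{i,j}` of a flag. -/
abbrev Pairs (n : ℕ) : Type := {p : Fin (n + 1) × Fin (n + 1) // p.1 ≤ p.2}

/-- The pair `(i, j)`. -/
abbrev Pairs.mk {n : ℕ} (i j : Fin (n + 1)) (h : i ≤ j) : Pairs n := ⟨(i, j), h⟩

/-- The arrow `(i, j) ⟶ (i', j')`. -/
abbrev Pairs.arrow {n : ℕ} {i j i' j' : Fin (n + 1)} (h : i ≤ j) (h' : i' ≤ j')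
    (hi : i ≤ i') (hj : j ≤ j') : Pairs.mk i j h ⟶ Pairs.mk i' j' h' :=
  homOfLE (show (⟨(i, j), h⟩ : Pairs n) ≤ ⟨(i', j'), h'⟩ from ⟨hi, hj⟩)

variable (C : Type u) [Category.{v} C] [HasZeroObject C]

/-- The diagrams `A` of the shape of a flag of length `n`: the diagonal entries `A_{i,i}` are the
fixed zero object, the horizontal maps `A_{i,j} ⟶ A_{i,k}` are mono, the vertical maps
`A_{i,k} ⟶ A_{j,k}` are epi, and all squares are biCartesian. -/
structure IsFlag {n : ℕ} (A : Pairs n ⥤ C) : Prop where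
  zero : ∀ i, A.obj (Pairs.mk i i le_rfl) = (0 : C)
  mono : ∀ i j k (hij : i ≤ j) (hjk : j ≤ k),
    Mono (A.map (Pairs.arrow hij (hij.trans hjk) le_rfl hjk))
  epi : ∀ i j k (hij : i ≤ j) (hjk : j ≤ k),
    Epi (A.map (Pairs.arrow (hij.trans hjk) hjk hij le_rfl))
  isPushout : ∀ i j k l (hij : i ≤ j) (hjk : j ≤ k) (hkl : k ≤ l),
    IsPushout (A.map (Pairs.arrow (hij.trans hjk) ((hij.trans hjk).trans hkl) le_rfl hkl))
      (A.map (Pairs.arrow (hij.trans hjk) hjk hij le_rfl))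
      (A.map (Pairs.arrow ((hij.trans hjk).trans hkl) (hjk.trans hkl) hij le_rfl))
      (A.map (Pairs.arrow hjk (hjk.trans hkl) le_rfl hkl))
  isPullback : ∀ i j k l (hij : i ≤ j) (hjk : j ≤ k) (hkl : k ≤ l),
    IsPullback (A.map (Pairs.arrow (hij.trans hjk) ((hij.trans hjk).trans hkl) le_rfl hkl))
      (A.map (Pairs.arrow (hij.trans hjk) hjk hij le_rfl))
      (A.map (Pairs.arrow ((hij.trans hjk).trans hkl) (hjk.trans hkl) hij le_rfl))
      (A.map (Pairs.arrow hjk (hjk.trans hkl) le_rfl hkl))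

/-- The property of being a flag. -/
def flagProperty (n : ℕ) : ObjectProperty (Pairs n ⥤ C) := fun A => IsFlag C A

/-- The groupoid `S_n` of flags of length `n`: the maximal groupoid in the category of flags. -/
abbrev S (n : ℕ) : Type (max u v) := Core (flagProperty C n).FullSubcategory

variable {C}

/-- The functor on pairs induced by a weakly monotone map. -/
def pairsMap {m n : ℕ} (f : Fin (m + 1) →o Fin (n + 1)) : Pairs m ⥤ Pairs n :=
  Monotone.functor (f := fun p : Pairs m => (⟨(f p.1.1, f p.1.2), f.monotone p.2⟩ : Pairs n))
    (fun _ _ h => ⟨f.monotone h.1, f.monotone h.2⟩)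

theorem IsFlag.restrict {m n : ℕ} (f : Fin (m + 1) →o Fin (n + 1)) {A : Pairs n ⥤ C}
    (hA : IsFlag C A) : IsFlag C (pairsMap f ⋙ A) where
  zero i := hA.zero (f i)
  mono i j k hij hjk := hA.mono (f i) (f j) (f k) (f.monotone hij) (f.monotone hjk)
  epi i j k hij hjk := hA.epi (f i) (f j) (f k) (f.monotone hij) (f.monotone hjk)
  isPushout i j k l hij hjk hkl :=
    hA.isPushout (f i) (f j) (f k) (f l) (f.monotone hij) (f.monotone hjk) (f.monotone hkl)
  isPullback i j k l hij hjk hkl :=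
    hA.isPullback (f i) (f j) (f k) (f l) (f.monotone hij) (f.monotone hjk) (f.monotone hkl)

/-- The simplicial structure of the groupoids of flags: a weakly monotone map
`f : {0, …, m} → {0, …, n}` induces the functor `S_n ⥤ S_m`, `A ↦ (A_{f i, f j})`. -/
def restrict {m n : ℕ} (f : Fin (m + 1) →o Fin (n + 1)) : S C n ⥤ S C m :=
  ((flagProperty C m).lift
    ((flagProperty C n).ι ⋙ (Functor.whiskeringLeft _ _ C).obj (pairsMap f))
    (fun A => IsFlag.restrict f A.property)).core

/-- The map `{0} → {0, …, n}` with image `i`. -/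
def vertexMap {n : ℕ} (i : Fin (n + 1)) : Fin 1 →o Fin (n + 1) := ⟨fun _ => i, fun _ _ _ => le_rfl⟩

/-- The map `{0, 1} → {0, …, n}` with values `i ≤ j`. -/
def edgeMap {n : ℕ} (i j : Fin (n + 1)) (hij : i ≤ j) : Fin 2 →o Fin (n + 1) :=
  ⟨![i, j], by intro a b h; fin_cases a <;> fin_cases b <;> simp_all⟩

/-- The map `{0, 1, 2} → {0, …, n}` with values `i ≤ j ≤ k`. -/
def triangleMap {n : ℕ} (i j k : Fin (n + 1)) (hij : i ≤ j) (hjk : j ≤ k) :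
    Fin 3 →o Fin (n + 1) :=
  ⟨![i, j, k], by
    intro a b h; have := hij.trans hjk; fin_cases a <;> fin_cases b <;> simp_all⟩

/-- The edge `t_{ij} ∈ S_1` of a flag `t ∈ S_n`, for `i ≤ j`. -/
abbrev edge {n : ℕ} (t : S C n) (i j : Fin (n + 1)) (hij : i ≤ j) : S C 1 :=
  (restrict (edgeMap i j hij)).obj t

/-- The triangle `t_{ijk} ∈ S_2` of a flag `t ∈ S_n`, for `i ≤ j ≤ k`. -/
abbrev triangle {n : ℕ} (t : S C n) (i j k : Fin (n + 1)) (hij : i ≤ j) (hjk : j ≤ k) : S C 2 :=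
  (restrict (triangleMap i j k hij hjk)).obj t

theorem edge_triangle_01 {n : ℕ} (t : S C n) (i j k : Fin (n + 1)) (hij : i ≤ j) (hjk : j ≤ k) :
    edge (triangle t i j k hij hjk) 0 1 (by decide) = edge t i j hij := by
  have h : (triangleMap i j k hij hjk).comp (edgeMap 0 1 (by decide)) = edgeMap i j hij := by
    ext x; fin_cases x <;> rfl
  exact congrArg (fun f => (restrict f).obj t) h

theorem edge_triangle_12 {n : ℕ} (t : S C n) (i j k : Fin (n + 1)) (hij : i ≤ j) (hjk : j ≤ k) :
    edge (triangle t i j k hij hjk) 1 2 (by decide) = edge t j k hjk := by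
  have h : (triangleMap i j k hij hjk).comp (edgeMap 1 2 (by decide)) = edgeMap j k hjk := by
    ext x; fin_cases x <;> rfl
  exact congrArg (fun f => (restrict f).obj t) h

theorem edge_triangle_02 {n : ℕ} (t : S C n) (i j k : Fin (n + 1)) (hij : i ≤ j) (hjk : j ≤ k) :
    edge (triangle t i j k hij hjk) 0 2 (by decide) = edge t i k (hij.trans hjk) := by
  have h : (triangleMap i j k hij hjk).comp (edgeMap 0 2 (by decide)) =
      edgeMap i k (hij.trans hjk) := by
    ext x; fin_cases x <;> rfl
  exact congrArg (fun f => (restrict f).obj t) h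

/-- The degeneracy `σ_0 : S_0 ⥤ S_1`. -/
abbrev degeneracy : S C 0 ⥤ S C 1 := restrict (edgeMap 0 0 le_rfl)

theorem degeneracy_vertex {n : ℕ} (t : S C n) (i : Fin (n + 1)) :
    degeneracy.obj ((restrict (vertexMap i)).obj t) = edge t i i le_rfl := by
  have h : (vertexMap i).comp (edgeMap 0 0 le_rfl) = edgeMap i i le_rfl := by
    ext x; fin_cases x <;> rfl
  exact congrArg (fun f => (restrict f).obj t) h

variable (C)

/-- The functor `S_2 ⥤ S_1 × S_1`, `t ↦ (t_{01}, t_{12})`. -/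
abbrev outerEdges : S C 2 ⥤ S C 1 × S C 1 :=
  (restrict (edgeMap 0 1 (by decide))).prod' (restrict (edgeMap 1 2 (by decide)))

/-- The functor `S_2 ⥤ S_1`, `t ↦ t_{02}`. -/
abbrev innerEdge : S C 2 ⥤ S C 1 := restrict (edgeMap 0 2 (by decide))

/-- The functor `S_3 ⥤ S_1 × S_1 × S_1`, `t ↦ (t_{01}, t_{12}, t_{23})`. -/
abbrev outerEdges₃ : S C 3 ⥤ S C 1 × S C 1 × S C 1 :=
  (restrict (edgeMap 0 1 (by decide))).prod'
    ((restrict (edgeMap 1 2 (by decide))).prod' (restrict (edgeMap 2 3 (by decide))))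

/-- The functor `S_3 ⥤ S_1`, `t ↦ t_{03}`. -/
abbrev innerEdge₃ : S C 3 ⥤ S C 1 := restrict (edgeMap 0 3 (by decide))

theorem isomorphic_of_S_zero (s t : S C 0) : Nonempty (s ≅ t) := by
  have hz : ∀ (r : S C 0) (x : Pairs 0), r.of.obj.obj x = (0 : C) := by
    intro r x
    obtain ⟨⟨i, j⟩, h⟩ := x
    obtain rfl : i = j := Subsingleton.elim (α := Fin 1) _ _
    exact r.of.property.zero i
  refine ⟨Core.isoMk (ObjectProperty.isoMk _ (NatIso.ofComponents
    (fun x => eqToIso ((hz s x).trans (hz t x).symm)) ?_))⟩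
  intro x y f
  exact ((isZero_zero C).of_iso (eqToIso (hz t y))).eq_of_tgt _ _

end Flags

/-! ### Finitely supported functors -/

/-- The category of finite-dimensional complex vector spaces. -/
abbrev VectC : Type 1 := FGModuleCat.{0} ℂ

section Fun

/-- The functors to finite-dimensional complex vector spaces which are nonzero on only finitely many
isomorphism classes. -/
def finiteSupport (A : Type u₁) [Category.{v₁} A] : ObjectProperty (A ⥤ VectC) :=
  fun φ => {x : Quotient (isIsomorphicSetoid A) |
    ∃ a : A, Quotient.mk (isIsomorphicSetoid A) a = x ∧ Nontrivial (φ.obj a)}.Finite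

/-- The category `Fun(A)` for a groupoid `A`. -/
abbrev Fun (A : Type u₁) [Category.{v₁} A] := (finiteSupport A).FullSubcategory

variable {A : Type u₁} [Category.{v₁} A] {B : Type u₂} [Category.{v₂} B]
  {X : Type u₃} [Category.{v₃} X]

theorem finiteSupport_box (φ : Fun A) (ψ : Fun B) :
    finiteSupport (A × B) (φ.obj.prod ψ.obj ⋙ tensor VectC) := by
  have hφ := φ.property
  have hψ := ψ.property
  refine ((hφ.prod hψ).image (fun p => Quotient.map₂ (sc := isIsomorphicSetoid (A × B))
    (fun a b => ((a, b) : A × B)) ?_ p.1 p.2)).subset ?_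
  · rintro a a' ⟨e⟩ b b' ⟨e'⟩
    exact ⟨e.prod e'⟩
  · rintro _ ⟨⟨a, b⟩, rfl, hab⟩
    refine ⟨(Quotient.mk _ a, Quotient.mk _ b), ⟨⟨a, rfl, ?_⟩, ⟨b, rfl, ?_⟩⟩, rfl⟩
    · by_contra h
      rw [not_nontrivial_iff_subsingleton] at h
      have : Subsingleton (TensorProduct ℂ (φ.obj.obj a) (ψ.obj.obj b)) := inferInstance
      exact not_subsingleton_iff_nontrivial.mpr hab this
    · by_contra h
      rw [not_nontrivial_iff_subsingleton] at h
      have : Subsingleton (TensorProduct ℂ (φ.obj.obj a) (ψ.obj.obj b)) := inferInstance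
      exact not_subsingleton_iff_nontrivial.mpr hab this

/-- The pointwise tensor product `(φ ⊠ ψ)(a, b) = φ(a) ⊗ ψ(b)` of functors. -/
abbrev boxObj (φ : Fun A) (ψ : Fun B) : Fun (A × B) :=
  ⟨φ.obj.prod ψ.obj ⋙ tensor VectC, finiteSupport_box φ ψ⟩

/-- The pointwise tensor product as a functor `Fun(A) × Fun(B) ⥤ Fun(A × B)`. -/
def box : Fun A × Fun B ⥤ Fun (A × B) where
  obj p := boxObj p.1 p.2
  map f := ObjectProperty.homMk
    (Functor.whiskerRight (NatTrans.prod f.1.hom f.2.hom) (tensor VectC))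

/-- A pull-push functor `R_! ∘ L^* : Fun(A) ⥤ Fun(B)` along a span `A ← X → B`: the functor `L^*`
sends `φ` to `L ⋙ φ`, which is required to have finite support again, and `R_!` is given by
pointwise left Kan extension along `R`, exhibited by the natural transformation `unit`. -/
structure PullPush (L : X ⥤ A) (R : X ⥤ B) where
  functor : Fun A ⥤ Fun B
  finiteSupport_pullback : ∀ φ : Fun A, finiteSupport X (L ⋙ φ.obj)
  unit : ∀ φ : Fun A, L ⋙ φ.obj ⟶ R ⋙ (functor.obj φ).obj
  unit_naturality : ∀ {φ ψ : Fun A} (f : φ ⟶ ψ),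
    unit φ ≫ Functor.whiskerLeft R (functor.map f).hom = Functor.whiskerLeft L f.hom ≫ unit ψ
  isPointwiseLeftKanExtension : ∀ φ : Fun A,
    Nonempty (Functor.LeftExtension.mk (functor.obj φ).obj (unit φ)).IsPointwiseLeftKanExtension

end Fun

/-! ### The Hall tensor product -/

section Hall

variable (C : Type u) [Category.{v} C] [HasZeroObject C]

/-- The object `ℂ` of `Fun(S_0)`. -/
def scalars : Fun (S C 0) :=
  ⟨(Functor.const _).obj (𝟙_ VectC), by
    have : Subsingleton (Quotient (isIsomorphicSetoid (S C 0))) := by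
      refine ⟨fun x y => ?_⟩
      induction x using Quotient.ind
      induction y using Quotient.ind
      exact Quotient.sound (isomorphic_of_S_zero C _ _)
    exact Set.toFinite _⟩

/-- The datum `(Fun(S_1), ⊗, I)`: pull-push functors along the spans
`S_1 × S_1 ← S_2 → S_1` and `S_0 ← S_0 → S_1`. Since left Kan extensions are determined only up
to unique isomorphism, a datum is a choice of such functors. -/
structure HallDatum where
  mul : PullPush (outerEdges C) (innerEdge C)
  one : PullPush (𝟭 (S C 0)) (degeneracy (C := C))

variable {C}

namespace HallDatum

variable (D : HallDatum C)

/-- The functor `⊗ : Fun(S_1) × Fun(S_1) ⥤ Fun(S_1)`. -/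
def tensorFunctor : Fun (S C 1) × Fun (S C 1) ⥤ Fun (S C 1) := box ⋙ D.mul.functor

/-- The tensor product `φ ⊗ ψ` on objects. -/
abbrev tens (φ ψ : Fun (S C 1)) : Fun (S C 1) := D.tensorFunctor.obj (φ, ψ)

/-- The unit object `I`, the value at `ℂ` of the pull-push functor `Fun(S_0) ⥤ Fun(S_1)`. -/
def unitObj : Fun (S C 1) := D.one.functor.obj (scalars C)

/-- The structure map `φ(t_{ij}) ⊗ ψ(t_{jk}) ⟶ (φ ⊗ ψ)(t_{ik})` of the Kan extension `φ ⊗ ψ`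
at the triangle `t_{ijk}` of a flag `t ∈ S_n`. -/
def mulMap (φ ψ : Fun (S C 1)) {n : ℕ} (t : S C n) (i j k : Fin (n + 1)) (hij : i ≤ j)
    (hjk : j ≤ k) :
    φ.obj.obj (edge t i j hij) ⊗ ψ.obj.obj (edge t j k hjk) ⟶
      (D.tens φ ψ).obj.obj (edge t i k (hij.trans hjk)) :=
  (φ.obj.map (eqToHom (edge_triangle_01 t i j k hij hjk).symm) ⊗ₘ
    ψ.obj.map (eqToHom (edge_triangle_12 t i j k hij hjk).symm)) ≫
  (D.mul.unit (boxObj φ ψ)).app (triangle t i j k hij hjk) ≫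
  (D.tens φ ψ).obj.map (eqToHom (edge_triangle_02 t i j k hij hjk))

/-- The structure map `ℂ ⟶ I(t_{ii})` of the Kan extension `I` at the vertex `i` of a flag
`t ∈ S_n`. -/
def oneMap {n : ℕ} (t : S C n) (i : Fin (n + 1)) :
    𝟙_ VectC ⟶ D.unitObj.obj.obj (edge t i i le_rfl) :=
  (D.one.unit (scalars C)).app ((restrict (vertexMap i)).obj t) ≫
    D.unitObj.obj.map (eqToHom (degeneracy_vertex t i))

/-- The data of a monoidal structure on `Fun(S_1)` with tensor product bifunctor `⊗`, unit `I`,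
and the given associators and unitors. -/
@[reducible]
def monoidalStruct
    (α : ∀ φ ψ ξ : Fun (S C 1), D.tens (D.tens φ ψ) ξ ≅ D.tens φ (D.tens ψ ξ))
    (l : ∀ φ : Fun (S C 1), D.tens D.unitObj φ ≅ φ)
    (r : ∀ φ : Fun (S C 1), D.tens φ D.unitObj ≅ φ) :
    MonoidalCategoryStruct (Fun (S C 1)) where
  tensorObj φ ψ := D.tens φ ψ
  whiskerLeft φ _ _ f := D.tensorFunctor.map (Prod.mkHom (𝟙 φ) f)
  whiskerRight f ψ := D.tensorFunctor.map (Prod.mkHom f (𝟙 ψ))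
  tensorHom f g := D.tensorFunctor.map (Prod.mkHom f g)
  tensorUnit := D.unitObj
  associator := α
  leftUnitor := l
  rightUnitor := r

/-- The threefold tensor product `φ ⊗ ψ ⊗ ξ`, defined by a pull-push functor `P` along the span
`S_1 × S_1 × S_1 ← S_3 → S_1`. -/
abbrev triple (P : PullPush (outerEdges₃ C) (innerEdge₃ C)) (φ ψ ξ : Fun (S C 1)) :
    Fun (S C 1) :=
  P.functor.obj (boxObj φ (boxObj ψ ξ))

/-- The structure map `φ(t_{01}) ⊗ (ψ(t_{12}) ⊗ ξ(t_{23})) ⟶ (φ ⊗ ψ ⊗ ξ)(t_{03})`. -/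
abbrev tripleMap (P : PullPush (outerEdges₃ C) (innerEdge₃ C)) (φ ψ ξ : Fun (S C 1))
    (t : S C 3) :
    φ.obj.obj (edge t 0 1 (by decide)) ⊗
        (ψ.obj.obj (edge t 1 2 (by decide)) ⊗ ξ.obj.obj (edge t 2 3 (by decide))) ⟶
      (triple P φ ψ ξ).obj.obj (edge t 0 3 (by decide)) :=
  (P.unit (boxObj φ (boxObj ψ ξ))).app t

/-- `a : φ ⊗ ψ ⊗ ξ ⟶ (φ ⊗ ψ) ⊗ ξ` is the map induced by the functor
`t ↦ (t_{012}, t_{023})` from `S_3` to `S_{012} ×_{S_{02}} S_{023}`. -/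
def IsLeftComparison (P : PullPush (outerEdges₃ C) (innerEdge₃ C)) (φ ψ ξ : Fun (S C 1))
    (a : triple P φ ψ ξ ⟶ D.tens (D.tens φ ψ) ξ) : Prop :=
  ∀ t : S C 3,
    tripleMap P φ ψ ξ t ≫ a.hom.app (edge t 0 3 (by decide)) =
      (α_ _ _ _).inv ≫
        (D.mulMap φ ψ t 0 1 2 (by decide) (by decide) ▷
          ξ.obj.obj (edge t 2 3 (by decide))) ≫
        D.mulMap (D.tens φ ψ) ξ t 0 2 3 (by decide) (by decide)

/-- `a : φ ⊗ ψ ⊗ ξ ⟶ φ ⊗ (ψ ⊗ ξ)` is the map induced by the functor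
`t ↦ (t_{013}, t_{123})` from `S_3` to `S_{013} ×_{S_{13}} S_{123}`. -/
def IsRightComparison (P : PullPush (outerEdges₃ C) (innerEdge₃ C)) (φ ψ ξ : Fun (S C 1))
    (a : triple P φ ψ ξ ⟶ D.tens φ (D.tens ψ ξ)) : Prop :=
  ∀ t : S C 3,
    tripleMap P φ ψ ξ t ≫ a.hom.app (edge t 0 3 (by decide)) =
      (φ.obj.obj (edge t 0 1 (by decide)) ◁
          D.mulMap ψ ξ t 1 2 3 (by decide) (by decide)) ≫
        D.mulMap φ (D.tens ψ ξ) t 0 1 3 (by decide) (by decide)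

/-- `l : I ⊗ φ ⟶ φ` is the map induced by the degenerate triangles `a_{001}`, `a ∈ S_1`. -/
def IsLeftUnit (φ : Fun (S C 1)) (l : D.tens D.unitObj φ ⟶ φ) : Prop :=
  ∀ a : S C 1,
    (D.oneMap a 0 ▷ φ.obj.obj (edge a 0 1 (by decide))) ≫
        D.mulMap D.unitObj φ a 0 0 1 (by decide) (by decide) ≫
        l.hom.app (edge a 0 1 (by decide)) =
      (λ_ (φ.obj.obj (edge a 0 1 (by decide)))).hom

/-- `r : φ ⊗ I ⟶ φ` is the map induced by the degenerate triangles `a_{011}`, `a ∈ S_1`. -/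
def IsRightUnit (φ : Fun (S C 1)) (r : D.tens φ D.unitObj ⟶ φ) : Prop :=
  ∀ a : S C 1,
    (φ.obj.obj (edge a 0 1 (by decide)) ◁ D.oneMap a 1) ≫
        D.mulMap φ D.unitObj a 0 1 1 (by decide) (by decide) ≫
        r.hom.app (edge a 0 1 (by decide)) =
      (ρ_ (φ.obj.obj (edge a 0 1 (by decide)))).hom

end HallDatum

end Hall

end HallMonoidal

end

open HallMonoidal

/-!
The category `Fun(S_1)` is monoidal because the simplicial groupoid `S` satisfies Segal-type
conditions: `S_3` is the homotopy pullback of two copies of `S_2` over `S_1` for each of the two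
ways of cutting a square into triangles, and `S_1` is the homotopy pullback of `S_2` and `S_0` over
`S_1` on either side.

*Flags.* A flag is determined by its first row, a chain of monomorphisms
`0 → A_{0,1} → ⋯ → A_{0,n}`: the entry `A_{i,j}` is the quotient of `A_{0,j}` by `A_{0,i}`. Every
such chain occurs (`exists_flag`), and morphisms of flags are the same as morphisms of chains
(`IsFlag.hom_ext`, `IsFlag.exists_extend`). Triangles sharing an edge are therefore glued by
composing chains (`exists_glue_left`); the other gluing, along a quotient, uses pullbacks
(`exists_glue_right`). The resulting squares of groupoids are Guitart exact.

*Existence.* The functors `t ↦ t_{02}` and `t ↦ t_{03}` are faithful, so that the comma categories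
in the formula for the pointwise left Kan extension are thin groupoids, and on functors of finite
support the colimits are finite direct sums (`hasPointwiseLeftKanExtension`). Pullback preserves
finite support because there are finitely many extensions and finitely many isomorphisms along which
to glue (`finiteFibers_outerEdges`, `finiteFibers_outerEdges₃`).

*Associator and unitors.* Since `- ⊗ W` preserves colimits, left Kan extension along functors to
groupoids commutes with tensoring (`isLeftKanExtension_diagUnit`). Combined with base change along
the exact squares, this shows that `(φ ⊗ ψ) ⊗ ξ` and `φ ⊗ (ψ ⊗ ξ)` are both left Kan extensions of
`φ ⊠ ψ ⊠ ξ` along `S_3 ⥤ S_1`, with the structure maps prescribed by the faces of a tetrahedron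
(`exists_isLeftKanExtension_tens_left`, `exists_isLeftKanExtension_tens_right`), and likewise that
`I ⊗ φ` and `φ ⊗ I` are left Kan extensions of `φ`. The associator and the unitors are the unique
comparison maps.

*Axioms.* Morphisms out of iterated products are determined by their composites with the structure
maps at flags (`tens_hom_ext`, `tens_tens_hom_ext`, `tens_tens_tens_hom_ext`). The equations
characterizing associators and unitors hold at all tetrahedra and edges of a flag, degenerate or not
(`mulMap_assoc`, `mulMap_leftUnit`, `mulMap_rightUnit`). The pentagon then follows from the five
tetrahedra of a flag in `S_4`, and the triangle from the degenerate tetrahedron `s_{0112}` of a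
triangle `s`.
-/

universe v₄ u₄ v₅ u₅

namespace HallMonoidal

noncomputable section

/-! ### Flags and chains of monomorphisms -/

section Rows

variable {C : Type u} [Category.{v} C]

/-- The entry `(0, j)` of the first row. -/
abbrev Pairs.row {n : ℕ} (j : Fin (n + 1)) : Pairs n := Pairs.mk 0 j (Fin.zero_le j)

/-- The arrow `(0, j) ⟶ (0, k)` of the first row. -/
abbrev Pairs.rowMap {n : ℕ} {j k : Fin (n + 1)} (h : j ≤ k) :
    (Pairs.row j : Pairs n) ⟶ Pairs.row k :=
  Pairs.arrow (Fin.zero_le j) (Fin.zero_le k) le_rfl h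

theorem IsFlag.isZero [HasZeroObject C] {n : ℕ} {A : Pairs n ⥤ C} (hA : IsFlag C A)
    (i : Fin (n + 1)) : IsZero (A.obj (Pairs.mk i i le_rfl)) :=
  (isZero_zero C).of_iso (eqToIso (hA.zero i))

/-- The map from the first row to an entry `(i, j)`. -/
abbrev rowArrow {n : ℕ} (p : Pairs n) : Pairs.row p.1.2 ⟶ p :=
  homOfLE ⟨Fin.zero_le _, le_rfl⟩

theorem IsFlag.epi_rowArrow [HasZeroObject C] {n : ℕ} {A : Pairs n ⥤ C} (hA : IsFlag C A)
    (p : Pairs n) : Epi (A.map (rowArrow p)) :=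
  hA.epi 0 p.1.1 p.1.2 (Fin.zero_le _) p.2

/-- Maps of flags agree if they agree on the first row, because all entries are quotients of
entries of the first row. -/
theorem IsFlag.hom_ext [HasZeroObject C] {n : ℕ} {A B : Pairs n ⥤ C} (hA : IsFlag C A)
    {f g : A ⟶ B} (h : ∀ j, f.app (Pairs.row j) = g.app (Pairs.row j)) : f = g := by
  ext p
  have := hA.epi_rowArrow p
  rw [← cancel_epi (A.map (rowArrow p)), f.naturality, g.naturality, h]

/-- A map of first rows of flags extends to the flags: the entry `(i, j)` is the pushout of
`A_{0,j} ← A_{0,i} → 0`. -/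
theorem IsFlag.exists_extend [HasZeroObject C] {n : ℕ} {A B : Pairs n ⥤ C} (hA : IsFlag C A)
    (hB : IsFlag C B) (g : ∀ j : Fin (n + 1), A.obj (Pairs.row j) ⟶ B.obj (Pairs.row j))
    (hg : ∀ (j k : Fin (n + 1)) (h : j ≤ k),
      A.map (Pairs.rowMap h) ≫ g k = g j ≫ B.map (Pairs.rowMap h)) :
    ∃ f : A ⟶ B, ∀ j, f.app (Pairs.row j) = g j := by
  have key : ∀ p : Pairs n, ∃ f : A.obj p ⟶ B.obj p,
      A.map (rowArrow p) ≫ f = g p.1.2 ≫ B.map (rowArrow p) := by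
    rintro ⟨⟨i, j⟩, hij⟩
    dsimp at hij
    have sq := hA.isPushout 0 i i j (Fin.zero_le i) le_rfl hij
    refine ⟨sq.desc (g j ≫ B.map (rowArrow ⟨(i, j), hij⟩))
      ((hA.isZero i).to_ _) ?_, sq.inl_desc _ _ _⟩
    have h2 := hg i j hij
    rw [← Category.assoc, h2, Category.assoc, ← B.map_comp]
    have h3 : Pairs.rowMap hij ≫
        rowArrow ⟨(i, j), hij⟩ = Pairs.arrow (Fin.zero_le i) (le_refl i) (Fin.zero_le i) le_rfl ≫
          Pairs.arrow (le_refl i) hij le_rfl hij := Subsingleton.elim _ _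
    rw [h3, B.map_comp, ← Category.assoc]
    have h4 : IsZero (B.obj (Pairs.mk i i le_rfl)) := hB.isZero i
    rw [h4.eq_of_tgt (g i ≫
        B.map (Pairs.arrow (Fin.zero_le i) (le_refl i) (Fin.zero_le i) le_rfl))
      (A.map (Pairs.arrow (Fin.zero_le i) (le_refl i) (Fin.zero_le i) le_rfl) ≫
        (hA.isZero i).to_ _), Category.assoc]
    congr 1
    exact (hA.isZero i).eq_of_src _ _
  choose f hf using key
  refine ⟨⟨f, fun p q u => ?_⟩, fun j => ?_⟩
  · have := hA.epi_rowArrow p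
    rw [← cancel_epi (A.map (rowArrow p)), reassoc_of% (hf p), ← A.map_comp_assoc,
      ← B.map_comp]
    have hu : p.1.2 ≤ q.1.2 := (leOfHom u).2
    have e : rowArrow p ≫ u = Pairs.rowMap hu ≫ rowArrow q := Subsingleton.elim _ _
    rw [e, A.map_comp, B.map_comp, Category.assoc, hf q, reassoc_of% (hg _ _ hu)]
  · have e : rowArrow (Pairs.row j : Pairs n) = 𝟙 _ := Subsingleton.elim _ _
    have := hf (Pairs.row j)
    rw [e, A.map_id, B.map_id, Category.id_comp] at this
    exact this.trans (Category.comp_id _)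

theorem epi_of_isZero {X Y : C} (hY : IsZero Y) (f : X ⟶ Y) : Epi f :=
  ⟨fun _ _ _ => hY.eq_of_src _ _⟩

theorem mono_of_isZero {X Y : C} (hX : IsZero X) (f : X ⟶ Y) : Mono f :=
  ⟨fun _ _ _ => hX.eq_of_tgt _ _⟩

theorem isIso_of_isZero {X Y : C} (hX : IsZero X) (hY : IsZero Y) (f : X ⟶ Y) : IsIso f :=
  ⟨hY.to_ X, hX.eq_of_src _ _, hY.eq_of_src _ _⟩

/-- The axiom provides one pushout with mono and epi sides, so all pushouts have such sides. -/
theorem ProtoAbelian.mono_epi_of_isPushout [ProtoAbelian C] {A B A' D : C} {i : A ⟶ B}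
    {p : A ⟶ A'} {q : B ⟶ D} {j : A' ⟶ D} (sq : IsPushout i p q j) [hi : Mono i] [hp : Epi p] :
    Mono j ∧ Epi q := by
  obtain ⟨D', q', j', hq', hj', sq'⟩ := ProtoAbelian.exists_isPushout i p hi hp
  have hj : j' ≫ (sq'.isoIsPushout _ _ sq).hom = j := sq'.inr_isoIsPushout_hom _ _ sq
  have hq : q' ≫ (sq'.isoIsPushout _ _ sq).hom = q := sq'.inl_isoIsPushout_hom _ _ sq
  exact ⟨hj ▸ inferInstance, hq ▸ inferInstance⟩

/-- In a chain indexed by `{0, …, n}` all maps are mono as soon as the successive ones are. -/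
theorem mono_map_of_succ {n : ℕ} (F : Fin (n + 1) ⥤ C)
    (hF : ∀ i : Fin n, Mono (F.map (homOfLE (Fin.castSucc_lt_succ (i := i)).le)))
    {i j : Fin (n + 1)} (f : i ⟶ j) : Mono (F.map f) := by
  have hf : f = homOfLE (leOfHom f) := rfl
  rw [hf]
  generalize leOfHom f = h
  clear hf f
  induction j using Fin.induction with
  | zero =>
    obtain rfl : i = 0 := le_antisymm h (Fin.zero_le _)
    have : F.map (homOfLE h) = 𝟙 _ := F.map_id _
    rw [this]; infer_instance
  | succ j ih =>
    obtain rfl | hlt := eq_or_lt_of_le h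
    · have : F.map (homOfLE h) = 𝟙 _ := F.map_id _
      rw [this]; infer_instance
    · have hle : i ≤ j.castSucc := Fin.le_castSucc_iff.2 hlt
      have e : F.map (homOfLE h) = F.map (homOfLE hle) ≫
          F.map (homOfLE (Fin.castSucc_lt_succ (i := j)).le) := by rw [← F.map_comp]; rfl
      have := ih hle
      have := hF j
      rw [e]; exact mono_comp _ _

/-- Every chain of monomorphisms starting at a zero object is, up to isomorphism, the first row of
a flag. The entry `(i, j)` of the flag is the quotient of the `j`-th by the `i`-th object of the
chain; all squares are pushouts by pasting. -/
theorem exists_flag [ProtoAbelian C] {n : ℕ} (F : Fin (n + 1) ⥤ C) (h0 : IsZero (F.obj 0))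
    (hF : ∀ {i j : Fin (n + 1)} (f : i ⟶ j), Mono (F.map f)) :
    ∃ A : Pairs n ⥤ C, IsFlag C A ∧
      ∃ e : ∀ j, A.obj (Pairs.row j) ≅ F.obj j, ∀ (j k : Fin (n + 1)) (h : j ≤ k),
        A.map (Pairs.rowMap h) ≫ (e k).hom = (e j).hom ≫ F.map (homOfLE h) := by
  have hz := isZero_zero C
  have key : ∀ p : Pairs n, ∃ (Q : C) (q : F.obj p.1.2 ⟶ Q), (p.1.1 = p.1.2 → Q = 0) ∧
      IsPushout (F.map (homOfLE p.2)) (hz.from_ (F.obj p.1.1)) q (hz.to_ Q) := by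
    rintro ⟨⟨i, j⟩, hij⟩
    dsimp at hij ⊢
    obtain rfl | hne := eq_or_ne i j
    · refine ⟨0, hz.from_ _, fun _ => rfl, ?_⟩
      have : F.map (homOfLE (le_refl i)) = 𝟙 _ := F.map_id i
      rw [this]
      exact IsPushout.of_horiz_isIso ⟨hz.eq_of_tgt _ _⟩
    · obtain ⟨Q, q, j', -, -, sq⟩ := ProtoAbelian.exists_isPushout (F.map (homOfLE hij))
        (hz.from_ (F.obj i)) (hF _) (epi_of_isZero hz _)
      refine ⟨Q, q, fun h => (hne h).elim, ?_⟩
      rwa [hz.eq_of_src j' (hz.to_ Q)] at sq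
  choose Q q hQ sq using key
  have hq : ∀ p, Epi (q p) := fun p =>
    have := hF (homOfLE p.2)
    have := epi_of_isZero hz (hz.from_ (F.obj p.1.1))
    (ProtoAbelian.mono_epi_of_isPushout (sq p)).2
  have ex : ∀ (p p' : Pairs n) (u : p ⟶ p'), ∃ f : Q p ⟶ Q p',
      q p ≫ f = F.map (homOfLE (leOfHom u).2) ≫ q p' := by
    intro p p' u
    refine ⟨(sq p).desc (F.map (homOfLE (leOfHom u).2) ≫ q p') (hz.to_ _) ?_,
      (sq p).inl_desc _ _ _⟩
    have e : F.map (homOfLE p.2) ≫ F.map (homOfLE (leOfHom u).2) =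
        F.map (homOfLE (leOfHom u).1) ≫ F.map (homOfLE p'.2) := by
      rw [← F.map_comp, ← F.map_comp]; rfl
    rw [← Category.assoc, e, Category.assoc, (sq p').w, ← Category.assoc]
    congr 1
    exact hz.eq_of_tgt _ _
  choose m' hm' using ex
  let m {p p' : Pairs n} (u : p ⟶ p') : Q p ⟶ Q p' := m' p p' u
  have hm : ∀ {p p' : Pairs n} (u : p ⟶ p'), q p ≫ m u = F.map (homOfLE (leOfHom u).2) ≫ q p' :=
    fun {p p'} u => hm' p p' u
  let A : Pairs n ⥤ C :=
    { obj := Q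
      map := m
      map_id := fun p => by
        have e : F.map (homOfLE (leOfHom (𝟙 p)).2) = 𝟙 _ := F.map_id _
        rw [← cancel_epi (q p), hm, e, Category.id_comp, Category.comp_id]
      map_comp := fun {p p' p''} u w => by
        have e : F.map (homOfLE (leOfHom (u ≫ w)).2) =
            F.map (homOfLE (leOfHom u).2) ≫ F.map (homOfLE (leOfHom w).2) := by
          rw [← F.map_comp]; rfl
        rw [← cancel_epi (q p), hm, reassoc_of% (hm u), hm w, e, Category.assoc] }
  -- the square with vertices `F j`, `F k`, `A_{i,j}`, `A_{i,k}`
  have sqF : ∀ i j k (hij : i ≤ j) (hjk : j ≤ k),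
      IsPushout (F.map (homOfLE hjk)) (q (Pairs.mk i j hij)) (q (Pairs.mk i k (hij.trans hjk)))
        (m (Pairs.arrow hij (hij.trans hjk) le_rfl hjk)) := by
    intro i j k hij hjk
    have s1 := sq (Pairs.mk i j hij)
    have s2 := sq (Pairs.mk i k (hij.trans hjk))
    have e : F.map (homOfLE (Pairs.mk i k (hij.trans hjk)).2) =
        F.map (homOfLE hij) ≫ F.map (homOfLE hjk) := by rw [← F.map_comp]; rfl
    rw [e] at s2
    refine IsPushout.of_left ?_ (hm (Pairs.arrow hij (hij.trans hjk) le_rfl hjk)).symm s1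
    rwa [hz.eq_of_src (hz.to_ _ ≫ m _) (hz.to_ _)]
  have hmono : ∀ i j k (hij : i ≤ j) (hjk : j ≤ k),
      Mono (m (Pairs.arrow hij (hij.trans hjk) le_rfl hjk)) := fun i j k hij hjk =>
    have := hF (homOfLE hjk)
    have := hq (Pairs.mk i j hij)
    (ProtoAbelian.mono_epi_of_isPushout (sqF i j k hij hjk)).1
  have hepi : ∀ i j k (hij : i ≤ j) (hjk : j ≤ k),
      Epi (m (Pairs.arrow (hij.trans hjk) hjk hij le_rfl)) := by
    intro i j k hij hjk
    have e := hm (Pairs.arrow (hij.trans hjk) hjk hij le_rfl)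
    have e' : F.map (homOfLE (leOfHom (Pairs.arrow (hij.trans hjk) hjk hij (le_refl k))).2) = 𝟙 _ :=
      F.map_id _
    rw [e', Category.id_comp] at e
    have := hq (Pairs.mk j k hjk)
    have : Epi (q (Pairs.mk i k (hij.trans hjk)) ≫
        m (Pairs.arrow (hij.trans hjk) hjk hij le_rfl)) := by rw [e]; infer_instance
    exact epi_of_epi (q (Pairs.mk i k (hij.trans hjk))) _
  have hpush : ∀ i j k l (hij : i ≤ j) (hjk : j ≤ k) (hkl : k ≤ l),
    IsPushout (m (Pairs.arrow (hij.trans hjk) ((hij.trans hjk).trans hkl) le_rfl hkl))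
      (m (Pairs.arrow (hij.trans hjk) hjk hij le_rfl))
      (m (Pairs.arrow ((hij.trans hjk).trans hkl) (hjk.trans hkl) hij le_rfl))
      (m (Pairs.arrow hjk (hjk.trans hkl) le_rfl hkl)) := by
    intro i j k l hij hjk hkl
    refine IsPushout.of_top (h₁₁ := F.map (homOfLE hkl)) (v₁₁ := q (Pairs.mk i k (hij.trans hjk)))
      (v₁₂ := q (Pairs.mk i l ((hij.trans hjk).trans hkl))) ?_ ?_ (sqF i k l (hij.trans hjk) hkl)
    · have e1 : q (Pairs.mk i k (hij.trans hjk)) ≫ m (Pairs.arrow (hij.trans hjk) hjk hij le_rfl) =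
          q (Pairs.mk j k hjk) := (hm _).trans ((congrArg (· ≫ _) (F.map_id _)).trans
            (Category.id_comp _))
      have e2 : q (Pairs.mk i l ((hij.trans hjk).trans hkl)) ≫
          m (Pairs.arrow ((hij.trans hjk).trans hkl) (hjk.trans hkl) hij le_rfl) =
          q (Pairs.mk j l (hjk.trans hkl)) := (hm _).trans ((congrArg (· ≫ _) (F.map_id _)).trans
            (Category.id_comp _))
      rw [e1, e2]
      exact sqF j k l hjk hkl
    · exact (A.map_comp (Pairs.arrow _ _ _ _) (Pairs.arrow _ _ _ _)).symm.trans
        (A.map_comp (Pairs.arrow (hij.trans hjk) hjk hij le_rfl)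
          (Pairs.arrow hjk (hjk.trans hkl) le_rfl hkl))
  refine ⟨A, ⟨fun i => hQ _ rfl, hmono, hepi, hpush, fun i j k l hij hjk hkl => ?_⟩, ?_⟩
  · exact (ProtoAbelian.isPushout_iff_isPullback _ _ _ _ (hmono _ _ _ _ _) (hepi _ _ _ _ _)
      (hepi _ _ _ _ _) (hmono _ _ _ _ _) (hpush i j k l hij hjk hkl).toCommSq).1
        (hpush i j k l hij hjk hkl)
  · have hiso : ∀ j, IsIso (q (Pairs.row j)) := fun j => by
      have : IsIso (hz.from_ (F.obj 0)) := ⟨h0.from_ _, h0.eq_of_src _ _, hz.eq_of_src _ _⟩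
      exact (sq (Pairs.row j)).isIso_inl_of_isIso
    refine ⟨fun j => (@asIso _ _ _ _ _ (hiso j)).symm, fun j k h => ?_⟩
    have := hiso j
    have := hiso k
    have e : q (Pairs.row j) ≫ A.map (Pairs.rowMap h) = F.map (homOfLE h) ≫ q (Pairs.row k) :=
      hm (Pairs.rowMap h)
    simp only [Iso.symm_hom, asIso_inv]
    rw [IsIso.comp_inv_eq, Category.assoc, ← e, IsIso.inv_hom_id_assoc]

end Rows

/-! ### Isomorphisms of flags in terms of their entries -/

section Entries

variable {C : Type u} [Category.{v} C] [HasZeroObject C]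

namespace S

variable {n : ℕ}

/-- The entry `A_{i,j}` of a flag. -/
abbrev ent (t : S C n) (i j : Fin (n + 1)) (h : i ≤ j := by decide) : C :=
  t.of.obj.obj (Pairs.mk i j h)

/-- The map `A_{i,j} ⟶ A_{k,l}` between entries of a flag. -/
abbrev entMap (t : S C n) (i j k l : Fin (n + 1)) (h : i ≤ j := by decide)
    (h' : k ≤ l := by decide) (hi : i ≤ k := by decide) (hj : j ≤ l := by decide) :
    t.ent i j h ⟶ t.ent k l h' :=
  t.of.obj.map (Pairs.arrow h h' hi hj)

/-- The component of an isomorphism of flags at the entry `(i, j)`. -/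
def comp {t t' : S C n} (u : t ⟶ t') (i j : Fin (n + 1)) (h : i ≤ j := by decide) :
    t.ent i j h ⟶ t'.ent i j h :=
  u.iso.hom.hom.app (Pairs.mk i j h)

theorem comp_id (t : S C n) (i j : Fin (n + 1)) (h : i ≤ j) : S.comp (𝟙 t) i j h = 𝟙 _ := rfl

theorem comp_comp {t t' t'' : S C n} (u : t ⟶ t') (w : t' ⟶ t'') (i j : Fin (n + 1)) (h : i ≤ j) :
    S.comp (u ≫ w) i j h = S.comp u i j h ≫ S.comp w i j h := rfl

theorem comp_naturality {t t' : S C n} (u : t ⟶ t') (i j k l : Fin (n + 1)) (h : i ≤ j)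
    (h' : k ≤ l) (hi : i ≤ k) (hj : j ≤ l) :
    t.entMap i j k l h h' hi hj ≫ S.comp u k l h' = S.comp u i j h ≫ t'.entMap i j k l h h' hi hj :=
  u.iso.hom.hom.naturality _

theorem comp_inv {t t' : S C n} (u : t ⟶ t') (i j : Fin (n + 1)) (h : i ≤ j) :
    S.comp u i j h ≫ S.comp (Groupoid.inv u) i j h = 𝟙 _ := by
  rw [← comp_comp, Groupoid.comp_inv, comp_id]

theorem inv_comp {t t' : S C n} (u : t ⟶ t') (i j : Fin (n + 1)) (h : i ≤ j) :
    S.comp (Groupoid.inv u) i j h ≫ S.comp u i j h = 𝟙 _ := by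
  rw [← comp_comp, Groupoid.inv_comp, comp_id]

instance {t t' : S C n} (u : t ⟶ t') (i j : Fin (n + 1)) (h : i ≤ j) : IsIso (S.comp u i j h) :=
  ⟨_, comp_inv u i j h, inv_comp u i j h⟩

theorem isZero_ent (t : S C n) (i : Fin (n + 1)) : IsZero (t.ent i i le_rfl) :=
  t.of.property.isZero i

theorem entMap_trans (t : S C n) (i j k l p q : Fin (n + 1)) (h : i ≤ j) (h' : k ≤ l) (h'' : p ≤ q)
    (hi : i ≤ k) (hj : j ≤ l) (hk : k ≤ p) (hl : l ≤ q) :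
    t.entMap i j k l h h' hi hj ≫ t.entMap k l p q h' h'' hk hl =
      t.entMap i j p q h h'' (hi.trans hk) (hj.trans hl) :=
  (t.of.obj.map_comp _ _).symm

theorem entMap_self (t : S C n) (i j : Fin (n + 1)) (h : i ≤ j) :
    t.entMap i j i j h h le_rfl le_rfl = 𝟙 _ :=
  t.of.obj.map_id _

/-- Isomorphisms of flags are determined by their components on the first row. -/
theorem hom_ext {t t' : S C n} {u w : t ⟶ t'}
    (h : ∀ j, S.comp u 0 j (Fin.zero_le j) = S.comp w 0 j (Fin.zero_le j)) : u = w :=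
  Core.hom_ext (ObjectProperty.hom_ext _ (t.of.property.hom_ext h))

/-- An isomorphism of the first rows of two flags extends to an isomorphism of the flags. -/
theorem exists_hom {t t' : S C n}
    (g : ∀ j, t.ent 0 j (Fin.zero_le j) ⟶ t'.ent 0 j (Fin.zero_le j)) [∀ j, IsIso (g j)]
    (hg : ∀ (j k : Fin (n + 1)) (h : j ≤ k),
      t.of.obj.map (Pairs.rowMap h) ≫ g k = g j ≫ t'.of.obj.map (Pairs.rowMap h)) :
    ∃ u : t ⟶ t', ∀ j, S.comp u 0 j (Fin.zero_le j) = g j := by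
  obtain ⟨f, hf⟩ := t.of.property.exists_extend t'.of.property g hg
  obtain ⟨f', hf'⟩ := t'.of.property.exists_extend t.of.property (fun j => inv (g j))
    (fun j k h => by rw [IsIso.comp_inv_eq, Category.assoc, hg, IsIso.inv_hom_id_assoc])
  have h1 : f ≫ f' = 𝟙 _ := t.of.property.hom_ext fun j => by
    rw [NatTrans.comp_app, hf, hf', IsIso.hom_inv_id]; rfl
  have h2 : f' ≫ f = 𝟙 _ := t'.of.property.hom_ext fun j => by
    rw [NatTrans.comp_app, hf, hf', IsIso.inv_hom_id]; rfl
  exact ⟨⟨ObjectProperty.isoMk _ ⟨f, f', h1, h2⟩⟩, hf⟩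

theorem hom_ext_one {t t' : S C 1} {u w : t ⟶ t'} (h : S.comp u 0 1 = S.comp w 0 1) : u = w := by
  refine hom_ext fun j => ?_
  match j with
  | 0 => exact (isZero_ent t 0).eq_of_src _ _
  | 1 => exact h

theorem hom_ext_two {t t' : S C 2} {u w : t ⟶ t'} (h : S.comp u 0 1 = S.comp w 0 1)
    (h' : S.comp u 0 2 = S.comp w 0 2) : u = w := by
  refine hom_ext fun j => ?_
  match j with
  | 0 => exact (isZero_ent t 0).eq_of_src _ _
  | 1 => exact h
  | 2 => exact h'

theorem hom_ext_three {t t' : S C 3} {u w : t ⟶ t'} (h : S.comp u 0 1 = S.comp w 0 1)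
    (h' : S.comp u 0 2 = S.comp w 0 2) (h'' : S.comp u 0 3 = S.comp w 0 3) : u = w := by
  refine hom_ext fun j => ?_
  match j with
  | 0 => exact (isZero_ent t 0).eq_of_src _ _
  | 1 => exact h
  | 2 => exact h'
  | 3 => exact h''

theorem rowMap_self_naturality {t t' : S C n} {j : Fin (n + 1)}
    (g : t.ent 0 j (Fin.zero_le j) ⟶ t'.ent 0 j (Fin.zero_le j)) :
    t.of.obj.map (Pairs.rowMap (le_refl j)) ≫ g = g ≫ t'.of.obj.map (Pairs.rowMap (le_refl j)) :=
  (congrArg (· ≫ g) (t.of.obj.map_id _)).trans ((Category.id_comp _).trans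
    ((congrArg (g ≫ ·) (t'.of.obj.map_id _)).trans (Category.comp_id _)).symm)

theorem exists_hom_one {t t' : S C 1} (g : t.ent 0 1 ⟶ t'.ent 0 1) (_ : IsIso g) :
    ∃ u : t ⟶ t', S.comp u 0 1 = g := by
  let G : ∀ j : Fin 2, t.ent 0 j (Fin.zero_le j) ⟶ t'.ent 0 j (Fin.zero_le j)
    | 0 => (isZero_ent t 0).to_ _
    | 1 => g
  have hG : ∀ j, IsIso (G j)
    | 0 => isIso_of_isZero (isZero_ent t 0) (isZero_ent t' 0) _
    | 1 => ‹_›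
  obtain ⟨u, hu⟩ := exists_hom G fun j k h => by
    match j, k, h with
    | 0, _, _ => exact (isZero_ent t 0).eq_of_src _ _
    | 1, 1, _ => exact rowMap_self_naturality (G 1)
  exact ⟨u, hu 1⟩

theorem exists_hom_two {t t' : S C 2} (g₁ : t.ent 0 1 ⟶ t'.ent 0 1) (g₂ : t.ent 0 2 ⟶ t'.ent 0 2)
    (i₁ : IsIso g₁) (i₂ : IsIso g₂) (w : t.entMap 0 1 0 2 ≫ g₂ = g₁ ≫ t'.entMap 0 1 0 2) :
    ∃ u : t ⟶ t', S.comp u 0 1 = g₁ ∧ S.comp u 0 2 = g₂ := by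
  let G : ∀ j : Fin 3, t.ent 0 j (Fin.zero_le j) ⟶ t'.ent 0 j (Fin.zero_le j)
    | 0 => (isZero_ent t 0).to_ _
    | 1 => g₁
    | 2 => g₂
  have hG : ∀ j, IsIso (G j)
    | 0 => isIso_of_isZero (isZero_ent t 0) (isZero_ent t' 0) _
    | 1 => ‹IsIso g₁›
    | 2 => ‹IsIso g₂›
  obtain ⟨u, hu⟩ := exists_hom G fun j k h => by
    match j, k, h with
    | 0, _, _ => exact (isZero_ent t 0).eq_of_src _ _
    | 1, 1, _ => exact rowMap_self_naturality (G 1)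
    | 1, 2, _ => exact w
    | 2, 2, _ => exact rowMap_self_naturality (G 2)
  exact ⟨u, hu 1, hu 2⟩

theorem exists_hom_three {t t' : S C 3} (g₁ : t.ent 0 1 ⟶ t'.ent 0 1)
    (g₂ : t.ent 0 2 ⟶ t'.ent 0 2) (g₃ : t.ent 0 3 ⟶ t'.ent 0 3) (i₁ : IsIso g₁) (i₂ : IsIso g₂)
    (i₃ : IsIso g₃)
    (w : t.entMap 0 1 0 2 ≫ g₂ = g₁ ≫ t'.entMap 0 1 0 2)
    (w' : t.entMap 0 2 0 3 ≫ g₃ = g₂ ≫ t'.entMap 0 2 0 3) :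
    ∃ u : t ⟶ t', S.comp u 0 1 = g₁ ∧ S.comp u 0 2 = g₂ ∧ S.comp u 0 3 = g₃ := by
  let G : ∀ j : Fin 4, t.ent 0 j (Fin.zero_le j) ⟶ t'.ent 0 j (Fin.zero_le j)
    | 0 => (isZero_ent t 0).to_ _
    | 1 => g₁
    | 2 => g₂
    | 3 => g₃
  have hG : ∀ j, IsIso (G j)
    | 0 => isIso_of_isZero (isZero_ent t 0) (isZero_ent t' 0) _
    | 1 => ‹IsIso g₁›
    | 2 => ‹IsIso g₂›
    | 3 => ‹IsIso g₃›
  have w'' : t.entMap 0 1 0 3 ≫ g₃ = g₁ ≫ t'.entMap 0 1 0 3 := by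
    rw [← entMap_trans t 0 1 0 2 0 3 _ (by decide) _ (by decide) (by decide) (by decide)
      (by decide), Category.assoc, w', reassoc_of% w, entMap_trans]
  obtain ⟨u, hu⟩ := exists_hom G fun j k h => by
    match j, k, h with
    | 0, _, _ => exact (isZero_ent t 0).eq_of_src _ _
    | 1, 1, _ => exact rowMap_self_naturality (G 1)
    | 1, 2, _ => exact w
    | 1, 3, _ => exact w''
    | 2, 2, _ => exact rowMap_self_naturality (G 2)
    | 2, 3, _ => exact w'
    | 3, 3, _ => exact rowMap_self_naturality (G 3)
  exact ⟨u, hu 1, hu 2, hu 3⟩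

theorem comp_eqToHom {t t' : S C n} (e : t = t') (i j : Fin (n + 1)) (h : i ≤ j) :
    S.comp (eqToHom e) i j h = eqToHom (by rw [e]) := by
  subst e; rfl

end S

end Entries

/-! ### Gluing of flags -/

section Gluing

variable {C : Type u} [Category.{v} C] [ProtoAbelian C]

/-- A chain of monomorphisms `0 → X₁ → X₂ → X₃` is the first row of a flag. -/
theorem exists_flag_three {X₁ X₂ X₃ : C} (f : X₁ ⟶ X₂) (g : X₂ ⟶ X₃) [Mono f] [Mono g] :
    ∃ (t : S C 3) (e₁ : t.ent 0 1 ≅ X₁) (e₂ : t.ent 0 2 ≅ X₂) (e₃ : t.ent 0 3 ≅ X₃),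
      t.entMap 0 1 0 2 ≫ e₂.hom = e₁.hom ≫ f ∧ t.entMap 0 2 0 3 ≫ e₃.hom = e₂.hom ≫ g := by
  have hz := isZero_zero C
  let F : ComposableArrows C 3 := ComposableArrows.mk₃ (hz.to_ X₁) f g
  obtain ⟨A, hA, e, he⟩ := exists_flag F hz (fun u => mono_map_of_succ F (fun i => by
    match i with
    | 0 => exact mono_of_isZero hz _
    | 1 => exact ‹Mono f›
    | 2 => exact ‹Mono g›) u)
  exact ⟨⟨⟨A, hA⟩⟩, e 1, e 2, e 3, he 1 2 (by decide), he 2 3 (by decide)⟩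

/-- A chain of monomorphisms `0 → X₁ → X₂ → X₃ → X₄` is the first row of a flag. -/
theorem exists_flag_four {X₁ X₂ X₃ X₄ : C} (f : X₁ ⟶ X₂) (g : X₂ ⟶ X₃) (h : X₃ ⟶ X₄)
    [Mono f] [Mono g] [Mono h] :
    ∃ (t : S C 4) (e₁ : t.ent 0 1 ≅ X₁) (e₂ : t.ent 0 2 ≅ X₂) (e₃ : t.ent 0 3 ≅ X₃)
      (e₄ : t.ent 0 4 ≅ X₄),
      t.entMap 0 1 0 2 ≫ e₂.hom = e₁.hom ≫ f ∧ t.entMap 0 2 0 3 ≫ e₃.hom = e₂.hom ≫ g ∧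
        t.entMap 0 3 0 4 ≫ e₄.hom = e₃.hom ≫ h := by
  have hz := isZero_zero C
  let F : ComposableArrows C 4 := ComposableArrows.mk₄ (hz.to_ X₁) f g h
  obtain ⟨A, hA, e, he⟩ := exists_flag F hz (fun u => mono_map_of_succ F (fun i => by
    match i with
    | 0 => exact mono_of_isZero hz _
    | 1 => exact ‹Mono f›
    | 2 => exact ‹Mono g›
    | 3 => exact ‹Mono h›) u)
  exact ⟨⟨⟨A, hA⟩⟩, e 1, e 2, e 3, e 4, he 1 2 (by decide), he 2 3 (by decide),
    he 3 4 (by decide)⟩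

theorem S.mono_entMap {n : ℕ} (t : S C n) (i j k : Fin (n + 1)) (hij : i ≤ j) (hjk : j ≤ k) :
    Mono (t.entMap i j i k hij (hij.trans hjk) le_rfl hjk) :=
  t.of.property.mono i j k hij hjk

theorem S.epi_entMap {n : ℕ} (t : S C n) (i j k : Fin (n + 1)) (hij : i ≤ j) (hjk : j ≤ k) :
    Epi (t.entMap i k j k (hij.trans hjk) hjk hij le_rfl) :=
  t.of.property.epi i j k hij hjk

theorem edge_eq_left (t : S C 3) :
    (restrict (edgeMap 0 2 (by decide))).obj
      ((restrict (triangleMap 0 1 2 (by decide) (by decide))).obj t) =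
      (restrict (edgeMap 0 1 (by decide))).obj
      ((restrict (triangleMap 0 2 3 (by decide) (by decide))).obj t) :=
  (edge_triangle_02 t 0 1 2 _ _).trans (edge_triangle_01 t 0 2 3 _ _).symm

theorem edge_eq_right (t : S C 3) :
    (restrict (edgeMap 0 2 (by decide))).obj
      ((restrict (triangleMap 1 2 3 (by decide) (by decide))).obj t) =
      (restrict (edgeMap 1 2 (by decide))).obj
      ((restrict (triangleMap 0 1 3 (by decide) (by decide))).obj t) :=
  (edge_triangle_02 t 1 2 3 _ _).trans (edge_triangle_12 t 0 1 3 _ _).symm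

/-- The identity of the edge `t_{02}`, which is shared by the faces `t_{012}` and `t_{023}`. -/
def leftGlue (t : S C 3) :
    (restrict (edgeMap 0 2 (by decide))).obj
        ((restrict (triangleMap 0 1 2 (by decide) (by decide))).obj t) ⟶
      (restrict (edgeMap 0 1 (by decide))).obj
        ((restrict (triangleMap 0 2 3 (by decide) (by decide))).obj t) :=
  eqToHom (edge_eq_left t)

theorem comp_leftGlue (t : S C 3) :
    S.comp (leftGlue t) 0 1 (Fin.zero_le 1) = 𝟙 (t.ent 0 2 (Fin.zero_le 2)) :=
  S.comp_eqToHom _ _ _ _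

/-- The identity of the edge `t_{13}`, which is shared by the faces `t_{123}` and `t_{013}`. -/
def rightGlue (t : S C 3) :
    (restrict (edgeMap 0 2 (by decide))).obj
        ((restrict (triangleMap 1 2 3 (by decide) (by decide))).obj t) ⟶
      (restrict (edgeMap 1 2 (by decide))).obj
        ((restrict (triangleMap 0 1 3 (by decide) (by decide))).obj t) :=
  eqToHom (edge_eq_right t)

theorem comp_rightGlue (t : S C 3) (h : (1 : Fin 4) ≤ 3) :
    S.comp (rightGlue t) 0 1 (Fin.zero_le 1) = 𝟙 (t.ent 1 3 h) :=
  S.comp_eqToHom _ _ _ _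

/-- Two triangles `r`, `s` with `r_{02} ≅ s_{01}` are the faces `t_{012}`, `t_{023}` of a
tetrahedron. -/
theorem exists_glue_left (r s : S C 2)
    (e : (restrict (edgeMap 0 2 (by decide))).obj r ⟶ (restrict (edgeMap 0 1 (by decide))).obj s) :
    ∃ (t : S C 3) (p : (restrict (triangleMap 0 1 2 (by decide) (by decide))).obj t ⟶ r)
      (q : (restrict (triangleMap 0 2 3 (by decide) (by decide))).obj t ⟶ s),
      (restrict (edgeMap 0 2 (by decide))).map p ≫ e =
        leftGlue t ≫ (restrict (edgeMap 0 1 (by decide))).map q := by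
  let a : r.ent 0 1 ⟶ r.ent 0 2 := r.entMap 0 1 0 2
  let b : s.ent 0 1 ⟶ s.ent 0 2 := s.entMap 0 1 0 2
  have ha : Mono a := S.mono_entMap r 0 1 2 (by decide) (by decide)
  have hb : Mono b := S.mono_entMap s 0 1 2 (by decide) (by decide)
  let e' : r.ent 0 2 ⟶ s.ent 0 1 := S.comp e 0 1
  have : IsIso e' := inferInstanceAs (IsIso (S.comp e 0 1))
  -- the first row of `t` is `r_{01} → r_{02} ≅ s_{01} → s_{02}`
  obtain ⟨t, e₁, e₂, e₃, h₁, h₂⟩ := exists_flag_three a (e' ≫ b)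
  obtain ⟨p, hp₁, hp₂⟩ := S.exists_hom_two
    (t := (restrict (triangleMap 0 1 2 (by decide) (by decide))).obj t) (t' := r)
    e₁.hom e₂.hom e₁.isIso_hom e₂.isIso_hom h₁
  obtain ⟨q, hq₁, hq₂⟩ := S.exists_hom_two
    (t := (restrict (triangleMap 0 2 3 (by decide) (by decide))).obj t) (t' := s)
    (e₂.hom ≫ e') e₃.hom
    (inferInstance : IsIso (e₂.hom ≫ e')) e₃.isIso_hom (h₂.trans (Category.assoc _ _ _).symm)
  refine ⟨t, p, q, S.hom_ext_one ?_⟩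
  refine (S.comp_comp _ _ _ _ _).trans (Eq.trans ?_ (S.comp_comp _ _ _ _ _).symm)
  rw [comp_leftGlue]
  exact (congrArg (· ≫ e') hp₂).trans (hq₁.symm.trans (Category.id_comp _).symm)

/-- Two triangles `r`, `s` with `r_{02} ≅ s_{12}` are the faces `t_{123}`, `t_{013}` of a
tetrahedron. The entry `t_{02}` is the pullback of `s_{02} → s_{12} ≅ r_{02} ← r_{01}`. -/
theorem exists_glue_right (r s : S C 2)
    (e : (restrict (edgeMap 0 2 (by decide))).obj r ⟶ (restrict (edgeMap 1 2 (by decide))).obj s) :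
    ∃ (t : S C 3) (p : (restrict (triangleMap 1 2 3 (by decide) (by decide))).obj t ⟶ r)
      (q : (restrict (triangleMap 0 1 3 (by decide) (by decide))).obj t ⟶ s),
      (restrict (edgeMap 0 2 (by decide))).map p ≫ e =
        rightGlue t ≫ (restrict (edgeMap 1 2 (by decide))).map q := by
  let e' : r.ent 0 2 ⟶ s.ent 1 2 := S.comp e 0 1
  have : IsIso e' := inferInstanceAs (IsIso (S.comp e 0 1))
  let a : r.ent 0 1 ⟶ r.ent 0 2 := r.entMap 0 1 0 2
  let b : s.ent 0 1 ⟶ s.ent 0 2 := s.entMap 0 1 0 2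
  let c : s.ent 0 2 ⟶ s.ent 1 2 := s.entMap 0 2 1 2
  have ha : Mono a := S.mono_entMap r 0 1 2 (by decide) (by decide)
  have hb : Mono b := S.mono_entMap s 0 1 2 (by decide) (by decide)
  have hc : Epi c := S.epi_entMap s 0 1 2 (by decide) (by decide)
  have hz := S.isZero_ent s 1
  obtain ⟨X, f, k, hf, hk, sq⟩ := ProtoAbelian.exists_isPullback c (a ≫ e') hc (mono_comp _ _)
  -- the big pullback square of `s` factors through the pullback `X`
  have sqs : IsPullback b (hz.from_ _) c (hz.to_ _) := by
    have := s.of.property.isPullback 0 1 1 2 (by decide) (by decide) (by decide)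
    rwa [hz.eq_of_tgt (s.of.obj.map (Pairs.arrow _ _ _ _)) (hz.from_ _),
      hz.eq_of_src (s.of.obj.map (Pairs.arrow _ _ _ _)) (hz.to_ _)] at this
  have hcomm : b ≫ c = (hz.from_ _ ≫ hz.to_ (r.ent 0 1)) ≫ a ≫ e' := by
    rw [sqs.w, Category.assoc]
    congr 1
    exact hz.eq_of_src _ _
  let i : s.ent 0 1 ⟶ X := sq.lift b (hz.from_ _ ≫ hz.to_ (r.ent 0 1)) hcomm
  have hif : i ≫ f = b := sq.lift_fst _ _ _
  have hik : i ≫ k = hz.from_ _ ≫ hz.to_ (r.ent 0 1) := sq.lift_snd _ _ _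
  have hi : Mono i := by
    have : Mono (i ≫ f) := by rw [hif]; exact hb
    exact mono_of_mono i f
  have sqi : IsPullback i (hz.from_ _) k (hz.to_ _) := by
    refine IsPullback.of_right ?_ hik sq
    rwa [hif, hz.eq_of_src (hz.to_ _ ≫ a ≫ e') (hz.to_ _)]
  have sqi' := (ProtoAbelian.isPushout_iff_isPullback _ _ _ _ hi (epi_of_isZero hz _) hk
    (mono_of_isZero hz _) ⟨sqi.w⟩).2 sqi
  -- the first row of `t` is `s_{01} → X → s_{02}`
  obtain ⟨t, e₁, e₂, e₃, h₁, h₂⟩ := exists_flag_three i f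
  have h₃ : t.entMap 0 1 0 3 ≫ e₃.hom = e₁.hom ≫ b := by
    rw [← S.entMap_trans t 0 1 0 2 0 3 (by decide) (by decide) (by decide) (by decide) (by decide)
      (by decide) (by decide), Category.assoc, h₂, reassoc_of% h₁, hif]
  obtain ⟨q, hq₁, hq₂⟩ := S.exists_hom_two
    (t := (restrict (triangleMap 0 1 3 (by decide) (by decide))).obj t) (t' := s)
    e₁.hom e₃.hom e₁.isIso_hom e₃.isIso_hom h₃
  let q₁₂ : t.ent 1 3 ⟶ s.ent 1 2 := S.comp q 1 2
  have : IsIso q₁₂ := inferInstanceAs (IsIso (S.comp q 1 2))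
  have hq₁₂ : t.entMap 0 3 1 3 ≫ q₁₂ = e₃.hom ≫ c :=
    (S.comp_naturality q 0 2 1 2 (by decide) (by decide) (by decide) (by decide)).trans
      (congrArg (· ≫ c) hq₂)
  have hzt := S.isZero_ent t 1
  have sqt : IsPushout (t.entMap 0 1 0 2) (hzt.from_ _) (t.entMap 0 2 1 2) (hzt.to_ _) := by
    have := t.of.property.isPushout 0 1 1 2 (by decide) (by decide) (by decide)
    rwa [hzt.eq_of_tgt (t.of.obj.map (Pairs.arrow _ _ _ _)) (hzt.from_ _),
      hzt.eq_of_src (t.of.obj.map (Pairs.arrow _ _ _ _)) (hzt.to_ _)] at this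
  have sqt' : IsPushout i (hz.from_ _) (e₂.inv ≫ t.entMap 0 2 1 2) (hz.to_ _) :=
    sqt.of_iso e₁ e₂ (hzt.iso hz) (Iso.refl _) h₁ (hz.eq_of_tgt _ _) (by simp)
      (hzt.eq_of_src _ _)
  -- both `t_{12}` and `r_{01}` are the quotient of `X` by `s_{01}`
  let g₁ := sqt'.isoIsPushout _ _ sqi'
  have hg₁ : t.entMap 0 2 1 2 ≫ g₁.hom = e₂.hom ≫ k := by
    rw [← Iso.inv_comp_eq, ← Category.assoc]
    exact sqt'.inl_isoIsPushout_hom _ _ sqi'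
  let m : t.ent 1 2 ⟶ t.ent 1 3 := t.entMap 1 2 1 3
  have hm : t.entMap 0 2 1 2 ≫ m = t.entMap 0 2 1 3 := S.entMap_trans _ _ _ _ _ _ _ _ _ _ _ _ _ _
  have hw : m ≫ q₁₂ ≫ inv e' = g₁.hom ≫ a := by
    have := S.epi_entMap t 0 1 2 (by decide) (by decide)
    refine this.left_cancellation _ _ ?_
    rw [reassoc_of% hg₁, reassoc_of% hm,
      ← S.entMap_trans t 0 2 0 3 1 3 (by decide) (by decide) (by decide) (by decide) (by decide)
      (by decide) (by decide), Category.assoc, reassoc_of% hq₁₂, reassoc_of% h₂, reassoc_of% sq.w,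
      IsIso.hom_inv_id, Category.comp_id]
  obtain ⟨p, hp₁, hp₂⟩ := S.exists_hom_two
    (t := (restrict (triangleMap 1 2 3 (by decide) (by decide))).obj t) (t' := r)
    g₁.hom (q₁₂ ≫ inv e') g₁.isIso_hom
    (inferInstance : IsIso (q₁₂ ≫ inv e')) hw
  refine ⟨t, p, q, S.hom_ext_one ?_⟩
  refine (S.comp_comp _ _ _ _ _).trans (Eq.trans ?_ (S.comp_comp _ _ _ _ _).symm)
  rw [comp_rightGlue _ (by decide)]
  refine (congrArg (· ≫ e') hp₂).trans (Eq.trans ?_ (Category.id_comp _).symm)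
  exact (Category.assoc _ _ _).trans ((congrArg (q₁₂ ≫ ·) (IsIso.inv_hom_id e')).trans
    (Category.comp_id q₁₂))

/-- An isomorphism of flags `t`, `t'` of length three amounts to isomorphisms of the faces `t_{012}`
and `t_{023}` which agree on the edge `t_{02}`. -/
theorem exists_hom_glue_left {t t' : S C 3}
    (g : (restrict (triangleMap 0 1 2 (by decide) (by decide))).obj t ⟶
      (restrict (triangleMap 0 1 2 (by decide) (by decide))).obj t')
    (k : (restrict (triangleMap 0 2 3 (by decide) (by decide))).obj t ⟶
      (restrict (triangleMap 0 2 3 (by decide) (by decide))).obj t')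
    (h : (restrict (edgeMap 0 2 (by decide))).map g ≫ leftGlue t' =
      leftGlue t ≫ (restrict (edgeMap 0 1 (by decide))).map k) :
    ∃ u : t ⟶ t', (restrict (triangleMap 0 1 2 (by decide) (by decide))).map u = g ∧
      (restrict (triangleMap 0 2 3 (by decide) (by decide))).map u = k := by
  let g₁ : t.ent 0 1 ⟶ t'.ent 0 1 := S.comp g 0 1
  let g₂ : t.ent 0 2 ⟶ t'.ent 0 2 := S.comp g 0 2
  let k₁ : t.ent 0 2 ⟶ t'.ent 0 2 := S.comp k 0 1
  let k₂ : t.ent 0 3 ⟶ t'.ent 0 3 := S.comp k 0 2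
  have : IsIso g₁ := inferInstanceAs (IsIso (S.comp g 0 1))
  have : IsIso g₂ := inferInstanceAs (IsIso (S.comp g 0 2))
  have : IsIso k₂ := inferInstanceAs (IsIso (S.comp k 0 2))
  have hgk : g₂ = k₁ := by
    have := congrArg (fun x => S.comp x 0 1) h
    rw [S.comp_comp, S.comp_comp, comp_leftGlue, comp_leftGlue] at this
    exact (Category.comp_id g₂).symm.trans (this.trans (Category.id_comp k₁))
  obtain ⟨u, h₁, h₂, h₃⟩ := S.exists_hom_three (t := t) (t' := t') g₁ g₂ k₂ ‹_› ‹_› ‹_›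
    (S.comp_naturality g 0 1 0 2 _ (by decide) (by decide) (by decide))
    (by rw [hgk]; exact S.comp_naturality k 0 1 0 2 _ (by decide) (by decide) (by decide))
  exact ⟨u, S.hom_ext_two h₁ h₂, S.hom_ext_two (h₂.trans hgk) h₃⟩

/-- An isomorphism of flags `t`, `t'` of length three amounts to isomorphisms of the faces `t_{123}`
and `t_{013}` which agree on the edge `t_{13}`. -/
theorem exists_hom_glue_right {t t' : S C 3}
    (g : (restrict (triangleMap 1 2 3 (by decide) (by decide))).obj t ⟶
      (restrict (triangleMap 1 2 3 (by decide) (by decide))).obj t')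
    (k : (restrict (triangleMap 0 1 3 (by decide) (by decide))).obj t ⟶
      (restrict (triangleMap 0 1 3 (by decide) (by decide))).obj t')
    (h : (restrict (edgeMap 0 2 (by decide))).map g ≫ rightGlue t' =
      rightGlue t ≫ (restrict (edgeMap 1 2 (by decide))).map k) :
    ∃ u : t ⟶ t', (restrict (triangleMap 1 2 3 (by decide) (by decide))).map u = g ∧
      (restrict (triangleMap 0 1 3 (by decide) (by decide))).map u = k := by
  let g₁₂ : t.ent 1 2 ⟶ t'.ent 1 2 := S.comp g 0 1
  let g₁₃ : t.ent 1 3 ⟶ t'.ent 1 3 := S.comp g 0 2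
  let g₁₁ : t.ent 1 1 ⟶ t'.ent 1 1 := S.comp g 0 0
  let k₁ : t.ent 0 1 ⟶ t'.ent 0 1 := S.comp k 0 1
  let k₃ : t.ent 0 3 ⟶ t'.ent 0 3 := S.comp k 0 2
  let k₁₃ : t.ent 1 3 ⟶ t'.ent 1 3 := S.comp k 1 2
  have : IsIso g₁₂ := inferInstanceAs (IsIso (S.comp g 0 1))
  have : IsIso k₁₃ := inferInstanceAs (IsIso (S.comp k 1 2))
  have : IsIso k₁ := inferInstanceAs (IsIso (S.comp k 0 1))
  have : IsIso k₃ := inferInstanceAs (IsIso (S.comp k 0 2))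
  have hgk : g₁₃ = k₁₃ := by
    have := congrArg (fun x => S.comp x 0 1) h
    rw [S.comp_comp, S.comp_comp, comp_rightGlue _ (by decide),
      comp_rightGlue _ (by decide)] at this
    exact (Category.comp_id g₁₃).symm.trans (this.trans (Category.id_comp k₁₃))
  have nk₁ : t.entMap 0 1 0 3 ≫ k₃ = k₁ ≫ t'.entMap 0 1 0 3 :=
    S.comp_naturality k 0 1 0 2 (by decide) (by decide) (by decide) (by decide)
  have nk₃ : t.entMap 0 3 1 3 ≫ k₁₃ = k₃ ≫ t'.entMap 0 3 1 3 :=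
    S.comp_naturality k 0 2 1 2 (by decide) (by decide) (by decide) (by decide)
  have ng₂ : t.entMap 1 2 1 3 ≫ g₁₃ = g₁₂ ≫ t'.entMap 1 2 1 3 :=
    S.comp_naturality g 0 1 0 2 (by decide) (by decide) (by decide) (by decide)
  have ng₁ : t.entMap 1 1 1 2 ≫ g₁₂ = g₁₁ ≫ t'.entMap 1 1 1 2 :=
    S.comp_naturality g 0 0 0 1 (by decide) (by decide) (by decide) (by decide)
  have sq : IsPullback (t.entMap 0 2 0 3) (t.entMap 0 2 1 2) (t.entMap 0 3 1 3)
      (t.entMap 1 2 1 3) :=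
    t.of.property.isPullback 0 1 2 3 (by decide) (by decide) (by decide)
  have sq' : IsPullback (t'.entMap 0 2 0 3) (t'.entMap 0 2 1 2) (t'.entMap 0 3 1 3)
      (t'.entMap 1 2 1 3) :=
    t'.of.property.isPullback 0 1 2 3 (by decide) (by decide) (by decide)
  have sq₂ : IsPullback (t.entMap 0 2 0 3 ≫ k₃) (t.entMap 0 2 1 2 ≫ g₁₂) (t'.entMap 0 3 1 3)
      (t'.entMap 1 2 1 3) :=
    sq.of_iso (Iso.refl _) (asIso k₃) (asIso g₁₂) (asIso k₁₃) (by simp) (by simp) nk₃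
      (hgk ▸ ng₂ :)
  -- the component at `(0, 2)` is determined by the pullback property of that entry
  let h₂ := sq₂.isoIsPullback _ _ sq'
  have hf : h₂.hom ≫ t'.entMap 0 2 0 3 = t.entMap 0 2 0 3 ≫ k₃ := sq₂.isoIsPullback_hom_fst _ _ sq'
  have hs : h₂.hom ≫ t'.entMap 0 2 1 2 = t.entMap 0 2 1 2 ≫ g₁₂ :=
    sq₂.isoIsPullback_hom_snd _ _ sq'
  have hw : t.entMap 0 1 0 2 ≫ h₂.hom = k₁ ≫ t'.entMap 0 1 0 2 := by
    refine sq'.hom_ext ?_ ?_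
    · rw [Category.assoc, hf, ← Category.assoc, S.entMap_trans, Category.assoc, S.entMap_trans, nk₁]
    · rw [Category.assoc, hs, ← Category.assoc, S.entMap_trans, Category.assoc, S.entMap_trans,
        ← S.entMap_trans t 0 1 1 1 1 2 (by decide) (by decide) (by decide) (by decide) (by decide)
          (by decide) (by decide),
        ← S.entMap_trans t' 0 1 1 1 1 2 (by decide) (by decide) (by decide) (by decide) (by decide)
          (by decide) (by decide), Category.assoc, ng₁, ← Category.assoc, ← Category.assoc,
        (S.isZero_ent t' 1).eq_of_tgt (t.entMap 0 1 1 1 ≫ g₁₁) (k₁ ≫ t'.entMap 0 1 1 1)]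
  obtain ⟨u, hu₁, hu₂, hu₃⟩ := S.exists_hom_three (t := t) (t' := t') k₁ h₂.hom k₃ ‹_›
    h₂.isIso_hom ‹_› hw hf.symm
  have huk : (restrict (triangleMap 0 1 3 (by decide) (by decide))).map u = k :=
    S.hom_ext_two hu₁ hu₃
  refine ⟨u, S.hom_ext_two ?_ ?_, huk⟩
  · have := S.epi_entMap t 0 1 2 (by decide) (by decide)
    have key : t.entMap 0 2 1 2 ≫ S.comp u 1 2 = t.entMap 0 2 1 2 ≫ g₁₂ := by
      rw [S.comp_naturality u 0 2 1 2, hu₂, hs]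
    exact this.left_cancellation _ _ key
  · have key : S.comp u 1 3 = k₁₃ := congrArg (fun x => S.comp x 1 2) huk
    exact key.trans hgk.symm

end Gluing

/-! ### Exact squares of groupoids of flags -/

section

/-- A square of groupoids which is a homotopy pullback is exact: it suffices that objects and
isomorphisms can be glued. -/
theorem guitartExact_of_glue {X : Type u₁} [Groupoid.{v₁} X] {Z : Type u₂} [Groupoid.{v₂} Z]
    {Y : Type u₃} [Groupoid.{v₃} Y] {W : Type u₄} [Category.{v₄} W]
    {T : X ⥤ Z} {L : X ⥤ Y} {R : Z ⥤ W} {B : Y ⥤ W} (w : TwoSquare T L R B)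
    (c : ∀ x, R.obj (T.obj x) ⟶ B.obj (L.obj x)) (hc : ∀ x, w.app x = c x)
    (hobj : ∀ (z : Z) (y : Y) (e : R.obj z ⟶ B.obj y), ∃ (x : X) (p : T.obj x ⟶ z)
      (q : L.obj x ⟶ y), R.map p ≫ e = c x ≫ B.map q)
    (hhom : ∀ (x x' : X) (g : T.obj x ⟶ T.obj x') (k : L.obj x ⟶ L.obj x'),
      R.map g ≫ c x' = c x ≫ B.map k → ∃ h : x ⟶ x', T.map h = g ∧ L.map h = k) :
    w.GuitartExact := by
  rw [TwoSquare.guitartExact_iff_isConnected_rightwards]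
  intro z y e
  have : Nonempty (w.StructuredArrowRightwards e) := by
    obtain ⟨x, p, q, h⟩ := hobj z y e
    refine ⟨TwoSquare.StructuredArrowRightwards.mk w e x (inv p) q ?_⟩
    rw [hc, ← h, ← Functor.map_comp_assoc, IsIso.inv_hom_id, R.map_id, Category.id_comp]
  refine zigzag_isConnected fun f f' => ?_
  obtain ⟨x, a, b, hab, rfl⟩ := f.mk_surjective
  obtain ⟨x', a', b', hab', rfl⟩ := f'.mk_surjective
  obtain ⟨h, hT, hL⟩ := hhom x x' (inv a ≫ a') (b ≫ inv b') (by
    rw [← cancel_mono (B.map b'), ← cancel_epi (R.map a)]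
    simp only [Functor.map_comp, Functor.map_inv, Category.assoc, IsIso.hom_inv_id_assoc,
      IsIso.inv_hom_id, Category.comp_id]
    rw [← hc, ← hc]
    exact hab'.trans hab.symm)
  refine Zigzag.of_hom (StructuredArrow.homMk (CostructuredArrow.homMk h ?_) ?_)
  · change L.map h ≫ b' = b
    rw [hL, Category.assoc, IsIso.inv_hom_id, Category.comp_id]
  · ext
    change a ≫ T.map h = a'
    rw [hT, IsIso.hom_inv_id_assoc]

section Squares

variable (C : Type u) [Category.{v} C]

section

variable {C} [HasZeroObject C]

theorem restrict_map_eqToHom {m n : ℕ} {f g : Fin (m + 1) →o Fin (n + 1)} (h : f = g)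
    {t t' : S C n} (u : t ⟶ t') (e : (restrict f).obj t = (restrict g).obj t)
    (e' : (restrict f).obj t' = (restrict g).obj t') :
    (restrict f).map u ≫ eqToHom e' = eqToHom e ≫ (restrict g).map u := by
  subst h
  rw [eqToHom_refl, eqToHom_refl, Category.id_comp, Category.comp_id]

/-- The natural transformation between two composites of restriction functors along maps with equal
composites; its components are identities. -/
def restrictSquare {l m m' n : ℕ} (f : Fin (l + 1) →o Fin (m + 1)) (g : Fin (m + 1) →o Fin (n + 1))
    (f' : Fin (l + 1) →o Fin (m' + 1)) (g' : Fin (m' + 1) →o Fin (n + 1))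
    (h : g.comp f = g'.comp f')
    (e : ∀ t : S C n, (restrict f).obj ((restrict g).obj t) =
      (restrict f').obj ((restrict g').obj t)) :
    TwoSquare (restrict (C := C) g) (restrict g') (restrict f) (restrict f') :=
  TwoSquare.mk _ _ _ _ ⟨fun t => eqToHom (e t), fun t t' u => restrict_map_eqToHom h u (e t) (e t')⟩

theorem restrictSquare_app {l m m' n : ℕ} (f : Fin (l + 1) →o Fin (m + 1))
    (g : Fin (m + 1) →o Fin (n + 1)) (f' : Fin (l + 1) →o Fin (m' + 1))
    (g' : Fin (m' + 1) →o Fin (n + 1)) (h : g.comp f = g'.comp f')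
    (e : ∀ t : S C n, (restrict f).obj ((restrict g).obj t) =
      (restrict f').obj ((restrict g').obj t)) (t : S C n) :
    (restrictSquare f g f' g' h e).app t = eqToHom (e t) := rfl

variable (C)

end

variable [ProtoAbelian C]

/-- The square expressing that `S_3` is the groupoid of pairs of triangles `t_{012}`, `t_{023}`. -/
def squareLeft :=
  restrictSquare (C := C) (l := 1) (m := 2) (m' := 2) (n := 3)
    (edgeMap 0 2 (by decide)) (triangleMap 0 1 2 (by decide) (by decide)) (edgeMap 0 1 (by decide))
    (triangleMap 0 2 3 (by decide) (by decide)) (by ext x; fin_cases x <;> rfl) edge_eq_left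

instance : (squareLeft C).GuitartExact :=
  guitartExact_of_glue (squareLeft C) leftGlue
    (fun t => restrictSquare_app _ _ _ _ _ edge_eq_left t)
    exists_glue_left (fun _ _ => exists_hom_glue_left)

/-- The square expressing that `S_3` is the groupoid of pairs of triangles `t_{123}`, `t_{013}`. -/
def squareRight :=
  restrictSquare (C := C) (l := 1) (m := 2) (m' := 2) (n := 3)
    (edgeMap 0 2 (by decide)) (triangleMap 1 2 3 (by decide) (by decide)) (edgeMap 1 2 (by decide))
    (triangleMap 0 1 3 (by decide) (by decide)) (by ext x; fin_cases x <;> rfl) edge_eq_right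

instance : (squareRight C).GuitartExact :=
  guitartExact_of_glue (squareRight C) rightGlue
    (fun t => restrictSquare_app _ _ _ _ _ edge_eq_right t)
    exists_glue_right (fun _ _ => exists_hom_glue_right)

variable {C}

theorem edge_eq_left_unit (a : S C 1) :
    (restrict (edgeMap 0 0 le_rfl)).obj ((restrict (vertexMap 0)).obj a) =
      (restrict (edgeMap 0 1 (by decide))).obj
        ((restrict (triangleMap 0 0 1 (by decide) (by decide))).obj a) :=
  (degeneracy_vertex a 0).trans (edge_triangle_01 a 0 0 1 _ _).symm

theorem edge_eq_right_unit (a : S C 1) :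
    (restrict (edgeMap 0 0 le_rfl)).obj ((restrict (vertexMap 1)).obj a) =
      (restrict (edgeMap 1 2 (by decide))).obj
        ((restrict (triangleMap 0 1 1 (by decide) (by decide))).obj a) :=
  (degeneracy_vertex a 1).trans (edge_triangle_12 a 0 1 1 _ _).symm

/-- The identity of the degenerate edge `a_{00}`. -/
def leftUnitGlue (a : S C 1) :
    (restrict (edgeMap 0 0 le_rfl)).obj ((restrict (vertexMap 0)).obj a) ⟶
      (restrict (edgeMap 0 1 (by decide))).obj
        ((restrict (triangleMap 0 0 1 (by decide) (by decide))).obj a) :=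
  eqToHom (edge_eq_left_unit a)

/-- The identity of the degenerate edge `a_{11}`. -/
def rightUnitGlue (a : S C 1) :
    (restrict (edgeMap 0 0 le_rfl)).obj ((restrict (vertexMap 1)).obj a) ⟶
      (restrict (edgeMap 1 2 (by decide))).obj
        ((restrict (triangleMap 0 1 1 (by decide) (by decide))).obj a) :=
  eqToHom (edge_eq_right_unit a)

theorem S.subsingleton_hom_zero (t t' : S C 0) : Subsingleton (t ⟶ t') :=
  ⟨fun _ _ => S.hom_ext fun j => by
    obtain rfl : j = 0 := Subsingleton.elim (α := Fin 1) _ _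
    exact (S.isZero_ent t 0).eq_of_src _ _⟩

theorem S.isZero_degeneracy (z : S C 0) (h : (0 : Fin 2) ≤ 1) :
    IsZero (((restrict (edgeMap 0 0 le_rfl)).obj z).ent 0 1 h) :=
  S.isZero_ent z 0

theorem isZero_of_iso_degeneracy {z : S C 0} {b : S C 1}
    (e : (restrict (edgeMap 0 0 le_rfl)).obj z ⟶ b) (h : (0 : Fin 2) ≤ 1) :
    IsZero (b.ent 0 1 h) :=
  (S.isZero_degeneracy z h).of_iso (asIso (S.comp e 0 1 h)).symm

theorem S.isIso_entMap_of_isZero (y : S C 2) (hz : IsZero (y.ent 1 2)) :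
    IsIso (y.entMap 0 1 0 2) := by
  have sq := y.of.property.isPullback 0 1 1 2 (by decide) (by decide) (by decide)
  have := isIso_of_isZero (S.isZero_ent y 1) hz (y.entMap 1 1 1 2)
  exact sq.isIso_fst_of_isIso

/-- A triangle `y` with `y_{01} ≅ 0` is isomorphic to the degenerate triangle `a_{001}`, where
`a = y_{02}`. -/
theorem exists_glue_left_unit (z : S C 0) (y : S C 2)
    (e : (restrict (edgeMap 0 0 le_rfl)).obj z ⟶ (restrict (edgeMap 0 1 (by decide))).obj y) :
    ∃ (a : S C 1) (p : (restrict (vertexMap 0)).obj a ⟶ z)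
      (q : (restrict (triangleMap 0 0 1 (by decide) (by decide))).obj a ⟶ y),
      (restrict (edgeMap 0 0 le_rfl)).map p ≫ e =
        leftUnitGlue a ≫ (restrict (edgeMap 0 1 (by decide))).map q := by
  have hz : IsZero (y.ent 0 1) := isZero_of_iso_degeneracy e (by decide)
  let a : S C 1 := (restrict (edgeMap 0 2 (by decide))).obj y
  let τ : S C 2 := (restrict (triangleMap 0 0 1 (by decide) (by decide))).obj a
  have hτ : IsZero (τ.ent 0 1) := S.isZero_ent a 0
  let i : τ.ent 0 2 ⟶ y.ent 0 2 := 𝟙 (y.ent 0 2)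
  let o : τ.ent 0 1 ⟶ y.ent 0 1 := hτ.to_ _
  obtain ⟨p⟩ := isomorphic_of_S_zero C ((restrict (vertexMap 0)).obj a) z
  obtain ⟨q, -, -⟩ := S.exists_hom_two (t := τ) (t' := y) o i (isIso_of_isZero hτ hz _)
    (inferInstanceAs (IsIso (𝟙 (y.ent 0 2)))) (hτ.eq_of_src _ _)
  exact ⟨a, p.hom, q, S.hom_ext_one ((S.isZero_degeneracy _ _).eq_of_src _ _)⟩

theorem exists_hom_glue_left_unit {a a' : S C 1}
    (g : (restrict (vertexMap 0)).obj a ⟶ (restrict (vertexMap 0)).obj a')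
    (k : (restrict (triangleMap 0 0 1 (by decide) (by decide))).obj a ⟶
      (restrict (triangleMap 0 0 1 (by decide) (by decide))).obj a') :
    ∃ h : a ⟶ a', (restrict (vertexMap 0)).map h = g ∧
      (restrict (triangleMap 0 0 1 (by decide) (by decide))).map h = k := by
  let k' : a.ent 0 1 ⟶ a'.ent 0 1 := S.comp k 0 2
  obtain ⟨h, hh⟩ := S.exists_hom_one k' (inferInstanceAs (IsIso (S.comp k 0 2)))
  have hτ : IsZero (((restrict (triangleMap 0 0 1 (by decide) (by decide))).obj a).ent 0 1) :=
    S.isZero_ent a 0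
  exact ⟨h, (S.subsingleton_hom_zero _ _).elim _ _, S.hom_ext_two (hτ.eq_of_src _ _) hh⟩

/-- The square expressing that `S_1` is the groupoid of triangles `t` with `t_{01} = 0`. -/
def squareLeftUnit :=
  restrictSquare (C := C) (l := 1) (m := 0) (m' := 2) (n := 1)
    (edgeMap 0 0 le_rfl) (vertexMap 0) (edgeMap 0 1 (by decide))
    (triangleMap 0 0 1 (by decide) (by decide)) (by ext x; fin_cases x <;> rfl) edge_eq_left_unit

instance : (squareLeftUnit (C := C)).GuitartExact :=
  guitartExact_of_glue squareLeftUnit leftUnitGlue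
    (fun t => restrictSquare_app _ _ _ _ _ edge_eq_left_unit t)
    exists_glue_left_unit (fun _ _ g k _ => exists_hom_glue_left_unit g k)

/-- A triangle `y` with `y_{12} ≅ 0` is isomorphic to the degenerate triangle `a_{011}`, where
`a = y_{01}`. -/
theorem exists_glue_right_unit (z : S C 0) (y : S C 2)
    (e : (restrict (edgeMap 0 0 le_rfl)).obj z ⟶ (restrict (edgeMap 1 2 (by decide))).obj y) :
    ∃ (a : S C 1) (p : (restrict (vertexMap 1)).obj a ⟶ z)
      (q : (restrict (triangleMap 0 1 1 (by decide) (by decide))).obj a ⟶ y),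
      (restrict (edgeMap 0 0 le_rfl)).map p ≫ e =
        rightUnitGlue a ≫ (restrict (edgeMap 1 2 (by decide))).map q := by
  have hz : IsZero (y.ent 1 2) := isZero_of_iso_degeneracy e (by decide)
  let a : S C 1 := (restrict (edgeMap 0 1 (by decide))).obj y
  let τ : S C 2 := (restrict (triangleMap 0 1 1 (by decide) (by decide))).obj a
  let i : τ.ent 0 1 ⟶ y.ent 0 1 := 𝟙 (y.ent 0 1)
  let f : y.ent 0 1 ⟶ y.ent 0 2 := y.entMap 0 1 0 2
  let f' : τ.ent 0 2 ⟶ y.ent 0 2 := f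
  have ha : τ.entMap 0 1 0 2 ≫ f' = i ≫ f :=
    congrArg (· ≫ f) (S.entMap_self y 0 1 (by decide))
  obtain ⟨p⟩ := isomorphic_of_S_zero C ((restrict (vertexMap 1)).obj a) z
  obtain ⟨q, -, -⟩ := S.exists_hom_two (t := τ) (t' := y) i f'
    (inferInstanceAs (IsIso (𝟙 (y.ent 0 1)))) (S.isIso_entMap_of_isZero y hz) ha
  exact ⟨a, p.hom, q, S.hom_ext_one ((S.isZero_degeneracy _ _).eq_of_src _ _)⟩

theorem exists_hom_glue_right_unit {a a' : S C 1}
    (g : (restrict (vertexMap 1)).obj a ⟶ (restrict (vertexMap 1)).obj a')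
    (k : (restrict (triangleMap 0 1 1 (by decide) (by decide))).obj a ⟶
      (restrict (triangleMap 0 1 1 (by decide) (by decide))).obj a') :
    ∃ h : a ⟶ a', (restrict (vertexMap 1)).map h = g ∧
      (restrict (triangleMap 0 1 1 (by decide) (by decide))).map h = k := by
  let k' : a.ent 0 1 ⟶ a'.ent 0 1 := S.comp k 0 1
  obtain ⟨h, hh⟩ := S.exists_hom_one k' (inferInstanceAs (IsIso (S.comp k 0 1)))
  refine ⟨h, (S.subsingleton_hom_zero _ _).elim _ _, S.hom_ext_two hh ?_⟩
  let k₂ : a.ent 0 1 ⟶ a'.ent 0 1 := S.comp k 0 2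
  have h1 : a.entMap 0 1 0 1 ≫ k₂ = k' ≫ a'.entMap 0 1 0 1 :=
    S.comp_naturality k 0 1 0 2 (by decide) (by decide) (by decide) (by decide)
  rw [S.entMap_self, S.entMap_self, Category.id_comp, Category.comp_id] at h1
  exact hh.trans h1.symm

/-- The square expressing that `S_1` is the groupoid of triangles `t` with `t_{12} = 0`. -/
def squareRightUnit :=
  restrictSquare (C := C) (l := 1) (m := 0) (m' := 2) (n := 1)
    (edgeMap 0 0 le_rfl) (vertexMap 1) (edgeMap 1 2 (by decide))
    (triangleMap 0 1 1 (by decide) (by decide)) (by ext x; fin_cases x <;> rfl) edge_eq_right_unit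

instance : (squareRightUnit (C := C)).GuitartExact :=
  guitartExact_of_glue squareRightUnit rightUnitGlue
    (fun t => restrictSquare_app _ _ _ _ _ edge_eq_right_unit t)
    exists_glue_right_unit (fun _ _ g k _ => exists_hom_glue_right_unit g k)

instance : (innerEdge C).Faithful where
  map_injective {t t'} u w h := by
    have h2 : S.comp u 0 2 = S.comp w 0 2 := congrArg (fun x => S.comp x 0 1) h
    refine S.hom_ext_two ?_ h2
    have := S.mono_entMap t' 0 1 2 (by decide) (by decide)
    refine this.right_cancellation _ _ ?_
    rw [← S.comp_naturality u, ← S.comp_naturality w, h2]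

instance : (innerEdge₃ C).Faithful where
  map_injective {t t'} u w h := by
    have h3 : S.comp u 0 3 = S.comp w 0 3 := congrArg (fun x => S.comp x 0 1) h
    refine S.hom_ext_three ?_ ?_ h3
    · have := S.mono_entMap t' 0 1 3 (by decide) (by decide)
      refine this.right_cancellation _ _ ?_
      rw [← S.comp_naturality u, ← S.comp_naturality w, h3]
    · have := S.mono_entMap t' 0 2 3 (by decide) (by decide)
      refine this.right_cancellation _ _ ?_
      rw [← S.comp_naturality u, ← S.comp_naturality w, h3]

instance : (degeneracy (C := C)).Faithful where
  map_injective {t t'} u w _ := (S.subsingleton_hom_zero t t').elim u w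

/-- The map `{0, 1, 2, 3} → {0, …, n}` with values `i ≤ j ≤ k ≤ l`. -/
def tetrahedronMap {n : ℕ} (i j k l : Fin (n + 1)) (hij : i ≤ j) (hjk : j ≤ k) (hkl : k ≤ l) :
    Fin 4 →o Fin (n + 1) :=
  ⟨![i, j, k, l], by
    intro a b h
    have := hij.trans hjk
    have := hjk.trans hkl
    have := (hij.trans hjk).trans hkl
    fin_cases a <;> fin_cases b <;> simp_all⟩

/-- A tetrahedron `t` and a triangle `s` with `t_{03} ≅ s_{01}` are the faces `T_{0123}`, `T_{034}`
of a flag of length four. -/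
theorem exists_glue_four (t : S C 3) (s : S C 2)
    (e : (restrict (edgeMap 0 3 (by decide))).obj t ⟶ (restrict (edgeMap 0 1 (by decide))).obj s) :
    ∃ (T : S C 4)
      (p : (restrict (tetrahedronMap 0 1 2 3 (by decide) (by decide) (by decide))).obj T ⟶ t)
      (q : (restrict (triangleMap 0 3 4 (by decide) (by decide))).obj T ⟶ s)
      (h : edge ((restrict (tetrahedronMap 0 1 2 3 (by decide) (by decide) (by decide))).obj T) 0 3
        (by decide) = (restrict (edgeMap 0 1 (by decide))).obj
      ((restrict (triangleMap 0 3 4 (by decide) (by decide))).obj T)),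
      (restrict (edgeMap 0 3 (by decide))).map p ≫ e =
        eqToHom h ≫ (restrict (edgeMap 0 1 (by decide))).map q := by
  let a : t.ent 0 1 ⟶ t.ent 0 2 := t.entMap 0 1 0 2
  let b : t.ent 0 2 ⟶ t.ent 0 3 := t.entMap 0 2 0 3
  let c : s.ent 0 1 ⟶ s.ent 0 2 := s.entMap 0 1 0 2
  have ha : Mono a := S.mono_entMap t 0 1 2 (by decide) (by decide)
  have hb : Mono b := S.mono_entMap t 0 2 3 (by decide) (by decide)
  have hc : Mono c := S.mono_entMap s 0 1 2 (by decide) (by decide)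
  let e' : t.ent 0 3 ⟶ s.ent 0 1 := S.comp e 0 1
  have : IsIso e' := inferInstanceAs (IsIso (S.comp e 0 1))
  obtain ⟨T, e₁, e₂, e₃, e₄, h₁, h₂, h₃⟩ := exists_flag_four a b (e' ≫ c)
  obtain ⟨p, -, -, hp₃⟩ := S.exists_hom_three
    (t := (restrict (tetrahedronMap 0 1 2 3 (by decide) (by decide) (by decide))).obj T)
    (t' := t) e₁.hom e₂.hom e₃.hom e₁.isIso_hom e₂.isIso_hom e₃.isIso_hom h₁ h₂
  obtain ⟨q, hq₁, hq₂⟩ := S.exists_hom_two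
    (t := (restrict (triangleMap 0 3 4 (by decide) (by decide))).obj T) (t' := s)
    (e₃.hom ≫ e') e₄.hom (inferInstance : IsIso (e₃.hom ≫ e')) e₄.isIso_hom
    (h₃.trans (Category.assoc _ _ _).symm)
  have h : edge ((restrict (tetrahedronMap 0 1 2 3 (by decide) (by decide) (by decide))).obj T) 0 3
        (by decide) = (restrict (edgeMap 0 1 (by decide))).obj
      ((restrict (triangleMap 0 3 4 (by decide) (by decide))).obj T) := by
    have h : (tetrahedronMap (n := 4) 0 1 2 3 (by decide) (by decide) (by decide)).comp
        (edgeMap 0 3 (by decide)) = (triangleMap 0 3 4 (by decide) (by decide)).comp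
          (edgeMap 0 1 (by decide)) := by
      ext x; fin_cases x <;> rfl
    exact congrArg (fun f => (restrict f).obj T) h
  refine ⟨T, p, q, h, S.hom_ext_one ?_⟩
  have h4 : S.comp (eqToHom h) 0 1 (Fin.zero_le 1) = 𝟙 (T.ent 0 3 (Fin.zero_le 3)) :=
    S.comp_eqToHom _ _ _ _
  refine (S.comp_comp _ _ _ _ _).trans (Eq.trans ?_ (S.comp_comp _ _ _ _ _).symm)
  rw [h4]
  exact (congrArg (· ≫ e') hp₃).trans (hq₁.symm.trans (Category.id_comp _).symm)

end Squares

end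

/-! ### Existence of pointwise left Kan extensions -/

section

theorem VectC.isZero (V : VectC) (h : ¬ Nontrivial V) : IsZero V := by
  rw [not_nontrivial_iff_subsingleton] at h
  rw [IsZero.iff_id_eq_zero]
  ext x
  exact Subsingleton.elim (α := V) _ _

theorem VectC.not_nontrivial {V : VectC} (h : IsZero V) : ¬ Nontrivial V := by
  rw [not_nontrivial_iff_subsingleton]
  refine ⟨fun x y => ?_⟩
  have h1 : ∀ z : V, z = 0 := fun z => by
    have := congrArg (fun f : V ⟶ V => f.hom.hom z) (h.eq_of_src (𝟙 V) 0)
    exact this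
  rw [h1 x, h1 y]

section ThinGroupoid

variable {J : Type u₁} [Category.{v₁} J] (G : J ⥤ VectC)

/-- The isomorphism classes on which `G` does not vanish. -/
abbrev SupportClasses : Type u₁ :=
  {q : Quotient (isIsomorphicSetoid J) // Nontrivial (G.obj q.out)}

variable [Finite (SupportClasses G)]

/-- The map from a value of `G` to the coproduct of the values of `G` at representatives of the
isomorphism classes on which `G` does not vanish. -/
def supportMap (q : Quotient (isIsomorphicSetoid J)) (j : J)
    (h : Quotient.mk (isIsomorphicSetoid J) j = q) :
    G.obj j ⟶ ∐ fun q : SupportClasses G => G.obj q.1.out :=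
  open Classical in
  if hq : Nontrivial (G.obj q.out) then
    G.map (Quotient.exact (h.trans q.out_eq.symm)).some.hom ≫
      Sigma.ι (fun q : SupportClasses G => G.obj q.1.out) ⟨q, hq⟩
  else 0

theorem supportMap_desc (s : Cocone G) (q : Quotient (isIsomorphicSetoid J)) (j : J)
    (h : Quotient.mk (isIsomorphicSetoid J) j = q) :
    supportMap G q j h ≫ Sigma.desc (fun q : SupportClasses G => s.ι.app q.1.out) =
      s.ι.app j := by
  unfold supportMap
  split_ifs with hq
  · rw [Category.assoc, Sigma.ι_desc]
    exact s.w _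
  · refine IsZero.eq_of_src ((VectC.isZero _ hq).of_iso ?_) _ _
    exact G.mapIso (Quotient.exact (h.trans q.out_eq.symm)).some

variable [∀ i j : J, Subsingleton (i ⟶ j)] (hJ : ∀ {i j : J} (f : i ⟶ j), IsIso f)

theorem map_supportMap {i j : J} (f : i ⟶ j) (q : Quotient (isIsomorphicSetoid J))
    (hi : Quotient.mk (isIsomorphicSetoid J) i = q)
    (hj : Quotient.mk (isIsomorphicSetoid J) j = q) :
    G.map f ≫ supportMap G q j hj = supportMap G q i hi := by
  unfold supportMap
  split_ifs with hq
  · rw [← Category.assoc, ← G.map_comp]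
    congr 2
    exact Subsingleton.elim _ _
  · exact comp_zero

theorem supportMap_out (q : SupportClasses G) :
    supportMap G q.1 q.1.out q.1.out_eq =
      Sigma.ι (fun q : SupportClasses G => G.obj q.1.out) q := by
  unfold supportMap
  rw [dif_pos q.2]
  have : (Quotient.exact (q.1.out_eq.trans q.1.out_eq.symm)).some.hom = 𝟙 q.1.out :=
    Subsingleton.elim _ _
  rw [this, G.map_id, Category.id_comp]

/-- The colimit cocone of a functor on a thin groupoid which vanishes on all but finitely many
isomorphism classes. -/
def supportCocone : Cocone G where
  pt := ∐ fun q : SupportClasses G => G.obj q.1.out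
  ι :=
    { app := fun j => supportMap G _ j rfl
      naturality := fun i j f => by
        have h : Quotient.mk (isIsomorphicSetoid J) i = Quotient.mk (isIsomorphicSetoid J) j :=
          Quotient.sound ⟨@asIso _ _ _ _ f (hJ f)⟩
        have aux : ∀ (q : Quotient (isIsomorphicSetoid J))
            (hq : Quotient.mk (isIsomorphicSetoid J) i = q),
            supportMap G q i hq = supportMap G _ i rfl := by
          rintro _ rfl; rfl
        exact (map_supportMap G f _ h rfl).trans ((aux _ h).trans (Category.comp_id _).symm) }

/-- A functor on a thin groupoid which vanishes on all but finitely many isomorphism classes has a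
colimit. -/
def supportCoconeIsColimit : IsColimit (supportCocone G hJ) where
  desc s := Sigma.desc (fun q : SupportClasses G => s.ι.app q.1.out)
  fac s j := supportMap_desc G s _ j rfl
  uniq s m hm := by
    refine Sigma.hom_ext _ _ fun q => ?_
    rw [Sigma.ι_desc, ← supportMap_out]
    have aux : ∀ (p : Quotient (isIsomorphicSetoid J))
        (hp : Quotient.mk (isIsomorphicSetoid J) q.1.out = p),
        supportMap G p q.1.out hp ≫ m = s.ι.app q.1.out := by
      rintro _ rfl; exact hm _
    exact aux _ _

end ThinGroupoid

section Kan

variable {X : Type u₁} [Groupoid.{v₁} X] {B : Type u₂} [Groupoid.{v₂} B]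

theorem isIso_costructuredArrow {R : X ⥤ B} {b : B} {i j : CostructuredArrow R b} (f : i ⟶ j) :
    IsIso f :=
  have : IsIso f.left := inferInstance
  ⟨CostructuredArrow.homMk (inv f.left) (by
      rw [Functor.map_inv, IsIso.inv_comp_eq, CostructuredArrow.w]), by
    constructor <;> ext <;> simp⟩

theorem subsingleton_costructuredArrow_hom {R : X ⥤ B} [R.Faithful] {b : B}
    (i j : CostructuredArrow R b) : Subsingleton (i ⟶ j) where
  allEq f g := by
    ext
    refine R.map_injective ?_
    rw [← cancel_mono j.hom, CostructuredArrow.w, CostructuredArrow.w]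

theorem finite_supportClasses (R : X ⥤ B) (b : B)
    (hB : ∀ b b' : B, Finite (b ⟶ b')) (F : X ⥤ VectC) (hF : finiteSupport X F) :
    Finite (SupportClasses (CostructuredArrow.proj R b ⋙ F)) := by
  have := hF.to_subtype
  have := fun x : X => hB (R.obj x) b
  let T := Σ q : {x : Quotient (isIsomorphicSetoid X) |
    ∃ a : X, Quotient.mk (isIsomorphicSetoid X) a = x ∧ Nontrivial (F.obj a)},
      (R.obj q.1.out ⟶ b)
  let f : T → Quotient (isIsomorphicSetoid (CostructuredArrow R b)) := fun p =>
    Quotient.mk _ (CostructuredArrow.mk p.2)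
  have hf : (Set.range f).Finite := Set.finite_range f
  refine (Set.Finite.subset hf (t := {q : Quotient (isIsomorphicSetoid (CostructuredArrow R b)) |
    Nontrivial ((CostructuredArrow.proj R b ⋙ F).obj q.out)}) ?_).to_subtype
  intro q hq
  have hx : Quotient.mk (isIsomorphicSetoid X) q.out.left ∈
      {x : Quotient (isIsomorphicSetoid X) |
        ∃ a : X, Quotient.mk (isIsomorphicSetoid X) a = x ∧ Nontrivial (F.obj a)} :=
    ⟨_, rfl, hq⟩
  obtain ⟨e⟩ := Quotient.exact (Quotient.out_eq (Quotient.mk (isIsomorphicSetoid X) q.out.left))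
  refine ⟨⟨⟨_, hx⟩, R.map e.hom ≫ q.out.hom⟩, ?_⟩
  refine Eq.trans ?_ q.out_eq
  exact Quotient.sound ⟨CostructuredArrow.isoMk e rfl⟩

/-- For a faithful functor `R` of groupoids the comma categories `R ↓ b` are thin groupoids, and a
functor of finite support vanishes on all but finitely many of their isomorphism classes, so that
the left Kan extension is given by finite direct sums. -/
theorem hasPointwiseLeftKanExtension (R : X ⥤ B) [R.Faithful]
    (hB : ∀ b b' : B, Finite (b ⟶ b')) (F : X ⥤ VectC) (hF : finiteSupport X F) :
    R.HasPointwiseLeftKanExtension F := fun b =>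
  have := finite_supportClasses R b hB F hF
  have := fun i j => subsingleton_costructuredArrow_hom (R := R) (b := b) i j
  ⟨⟨⟨supportCocone (CostructuredArrow.proj R b ⋙ F) isIso_costructuredArrow,
    supportCoconeIsColimit _ _⟩⟩⟩

theorem finiteSupport_of_isPointwiseLeftKanExtension {R : X ⥤ B} {F : X ⥤ VectC}
    (hF : finiteSupport X F) (E : R.LeftExtension F) (hE : E.IsPointwiseLeftKanExtension) :
    finiteSupport B E.right := by
  let f : Quotient (isIsomorphicSetoid X) → Quotient (isIsomorphicSetoid B) :=
    Quotient.map R.obj fun _ _ ⟨e⟩ => ⟨R.mapIso e⟩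
  refine (hF.image f).subset ?_
  rintro _ ⟨b, rfl, hb⟩
  by_contra hcon
  refine VectC.not_nontrivial ((IsZero.iff_id_eq_zero _).2 ((hE b).hom_ext fun j => ?_)) hb
  refine IsZero.eq_of_src (VectC.isZero _ fun hj => hcon ?_) _ _
  exact ⟨_, ⟨j.left, rfl, hj⟩, Quotient.sound ⟨asIso j.hom⟩⟩

/-- The map between left Kan extensions induced by a natural transformation. -/
def kanMap (R : X ⥤ B) {F G : X ⥤ VectC} [R.HasPointwiseLeftKanExtension F]
    [R.HasPointwiseLeftKanExtension G] (f : F ⟶ G) :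
    R.pointwiseLeftKanExtension F ⟶ R.pointwiseLeftKanExtension G :=
  (R.pointwiseLeftKanExtension F).descOfIsLeftKanExtension
    (R.pointwiseLeftKanExtensionUnit F) _ (f ≫ R.pointwiseLeftKanExtensionUnit G)

theorem unit_kanMap (R : X ⥤ B) {F G : X ⥤ VectC} [R.HasPointwiseLeftKanExtension F]
    [R.HasPointwiseLeftKanExtension G] (f : F ⟶ G) :
    R.pointwiseLeftKanExtensionUnit F ≫ Functor.whiskerLeft R (kanMap R f) =
      f ≫ R.pointwiseLeftKanExtensionUnit G :=
  Functor.descOfIsLeftKanExtension_fac _ _ _ _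

theorem kanMap_id (R : X ⥤ B) (F : X ⥤ VectC) [R.HasPointwiseLeftKanExtension F] :
    kanMap R (𝟙 F) = 𝟙 _ := by
  refine (R.pointwiseLeftKanExtension F).hom_ext_of_isLeftKanExtension
    (R.pointwiseLeftKanExtensionUnit _) _ _ ?_
  rw [unit_kanMap, Category.id_comp]
  exact (Category.comp_id _).symm

theorem kanMap_comp (R : X ⥤ B) {F G H : X ⥤ VectC} [R.HasPointwiseLeftKanExtension F]
    [R.HasPointwiseLeftKanExtension G] [R.HasPointwiseLeftKanExtension H] (f : F ⟶ G)
    (g : G ⟶ H) : kanMap R (f ≫ g) = kanMap R f ≫ kanMap R g := by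
  refine (R.pointwiseLeftKanExtension F).hom_ext_of_isLeftKanExtension
    (R.pointwiseLeftKanExtensionUnit _) _ _ ?_
  rw [unit_kanMap, Functor.whiskerLeft_comp, ← Category.assoc, unit_kanMap, Category.assoc,
    Category.assoc, unit_kanMap]

variable {A : Type u₃} [Category.{v₃} A]

/-- Pull-push functors along spans `A ← X → B` of groupoids exist if `X ⥤ B` is faithful, the sets
of morphisms of `B` are finite and pullback along `X ⥤ A` preserves finite support. -/
def pullPush (L : X ⥤ A) (R : X ⥤ B) [R.Faithful] (hB : ∀ b b' : B, Finite (b ⟶ b'))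
    (hL : ∀ φ : Fun A, finiteSupport X (L ⋙ φ.obj)) : PullPush L R :=
  have (φ : Fun A) : R.HasPointwiseLeftKanExtension (L ⋙ φ.obj) :=
    hasPointwiseLeftKanExtension R hB _ (hL φ)
  { functor :=
      { obj := fun φ => ⟨R.pointwiseLeftKanExtension (L ⋙ φ.obj),
          finiteSupport_of_isPointwiseLeftKanExtension (hL φ) _
            (R.pointwiseLeftKanExtensionIsPointwiseLeftKanExtension _)⟩
        map := fun f => ObjectProperty.homMk (kanMap R (Functor.whiskerLeft L f.hom))
        map_id := fun _ => congrArg ObjectProperty.homMk (kanMap_id R _)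
        map_comp := fun f g => congrArg ObjectProperty.homMk
          (kanMap_comp R (Functor.whiskerLeft L f.hom) (Functor.whiskerLeft L g.hom)) }
    finiteSupport_pullback := hL
    unit := fun _ => R.pointwiseLeftKanExtensionUnit _
    unit_naturality := fun _ => unit_kanMap R _
    isPointwiseLeftKanExtension := fun _ =>
      ⟨R.pointwiseLeftKanExtensionIsPointwiseLeftKanExtension _⟩ }

end Kan

end

/-! ### Finiteness of the spans -/

section

section FiniteFibers

variable {X : Type u₁} [Category.{v₁} X] {A : Type u₂} [Category.{v₂} A]

/-- A functor has finite fibres if the objects over a given object form finitely many isomorphism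
classes. -/
def FiniteFibers (L : X ⥤ A) : Prop :=
  ∀ a : A, {q : Quotient (isIsomorphicSetoid X) | Nonempty (L.obj q.out ≅ a)}.Finite

/-- Pullback along a functor with finite fibres preserves finite support. -/
theorem FiniteFibers.finiteSupport {L : X ⥤ A} (hL : FiniteFibers L) (φ : Fun A) :
    finiteSupport X (L ⋙ φ.obj) := by
  refine (φ.property.biUnion fun p _ => hL p.out).subset ?_
  rintro _ ⟨x, rfl, hx⟩
  have hout := Quotient.mk_out (s := isIsomorphicSetoid A) (L.obj x)
  have hout' := Quotient.mk_out (s := isIsomorphicSetoid X) x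
  refine Set.mem_biUnion (x := Quotient.mk (isIsomorphicSetoid A) (L.obj x)) ⟨_, rfl, hx⟩ ?_
  exact ⟨L.mapIso hout'.some ≪≫ hout.some.symm⟩

/-- The objects satisfying a property form finitely many isomorphism classes if they have a complete
invariant with finitely many values. -/
theorem finite_classes_of_invariant (p : X → Prop) {I : Type u₃} [Finite I]
    (f : ∀ x, p x → I) (hf : ∀ x y hx hy, f x hx = f y hy → Nonempty (x ≅ y)) :
    {q : Quotient (isIsomorphicSetoid X) | p q.out}.Finite := by
  let g : {q : Quotient (isIsomorphicSetoid X) | p q.out} → I := fun q => f q.1.out q.2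
  have : Function.Injective g := fun q r h => by
    have := Quotient.sound (s := isIsomorphicSetoid X) (hf _ _ q.2 r.2 h)
    rw [Quotient.out_eq, Quotient.out_eq] at this
    exact Subtype.ext this
  exact Set.finite_coe_iff.mp (Finite.of_injective g this)

end FiniteFibers

section Ext

variable {C : Type u} [Category.{v} C] [HasZeroObject C]

theorem Extension.equivalent_equivalence (A' A : C) :
    Equivalence (Extension.Equivalent (A' := A') (A := A)) where
  refl E := ⟨Iso.refl _, Category.comp_id _, Category.id_comp _⟩
  symm := by
    rintro E E' ⟨e, h₁, h₂⟩
    exact ⟨e.symm, by rw [← h₁]; simp, by rw [← h₂]; simp⟩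
  trans := by
    rintro E E' E'' ⟨e, h₁, h₂⟩ ⟨e', h₁', h₂'⟩
    exact ⟨e ≪≫ e', by rw [← h₁', ← h₁]; simp, by rw [← h₂, ← h₂']; simp⟩

theorem Extension.equivalent_of_eq {A' A : C} {E E' : Extension A' A}
    (h : (Quot.mk _ E : ExtSet A' A) = Quot.mk _ E') : E.Equivalent E' := by
  have := Quot.eqvGen_exact h
  rwa [(Extension.equivalent_equivalence A' A).eqvGen_iff] at this

end Ext

section Spans

variable {C : Type u} [Category.{v} C] [ProtoAbelian C]

/-- A triangle with edges `t_{01} ≅ a` and `t_{12} ≅ b` is an extension of `b` by `a`. -/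
def extensionOfTriangle (t : S C 2) {A A' : C} (i : t.ent 0 1 ≅ A) (j : t.ent 1 2 ≅ A') :
    Extension A' A where
  mid := t.ent 0 2
  inl := i.inv ≫ t.entMap 0 1 0 2
  proj := t.entMap 0 2 1 2 ≫ j.hom
  mono := by
    have := S.mono_entMap t 0 1 2 (by decide) (by decide)
    exact mono_comp _ _
  epi := by
    have := S.epi_entMap t 0 1 2 (by decide) (by decide)
    exact epi_comp _ _
  isPushout := by
    have hz := S.isZero_ent t 1
    have sq : IsPushout (t.entMap 0 1 0 2) (t.entMap 0 1 1 1) (t.entMap 0 2 1 2)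
        (t.entMap 1 1 1 2) :=
      t.of.property.isPushout 0 1 1 2 (by decide) (by decide) (by decide)
    exact sq.of_iso i (Iso.refl _) (hz.iso (isZero_zero C)) j
      (by simp) ((isZero_zero C).eq_of_tgt _ _) (by simp) (hz.eq_of_src _ _)

theorem isomorphic_of_equivalent_extensionOfTriangle {t t' : S C 2} {A A' : C}
    {i : t.ent 0 1 ≅ A} {j : t.ent 1 2 ≅ A'} {i' : t'.ent 0 1 ≅ A} {j' : t'.ent 1 2 ≅ A'}
    (h : (extensionOfTriangle t i j).Equivalent (extensionOfTriangle t' i' j')) :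
    Nonempty (t ≅ t') := by
  obtain ⟨e, h₁, -⟩ := h
  let e' : t.ent 0 2 ≅ t'.ent 0 2 := e
  have h₁' : (i.inv ≫ t.entMap 0 1 0 2) ≫ e'.hom = i'.inv ≫ t'.entMap 0 1 0 2 := h₁
  obtain ⟨u, -, -⟩ := S.exists_hom_two (t := t) (t' := t') (i.hom ≫ i'.inv) e'.hom
    inferInstance e'.isIso_hom (by
      rw [Category.assoc, ← h₁', Category.assoc, Iso.hom_inv_id_assoc])
  exact ⟨asIso u⟩

variable (C) in
/-- Triangles with given outer edges are classified by the finite set `Ext`. -/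
theorem finite_triangles [Finitary C] (a b : S C 1) :
    {q : Quotient (isIsomorphicSetoid (S C 2)) |
      Nonempty ((restrict (edgeMap 0 1 (by decide))).obj q.out ≅ a) ∧
        Nonempty ((restrict (edgeMap 1 2 (by decide))).obj q.out ≅ b)}.Finite := by
  let A : C := a.ent 0 1
  let A' : C := b.ent 0 1
  have := Finitary.finite_ext A' A
  let i (t : S C 2) (e : (restrict (edgeMap 0 1 (by decide))).obj t ≅ a) : t.ent 0 1 ≅ A :=
    (asIso (S.comp e.hom 0 1 (Fin.zero_le 1)) :)
  let j (t : S C 2) (e : (restrict (edgeMap 1 2 (by decide))).obj t ≅ b) : t.ent 1 2 ≅ A' :=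
    (asIso (S.comp e.hom 0 1 (Fin.zero_le 1)) :)
  exact finite_classes_of_invariant (I := ExtSet A' A)
    (fun t : S C 2 => Nonempty ((restrict (edgeMap 0 1 (by decide))).obj t ≅ a) ∧
        Nonempty ((restrict (edgeMap 1 2 (by decide))).obj t ≅ b))
    (fun t h => (Quot.mk _ (extensionOfTriangle t (i t h.1.some) (j t h.2.some)) : ExtSet A' A))
    (fun t t' ht ht' h =>
      isomorphic_of_equivalent_extensionOfTriangle (Extension.equivalent_of_eq h))

theorem S.finite_hom [Finitary C] {n : ℕ} (t t' : S C n) : Finite (t ⟶ t') := by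
  have := Finitary.finite_hom (C := C)
  let f : (t ⟶ t') → ∀ j : Fin (n + 1), t.ent 0 j (Fin.zero_le j) ⟶ t'.ent 0 j (Fin.zero_le j) :=
    fun u j => S.comp u 0 j (Fin.zero_le j)
  exact Finite.of_injective f fun u w h => S.hom_ext fun j => congrFun h j

/-- A tetrahedron with given faces `t_{012} ≅ r` and `t_{023} ≅ s` is determined by the isomorphism
`r_{02} ≅ s_{01}`, for which there are finitely many choices. -/
theorem finite_tetrahedra [Finitary C] (r s : S C 2) :
    {q : Quotient (isIsomorphicSetoid (S C 3)) |
      Nonempty ((restrict (triangleMap 0 1 2 (by decide) (by decide))).obj q.out ≅ r) ∧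
        Nonempty
          ((restrict (triangleMap 0 2 3 (by decide) (by decide))).obj q.out ≅ s)}.Finite := by
  have := S.finite_hom ((restrict (edgeMap 0 2 (by decide))).obj r)
    ((restrict (edgeMap 0 1 (by decide))).obj s)
  refine finite_classes_of_invariant
    (fun t : S C 3 =>
      Nonempty ((restrict (triangleMap 0 1 2 (by decide) (by decide))).obj t ≅ r) ∧
        Nonempty ((restrict (triangleMap 0 2 3 (by decide) (by decide))).obj t ≅ s))
    (fun t h => (restrict (edgeMap 0 2 (by decide))).map h.1.some.inv ≫ leftGlue t ≫
      (restrict (edgeMap 0 1 (by decide))).map h.2.some.hom)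
    (fun t t' ht ht' h => ?_)
  generalize ht.1.some = p, ht.2.some = q, ht'.1.some = p', ht'.2.some = q' at h
  obtain ⟨u, -, -⟩ := exists_hom_glue_left (p.hom ≫ p'.inv) (q.hom ≫ q'.inv) (by
    rw [Functor.map_comp, Functor.map_comp, Category.assoc]
    have h' := congrArg (fun x => (restrict (edgeMap 0 2 (by decide))).map p.hom ≫ x ≫
      (restrict (edgeMap 0 1 (by decide))).map q'.inv) h
    simpa only [Category.assoc, Iso.map_hom_inv_id_assoc, Iso.map_hom_inv_id, Category.comp_id]
      using h'.symm)
  exact ⟨asIso u⟩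

theorem finiteFibers_outerEdges [Finitary C] : FiniteFibers (outerEdges C) := by
  rintro ⟨a, b⟩
  refine (finite_triangles C a b).subset ?_
  rintro q ⟨e⟩
  exact ⟨⟨asIso e.hom.1⟩, ⟨asIso e.hom.2⟩⟩

theorem edge_left_012 (t : S C 3) :
    (restrict (edgeMap 0 1 (by decide))).obj
      ((restrict (triangleMap 0 1 2 (by decide) (by decide))).obj t) =
    (restrict (edgeMap 0 1 (by decide))).obj t := edge_triangle_01 t 0 1 2 _ _

theorem edge_right_012 (t : S C 3) :
    (restrict (edgeMap 1 2 (by decide))).obj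
      ((restrict (triangleMap 0 1 2 (by decide) (by decide))).obj t) =
    (restrict (edgeMap 1 2 (by decide))).obj t := edge_triangle_12 t 0 1 2 _ _

theorem edge_right_023 (t : S C 3) :
    (restrict (edgeMap 1 2 (by decide))).obj
      ((restrict (triangleMap 0 2 3 (by decide) (by decide))).obj t) =
    (restrict (edgeMap 2 3 (by decide))).obj t := edge_triangle_12 t 0 2 3 _ _

/-- A flag of length three is glued from two triangles. Up to isomorphism there are finitely many
choices for `t_{012}`, then finitely many for `t_{023}`, then finitely many gluings. -/
theorem finiteFibers_outerEdges₃ [Finitary C] : FiniteFibers (outerEdges₃ C) := by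
  rintro ⟨a, b, c⟩
  have H := (finite_triangles C a b).biUnion fun r _ =>
    (finite_triangles C ((restrict (edgeMap 0 2 (by decide))).obj r.out) c).biUnion fun s _ =>
      finite_tetrahedra r.out s.out
  refine H.subset ?_
  rintro q ⟨e⟩
  let r : Quotient (isIsomorphicSetoid (S C 2)) := Quotient.mk _
    ((restrict (triangleMap 0 1 2 (by decide) (by decide))).obj q.out)
  let s : Quotient (isIsomorphicSetoid (S C 2)) := Quotient.mk _
    ((restrict (triangleMap 0 2 3 (by decide) (by decide))).obj q.out)
  have er : r.out ≅ (restrict (triangleMap 0 1 2 (by decide) (by decide))).obj q.out :=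
    (Quotient.mk_out (s := isIsomorphicSetoid (S C 2)) _).some
  have es : s.out ≅ (restrict (triangleMap 0 2 3 (by decide) (by decide))).obj q.out :=
    (Quotient.mk_out (s := isIsomorphicSetoid (S C 2)) _).some
  have e₁ : (restrict (edgeMap 0 1 (by decide))).obj q.out ≅ a := asIso e.hom.1
  have e₂ : (restrict (edgeMap 1 2 (by decide))).obj q.out ≅ b := asIso e.hom.2.1
  have e₃ : (restrict (edgeMap 2 3 (by decide))).obj q.out ≅ c := asIso e.hom.2.2
  refine Set.mem_biUnion (x := r) ⟨⟨?_⟩, ⟨?_⟩⟩ (Set.mem_biUnion (x := s) ⟨⟨?_⟩, ⟨?_⟩⟩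
    ⟨⟨er.symm⟩, ⟨es.symm⟩⟩)
  · exact (restrict _).mapIso er ≪≫ eqToIso (edge_left_012 q.out) ≪≫ e₁
  · exact (restrict _).mapIso er ≪≫ eqToIso (edge_right_012 q.out) ≪≫ e₂
  · exact (restrict _).mapIso es ≪≫ (asIso (leftGlue q.out)).symm ≪≫ (restrict _).mapIso er.symm
  · exact (restrict _).mapIso es ≪≫ eqToIso (edge_right_023 q.out) ≪≫ e₃

variable (C) [Finitary C]

theorem nonempty_hallDatum : Nonempty (HallDatum C) :=
  ⟨{ mul := pullPush _ _ S.finite_hom finiteFibers_outerEdges.finiteSupport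
     one := pullPush _ _ S.finite_hom fun φ => φ.property }⟩

theorem nonempty_pullPush₃ : Nonempty (PullPush (outerEdges₃ C) (innerEdge₃ C)) :=
  ⟨pullPush _ _ S.finite_hom finiteFibers_outerEdges₃.finiteSupport⟩

end Spans

end

/-! ### The projection formula for left Kan extensions -/

section

section Diagonal

variable {X : Type u₁} [Category.{v₁} X] {Y : Type u₂} [Category.{v₂} Y]
  {V : Type u₃} [Category.{v₃} V]

/-- The functor `y ↦ K(y)(E(y))` for a family `K` of endofunctors. -/
@[simps]
def diagApp (K : Y ⥤ V ⥤ V) (E : Y ⥤ V) : Y ⥤ V where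
  obj y := (K.obj y).obj (E.obj y)
  map {y y'} u := (K.map u).app (E.obj y) ≫ (K.obj y').map (E.map u)
  map_comp u w := by simp

/-- The natural transformation `K(L(x))(F(x)) ⟶ K(L(x))(E(L(x)))` induced by `F ⟶ L ⋙ E`. -/
@[simps]
def diagUnit (K : Y ⥤ V ⥤ V) {L : X ⥤ Y} {F : X ⥤ V} {E : Y ⥤ V} (η : F ⟶ L ⋙ E) :
    diagApp (L ⋙ K) F ⟶ L ⋙ diagApp K E where
  app x := (K.obj (L.obj x)).map (η.app x)
  naturality x x' u := by
    have h : F.map u ≫ η.app x' = η.app x ≫ E.map (L.map u) := η.naturality u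
    change ((K.map (L.map u)).app (F.obj x) ≫ (K.obj (L.obj x')).map (F.map u)) ≫
      (K.obj (L.obj x')).map (η.app x') = (K.obj (L.obj x)).map (η.app x) ≫
        (K.map (L.map u)).app (E.obj (L.obj x)) ≫ (K.obj (L.obj x')).map (E.map (L.map u))
    rw [Category.assoc, ← Functor.map_comp, h, Functor.map_comp]
    exact ((K.map (L.map u)).naturality_assoc (η.app x) _).symm

/-- Left Kan extensions along functors to a groupoid commute with families of functors which
preserve colimits. -/
theorem isLeftKanExtension_diagUnit {Y : Type u₂} [Groupoid.{v₂} Y] (K : Y ⥤ V ⥤ V)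
    (hK : ∀ y, (K.obj y).IsLeftAdjoint) {L : X ⥤ Y} {F : X ⥤ V} {E : Y ⥤ V} (η : F ⟶ L ⋙ E)
    (h : (Functor.LeftExtension.mk E η).IsPointwiseLeftKanExtension) :
    (diagApp K E).IsLeftKanExtension (diagUnit K η) := by
  refine Functor.LeftExtension.IsPointwiseLeftKanExtension.isLeftKanExtension
    (E := Functor.LeftExtension.mk _ (diagUnit K η)) fun y => ?_
  have := hK y
  have : PreservesColimitsOfSize.{v₁, max u₁ v₂} (K.obj y) :=
    (Adjunction.ofIsLeftAdjoint (K.obj y)).leftAdjoint_preservesColimits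
  have hc := isColimitOfPreserves (K.obj y) (h y)
  let θ : CostructuredArrow.proj L y ⋙ diagApp (L ⋙ K) F ≅
      (CostructuredArrow.proj L y ⋙ F) ⋙ K.obj y :=
    NatIso.ofComponents (fun j => (asIso (K.map j.hom)).app (F.obj j.left)) (by
      intro i j f
      have h1 := congrArg (fun u => (K.map u).app (F.obj i.left)) (CostructuredArrow.w f)
      change ((K.map (L.map f.left)).app (F.obj i.left) ≫
        (K.obj (L.obj j.left)).map (F.map f.left)) ≫ (K.map j.hom).app (F.obj j.left) =
          (K.map i.hom).app (F.obj i.left) ≫ (K.obj y).map (F.map f.left)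
      simp only [Functor.map_comp, NatTrans.comp_app] at h1
      rw [Category.assoc, NatTrans.naturality, ← Category.assoc, h1])
  refine ((IsColimit.precomposeHomEquiv θ _).symm hc).ofIsoColimit
    (Cocone.ext (Iso.refl _) fun j => ?_)
  change ((K.map j.hom).app (F.obj j.left) ≫
    (K.obj y).map (η.app j.left ≫ E.map j.hom)) ≫ 𝟙 ((K.obj y).obj (E.obj y)) =
      (K.obj (L.obj j.left)).map (η.app j.left) ≫
        (K.map j.hom).app (E.obj (L.obj j.left)) ≫ (K.obj y).map (E.map j.hom)
  rw [Category.comp_id, Functor.map_comp, ← NatTrans.naturality_assoc]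
  rfl

end Diagonal

section Glue

variable {X : Type u₁} [Category.{v₁} X] {Z : Type u₂} [Category.{v₂} Z] {Y : Type u₃}
  [Groupoid.{v₃} Y] {A : Type u₄} [Category.{v₄} A] {A' : Type u₅} [Category.{v₅} A']
  {V : Type u} [Category.{v} V]

/-- A left Kan extension of a diagram which itself contains a pointwise left Kan extension is a left
Kan extension along the functor from the homotopy pullback. -/
theorem exists_isLeftKanExtension_glue {T : X ⥤ Z} {L : X ⥤ Y} {R : Z ⥤ A} {S : Y ⥤ A}
    (w : TwoSquare T L R S) [w.GuitartExact] {F : Z ⥤ V} {E : A ⥤ V} (η : F ⟶ R ⋙ E)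
    (h : (Functor.LeftExtension.mk E η).IsPointwiseLeftKanExtension)
    (K : Y ⥤ V ⥤ V) (hK : ∀ y, (K.obj y).IsLeftAdjoint) {R' : Y ⥤ A'} {E' : A' ⥤ V}
    (η' : diagApp K (S ⋙ E) ⟶ R' ⋙ E') [E'.IsLeftKanExtension η'] {N : X ⥤ A'}
    (δ : L ⋙ R' ≅ N) {F' : X ⥤ V} (κ : F' ≅ diagApp (L ⋙ K) (T ⋙ F)) :
    ∃ μ : F' ⟶ N ⋙ E', E'.IsLeftKanExtension μ ∧ ∀ x, μ.app x = κ.hom.app x ≫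
      (K.obj (L.obj x)).map (η.app (T.obj x) ≫ E.map (w.app x)) ≫ η'.app (L.obj x) ≫
        E'.map (δ.hom.app x) := by
  let η₁ : T ⋙ F ⟶ L ⋙ S ⋙ E := (Functor.LeftExtension.compTwoSquare (.mk E η) w).hom
  have h1 : (diagApp K (S ⋙ E)).IsLeftKanExtension (diagUnit K η₁) :=
    isLeftKanExtension_diagUnit K hK _ (h.compTwoSquare w)
  have hd (x : X) : (diagUnit K η₁).app x =
      (K.obj (L.obj x)).map (η.app (T.obj x) ≫ E.map (w.app x)) :=
    congrArg (K.obj (L.obj x)).map (by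
      change η.app (T.obj x) ≫ 𝟙 _ ≫ E.map (w.app x) ≫ 𝟙 _ = _
      rw [Category.id_comp, Category.comp_id])
  let γ : diagApp (L ⋙ K) (T ⋙ F) ⟶ N ⋙ E' := diagUnit K η₁ ≫ Functor.whiskerLeft L η' ≫
    (Functor.associator _ _ _).inv ≫ Functor.whiskerRight δ.hom E'
  have hγ : E'.IsLeftKanExtension γ :=
    (Functor.isLeftKanExtension_iff_postcompose (diagUnit K η₁) N δ η' γ rfl).1 ‹_›
  refine ⟨κ.hom ≫ γ, (Functor.isLeftKanExtension_iff_of_iso₂ _ γ κ (Iso.refl _) ?_).2 hγ,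
    fun x => ?_⟩
  · rw [Iso.refl_hom, Functor.whiskerLeft_id']
    exact Category.comp_id _
  · change κ.hom.app x ≫ (diagUnit K η₁).app x ≫ η'.app (L.obj x) ≫ 𝟙 _ ≫
      E'.map (δ.hom.app x) = _
    rw [hd, Category.id_comp]
    rfl

variable [MonoidalCategory V]

/-- The functor `y ↦ E(y) ⊗ Q(y)` as the family of functors `- ⊗ Q(y)` applied to `E`. -/
def diagAppTensorRight (E : Y ⥤ V) (Q : Y ⥤ V) :
    diagApp (Q ⋙ (curriedTensor V).flip) E ≅ E.prod' Q ⋙ tensor V :=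
  NatIso.ofComponents (fun y => Iso.refl (E.obj y ⊗ Q.obj y)) (fun {y y'} u => by
    change (E.obj y ◁ Q.map u ≫ E.map u ▷ Q.obj y') ≫ 𝟙 _ = 𝟙 _ ≫ (E.map u ⊗ₘ Q.map u)
    rw [Category.comp_id, Category.id_comp, MonoidalCategory.tensorHom_def'])

/-- The functor `y ↦ Q(y) ⊗ E(y)` as the family of functors `Q(y) ⊗ -` applied to `E`. -/
def diagAppTensorLeft (E : Y ⥤ V) (Q : Y ⥤ V) :
    diagApp (Q ⋙ curriedTensor V) E ≅ Q.prod' E ⋙ tensor V :=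
  NatIso.ofComponents (fun y => Iso.refl (Q.obj y ⊗ E.obj y)) (fun {y y'} u => by
    change (Q.map u ▷ E.obj y ≫ Q.obj y' ◁ E.map u) ≫ 𝟙 _ = 𝟙 _ ≫ (Q.map u ⊗ₘ E.map u)
    rw [Category.comp_id, Category.id_comp, MonoidalCategory.tensorHom_def])

/-- The case `K(y) = - ⊗ Q(y)`. -/
theorem exists_isLeftKanExtension_glue_tensorRight {T : X ⥤ Z} {L : X ⥤ Y} {R : Z ⥤ A} {S : Y ⥤ A}
    (w : TwoSquare T L R S) [w.GuitartExact] {F : Z ⥤ V} {E : A ⥤ V} (η : F ⟶ R ⋙ E)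
    (h : (Functor.LeftExtension.mk E η).IsPointwiseLeftKanExtension)
    (hV : ∀ W : V, (tensorRight W).IsLeftAdjoint) (Q : Y ⥤ V) {R' : Y ⥤ A'} {E' : A' ⥤ V}
    (η' : (S ⋙ E).prod' Q ⋙ tensor V ⟶ R' ⋙ E') (hη' : E'.IsLeftKanExtension η') {N : X ⥤ A'}
    (δ : L ⋙ R' ≅ N) {F' : X ⥤ V}
    (c : ∀ x, F'.obj x ≅ F.obj (T.obj x) ⊗ Q.obj (L.obj x))
    (hc : ∀ {x x'} (u : x ⟶ x'), F'.map u ≫ (c x').hom =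
      (c x).hom ≫ (F.map (T.map u) ⊗ₘ Q.map (L.map u))) :
    ∃ μ : F' ⟶ N ⋙ E', E'.IsLeftKanExtension μ ∧ ∀ x, μ.app x = (c x).hom ≫
      (η.app (T.obj x) ≫ E.map (w.app x)) ▷ Q.obj (L.obj x) ≫ η'.app (L.obj x) ≫
        E'.map (δ.hom.app x) := by
  let ι := diagAppTensorRight (S ⋙ E) Q
  let κ : F' ≅ diagApp (L ⋙ Q ⋙ (curriedTensor V).flip) (T ⋙ F) :=
    NatIso.ofComponents c (fun {x x'} u => by
      refine (hc u).trans (congrArg ((c x).hom ≫ ·) ?_)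
      exact MonoidalCategory.tensorHom_def' _ _)
  have : E'.IsLeftKanExtension (ι.hom ≫ η') :=
    (Functor.isLeftKanExtension_iff_of_iso₂ _ η' ι (Iso.refl _) (by
      rw [Iso.refl_hom, Functor.whiskerLeft_id']
      exact Category.comp_id _)).2 hη'
  obtain ⟨μ, h1, h2⟩ := exists_isLeftKanExtension_glue w η h (Q ⋙ (curriedTensor V).flip)
    (fun y => hV _) (ι.hom ≫ η') δ κ
  refine ⟨μ, h1, fun x => (h2 x).trans ?_⟩
  change (c x).hom ≫ (η.app (T.obj x) ≫ E.map (w.app x)) ▷ Q.obj (L.obj x) ≫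
    (𝟙 _ ≫ η'.app (L.obj x)) ≫ E'.map (δ.hom.app x) = _
  rw [Category.id_comp]

/-- The case `K(y) = Q(y) ⊗ -`. -/
theorem exists_isLeftKanExtension_glue_tensorLeft {T : X ⥤ Z} {L : X ⥤ Y} {R : Z ⥤ A} {S : Y ⥤ A}
    (w : TwoSquare T L R S) [w.GuitartExact] {F : Z ⥤ V} {E : A ⥤ V} (η : F ⟶ R ⋙ E)
    (h : (Functor.LeftExtension.mk E η).IsPointwiseLeftKanExtension)
    (hV : ∀ W : V, (tensorLeft W).IsLeftAdjoint) (Q : Y ⥤ V) {R' : Y ⥤ A'} {E' : A' ⥤ V}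
    (η' : Q.prod' (S ⋙ E) ⋙ tensor V ⟶ R' ⋙ E') (hη' : E'.IsLeftKanExtension η') {N : X ⥤ A'}
    (δ : L ⋙ R' ≅ N) {F' : X ⥤ V}
    (c : ∀ x, F'.obj x ≅ Q.obj (L.obj x) ⊗ F.obj (T.obj x))
    (hc : ∀ {x x'} (u : x ⟶ x'), F'.map u ≫ (c x').hom =
      (c x).hom ≫ (Q.map (L.map u) ⊗ₘ F.map (T.map u))) :
    ∃ μ : F' ⟶ N ⋙ E', E'.IsLeftKanExtension μ ∧ ∀ x, μ.app x = (c x).hom ≫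
      Q.obj (L.obj x) ◁ (η.app (T.obj x) ≫ E.map (w.app x)) ≫ η'.app (L.obj x) ≫
        E'.map (δ.hom.app x) := by
  let ι := diagAppTensorLeft (S ⋙ E) Q
  let κ : F' ≅ diagApp (L ⋙ Q ⋙ curriedTensor V) (T ⋙ F) :=
    NatIso.ofComponents c (fun {x x'} u => by
      refine (hc u).trans (congrArg ((c x).hom ≫ ·) ?_)
      exact MonoidalCategory.tensorHom_def _ _)
  have : E'.IsLeftKanExtension (ι.hom ≫ η') :=
    (Functor.isLeftKanExtension_iff_of_iso₂ _ η' ι (Iso.refl _) (by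
      rw [Iso.refl_hom, Functor.whiskerLeft_id']
      exact Category.comp_id _)).2 hη'
  obtain ⟨μ, h1, h2⟩ := exists_isLeftKanExtension_glue w η h (Q ⋙ curriedTensor V)
    (fun y => hV _) (ι.hom ≫ η') δ κ
  refine ⟨μ, h1, fun x => (h2 x).trans ?_⟩
  change (c x).hom ≫ Q.obj (L.obj x) ◁ (η.app (T.obj x) ≫ E.map (w.app x)) ≫
    (𝟙 _ ≫ η'.app (L.obj x)) ≫ E'.map (δ.hom.app x) = _
  rw [Category.id_comp]

end Glue

end

/-! ### Iterated Kan extensions of tensor products -/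

section Glue

variable {X : Type u₁} [Category.{v₁} X] {Z : Type u₂} [Category.{v₂} Z] {Y : Type u₃}
  [Groupoid.{v₃} Y] {A : Type u₄} [Category.{v₄} A]
  {V : Type u} [Category.{v} V] [MonoidalCategory V]

theorem tensorHom_comp_whiskerRight_assoc {P P' Q Q' W₁ W₂ W₃ W : V} (a : P ⟶ P') (n : Q ⟶ Q')
    (u : P' ⟶ W₁) (f : W₁ ⟶ W₂) (g : W₂ ⟶ W₃) (k : W₃ ⊗ Q' ⟶ W) :
    (a ⊗ₘ n) ≫ (u ≫ f ≫ g) ▷ Q' ≫ k = (a ≫ u ≫ f) ▷ Q ≫ (g ⊗ₘ n) ≫ k := by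
  rw [← tensorHom_id, ← tensorHom_id, tensorHom_comp_tensorHom_assoc,
    tensorHom_comp_tensorHom_assoc, Category.comp_id, Category.id_comp, Category.assoc,
    Category.assoc]

theorem tensorHom_comp_whiskerLeft_assoc {P P' Q Q' W₁ W₂ W₃ W : V} (a : P ⟶ P') (n : Q ⟶ Q')
    (u : P' ⟶ W₁) (f : W₁ ⟶ W₂) (g : W₂ ⟶ W₃) (k : Q' ⊗ W₃ ⟶ W) :
    (n ⊗ₘ a) ≫ Q' ◁ (u ≫ f ≫ g) ≫ k = Q ◁ (a ≫ u ≫ f) ≫ (n ⊗ₘ g) ≫ k := by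
  rw [← id_tensorHom, ← id_tensorHom, tensorHom_comp_tensorHom_assoc,
    tensorHom_comp_tensorHom_assoc, Category.comp_id, Category.id_comp, Category.assoc,
    Category.assoc]

/-- If `E` is the left Kan extension of `φ ⊠ ψ` and `E'` that of `E ⊠ ξ`, then `E'` is the left Kan
extension of `φ ⊠ (ψ ⊠ ξ)` along the homotopy pullback `X` of the two spans. In the formula for the
structure map, the component of the square `w` may be split at will into a factor `f` belonging to
`E` and a factor `g` belonging to `E'`. -/
theorem exists_isLeftKanExtension_assoc_left {T : X ⥤ Z} {L : X ⥤ Y} {R : Z ⥤ A} {S : Y ⥤ A}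
    (w : TwoSquare T L R S) [w.GuitartExact] (hV : ∀ W : V, (tensorRight W).IsLeftAdjoint)
    {p₁ q₁ : Z ⥤ A} {q₂ R' : Y ⥤ A} {p q r N : X ⥤ A} (ep : p ≅ T ⋙ p₁) (eq : q ≅ T ⋙ q₁)
    (er : r ≅ L ⋙ q₂) (δ : L ⋙ R' ≅ N) {φ ψ ξ E E' : A ⥤ V}
    (η : p₁.prod' q₁ ⋙ φ.prod ψ ⋙ tensor V ⟶ R ⋙ E)
    (h : (Functor.LeftExtension.mk E η).IsPointwiseLeftKanExtension)
    (η' : S.prod' q₂ ⋙ E.prod ξ ⋙ tensor V ⟶ R' ⋙ E')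
    (hη' : E'.IsLeftKanExtension η') :
    ∃ μ : p.prod' (q.prod' r) ⋙ φ.prod (ψ.prod ξ ⋙ tensor V) ⋙ tensor V ⟶ N ⋙ E',
      E'.IsLeftKanExtension μ ∧ ∀ (x : X) (b : A) (f : R.obj (T.obj x) ⟶ b)
        (g : b ⟶ S.obj (L.obj x)), f ≫ g = w.app x →
        μ.app x = (α_ (φ.obj (p.obj x)) (ψ.obj (q.obj x)) (ξ.obj (r.obj x))).inv ≫
          ((φ.map (ep.hom.app x) ⊗ₘ ψ.map (eq.hom.app x)) ≫ η.app (T.obj x) ≫ E.map f) ▷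
            ξ.obj (r.obj x) ≫
          (E.map g ⊗ₘ ξ.map (er.hom.app x)) ≫ η'.app (L.obj x) ≫ E'.map (δ.hom.app x) := by
  obtain ⟨μ, h1, h2⟩ := exists_isLeftKanExtension_glue_tensorRight w η h hV (q₂ ⋙ ξ)
    (R' := R') (E' := E') η' hη' δ
    (F' := p.prod' (q.prod' r) ⋙ φ.prod (ψ.prod ξ ⋙ tensor V) ⋙ tensor V)
    (fun x => (α_ (φ.obj (p.obj x)) (ψ.obj (q.obj x)) (ξ.obj (r.obj x))).symm ≪≫
      ((φ.mapIso (ep.app x) ⊗ᵢ ψ.mapIso (eq.app x)) ⊗ᵢ ξ.mapIso (er.app x)))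
    (fun {x x'} u => by
      have h1 : φ.map (p.map u) ≫ φ.map (ep.hom.app x') =
          φ.map (ep.hom.app x) ≫ φ.map (p₁.map (T.map u)) := by
        rw [← φ.map_comp, ← φ.map_comp]; exact congrArg φ.map (ep.hom.naturality u)
      have h2 : ψ.map (q.map u) ≫ ψ.map (eq.hom.app x') =
          ψ.map (eq.hom.app x) ≫ ψ.map (q₁.map (T.map u)) := by
        rw [← ψ.map_comp, ← ψ.map_comp]; exact congrArg ψ.map (eq.hom.naturality u)
      have h3 : ξ.map (r.map u) ≫ ξ.map (er.hom.app x') =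
          ξ.map (er.hom.app x) ≫ ξ.map (q₂.map (L.map u)) := by
        rw [← ξ.map_comp, ← ξ.map_comp]; exact congrArg ξ.map (er.hom.naturality u)
      change (φ.map (p.map u) ⊗ₘ (ψ.map (q.map u) ⊗ₘ ξ.map (r.map u))) ≫ (α_ _ _ _).inv ≫
        ((φ.map (ep.hom.app x') ⊗ₘ ψ.map (eq.hom.app x')) ⊗ₘ ξ.map (er.hom.app x')) =
          ((α_ _ _ _).inv ≫
            ((φ.map (ep.hom.app x) ⊗ₘ ψ.map (eq.hom.app x)) ⊗ₘ ξ.map (er.hom.app x))) ≫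
            ((φ.map (p₁.map (T.map u)) ⊗ₘ ψ.map (q₁.map (T.map u))) ⊗ₘ
              ξ.map (q₂.map (L.map u)))
      rw [associator_inv_naturality_assoc, Category.assoc, tensorHom_comp_tensorHom,
        tensorHom_comp_tensorHom, tensorHom_comp_tensorHom, tensorHom_comp_tensorHom, h1, h2, h3])
  refine ⟨μ, h1, fun x b f g hw => (h2 x).trans ?_⟩
  change ((α_ _ _ _).inv ≫
    ((φ.map (ep.hom.app x) ⊗ₘ ψ.map (eq.hom.app x)) ⊗ₘ ξ.map (er.hom.app x))) ≫
      (η.app (T.obj x) ≫ E.map (w.app x)) ▷ ξ.obj (q₂.obj (L.obj x)) ≫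
        η'.app (L.obj x) ≫ E'.map (δ.hom.app x) = _
  rw [← hw, E.map_comp]
  refine (Category.assoc _ _ _).trans (congrArg ((α_ _ _ _).inv ≫ ·) ?_)
  exact tensorHom_comp_whiskerRight_assoc _ (ξ.map (er.hom.app x)) (η.app (T.obj x)) (E.map f)
    (E.map g) _

/-- The analogue of `exists_isLeftKanExtension_assoc_left` for an iterated product bracketed to the
right. -/
theorem exists_isLeftKanExtension_assoc_right {T : X ⥤ Z} {L : X ⥤ Y} {R : Z ⥤ A} {S : Y ⥤ A}
    (w : TwoSquare T L R S) [w.GuitartExact] (hV : ∀ W : V, (tensorLeft W).IsLeftAdjoint)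
    {p₁ q₁ : Z ⥤ A} {q₂ R' : Y ⥤ A} {p q r N : X ⥤ A} (ep : p ≅ L ⋙ q₂) (eq : q ≅ T ⋙ p₁)
    (er : r ≅ T ⋙ q₁) (δ : L ⋙ R' ≅ N) {φ ψ ξ E E' : A ⥤ V}
    (η : p₁.prod' q₁ ⋙ ψ.prod ξ ⋙ tensor V ⟶ R ⋙ E)
    (h : (Functor.LeftExtension.mk E η).IsPointwiseLeftKanExtension)
    (η' : q₂.prod' S ⋙ φ.prod E ⋙ tensor V ⟶ R' ⋙ E')
    (hη' : E'.IsLeftKanExtension η') :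
    ∃ μ : p.prod' (q.prod' r) ⋙ φ.prod (ψ.prod ξ ⋙ tensor V) ⋙ tensor V ⟶ N ⋙ E',
      E'.IsLeftKanExtension μ ∧ ∀ (x : X) (b : A) (f : R.obj (T.obj x) ⟶ b)
        (g : b ⟶ S.obj (L.obj x)), f ≫ g = w.app x →
        μ.app x = φ.obj (p.obj x) ◁
          ((ψ.map (eq.hom.app x) ⊗ₘ ξ.map (er.hom.app x)) ≫ η.app (T.obj x) ≫ E.map f) ≫
          (φ.map (ep.hom.app x) ⊗ₘ E.map g) ≫ η'.app (L.obj x) ≫ E'.map (δ.hom.app x) := by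
  obtain ⟨μ, h1, h2⟩ := exists_isLeftKanExtension_glue_tensorLeft w η h hV (q₂ ⋙ φ)
    (R' := R') (E' := E') η' hη' δ
    (F' := p.prod' (q.prod' r) ⋙ φ.prod (ψ.prod ξ ⋙ tensor V) ⋙ tensor V)
    (fun x => φ.mapIso (ep.app x) ⊗ᵢ (ψ.mapIso (eq.app x) ⊗ᵢ ξ.mapIso (er.app x)))
    (fun {x x'} u => by
      have h1 : φ.map (p.map u) ≫ φ.map (ep.hom.app x') =
          φ.map (ep.hom.app x) ≫ φ.map (q₂.map (L.map u)) := by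
        rw [← φ.map_comp, ← φ.map_comp]; exact congrArg φ.map (ep.hom.naturality u)
      have h2 : ψ.map (q.map u) ≫ ψ.map (eq.hom.app x') =
          ψ.map (eq.hom.app x) ≫ ψ.map (p₁.map (T.map u)) := by
        rw [← ψ.map_comp, ← ψ.map_comp]; exact congrArg ψ.map (eq.hom.naturality u)
      have h3 : ξ.map (r.map u) ≫ ξ.map (er.hom.app x') =
          ξ.map (er.hom.app x) ≫ ξ.map (q₁.map (T.map u)) := by
        rw [← ξ.map_comp, ← ξ.map_comp]; exact congrArg ξ.map (er.hom.naturality u)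
      change (φ.map (p.map u) ⊗ₘ (ψ.map (q.map u) ⊗ₘ ξ.map (r.map u))) ≫
        (φ.map (ep.hom.app x') ⊗ₘ (ψ.map (eq.hom.app x') ⊗ₘ ξ.map (er.hom.app x'))) =
          (φ.map (ep.hom.app x) ⊗ₘ (ψ.map (eq.hom.app x) ⊗ₘ ξ.map (er.hom.app x))) ≫
            (φ.map (q₂.map (L.map u)) ⊗ₘ (ψ.map (p₁.map (T.map u)) ⊗ₘ
              ξ.map (q₁.map (T.map u))))
      rw [tensorHom_comp_tensorHom, tensorHom_comp_tensorHom, tensorHom_comp_tensorHom,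
        tensorHom_comp_tensorHom, h1, h2, h3])
  refine ⟨μ, h1, fun x b f g hw => (h2 x).trans ?_⟩
  change (φ.map (ep.hom.app x) ⊗ₘ (ψ.map (eq.hom.app x) ⊗ₘ ξ.map (er.hom.app x))) ≫
      φ.obj (q₂.obj (L.obj x)) ◁ (η.app (T.obj x) ≫ E.map (w.app x)) ≫
        η'.app (L.obj x) ≫ E'.map (δ.hom.app x) = _
  rw [← hw, E.map_comp]
  exact tensorHom_comp_whiskerLeft_assoc _ (φ.map (ep.hom.app x)) (η.app (T.obj x)) (E.map f)
    (E.map g) _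

/-- If `E` is the left Kan extension of the constant functor `𝟙_ V` and `E'` that of `E ⊠ φ`, then
`E'` is the left Kan extension of `φ` along the homotopy pullback of the two spans. -/
theorem exists_isLeftKanExtension_unit_left {T : X ⥤ Z} {L : X ⥤ Y} {R : Z ⥤ A} {S : Y ⥤ A}
    (w : TwoSquare T L R S) [w.GuitartExact] (hV : ∀ W : V, (tensorRight W).IsLeftAdjoint)
    {q₂ R' : Y ⥤ A} {N : X ⥤ A} (er : N ≅ L ⋙ q₂) (δ : L ⋙ R' ≅ N) {φ E E' : A ⥤ V}
    (η : 𝟭 Z ⋙ (Functor.const Z).obj (𝟙_ V) ⟶ R ⋙ E)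
    (h : (Functor.LeftExtension.mk E η).IsPointwiseLeftKanExtension)
    (η' : S.prod' q₂ ⋙ E.prod φ ⋙ tensor V ⟶ R' ⋙ E')
    (hη' : E'.IsLeftKanExtension η') :
    ∃ μ : N ⋙ φ ⟶ N ⋙ E',
      E'.IsLeftKanExtension μ ∧ ∀ (x : X) (b : A) (f : R.obj (T.obj x) ⟶ b)
        (g : b ⟶ S.obj (L.obj x)), f ≫ g = w.app x →
        (λ_ (φ.obj (N.obj x))).hom ≫ μ.app x =
          (η.app (T.obj x) ≫ E.map f) ▷ φ.obj (N.obj x) ≫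
          (E.map g ⊗ₘ φ.map (er.hom.app x)) ≫ η'.app (L.obj x) ≫ E'.map (δ.hom.app x) := by
  obtain ⟨μ, h1, h2⟩ := exists_isLeftKanExtension_glue_tensorRight w η h hV (q₂ ⋙ φ)
    (R' := R') (E' := E') η' hη' δ (F' := N ⋙ φ)
    (fun x => (λ_ (φ.obj (N.obj x))).symm ≪≫ (Iso.refl (𝟙_ V) ⊗ᵢ φ.mapIso (er.app x)))
    (fun {x x'} u => by
      have h3 : φ.map (N.map u) ≫ φ.map (er.hom.app x') =
          φ.map (er.hom.app x) ≫ φ.map (q₂.map (L.map u)) := by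
        rw [← φ.map_comp, ← φ.map_comp]; exact congrArg φ.map (er.hom.naturality u)
      change φ.map (N.map u) ≫ (λ_ _).inv ≫ (𝟙 (𝟙_ V) ⊗ₘ φ.map (er.hom.app x')) =
        ((λ_ _).inv ≫ (𝟙 (𝟙_ V) ⊗ₘ φ.map (er.hom.app x))) ≫
          (𝟙 (𝟙_ V) ⊗ₘ φ.map (q₂.map (L.map u)))
      rw [Category.assoc, leftUnitor_inv_naturality_assoc, ← id_tensorHom,
        tensorHom_comp_tensorHom, tensorHom_comp_tensorHom, h3])
  refine ⟨μ, h1, fun x b f g hw => ?_⟩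
  rw [h2]
  change (λ_ _).hom ≫ ((λ_ _).inv ≫ (𝟙 (𝟙_ V) ⊗ₘ φ.map (er.hom.app x))) ≫
      (η.app (T.obj x) ≫ E.map (w.app x)) ▷ φ.obj (q₂.obj (L.obj x)) ≫
        η'.app (L.obj x) ≫ E'.map (δ.hom.app x) = _
  rw [← hw, E.map_comp, Category.assoc, Iso.hom_inv_id_assoc]
  refine (tensorHom_comp_whiskerRight_assoc _ (φ.map (er.hom.app x)) (η.app (T.obj x)) (E.map f)
    (E.map g) _).trans ?_
  exact congrArg (· ▷ φ.obj (N.obj x) ≫ (E.map g ⊗ₘ φ.map (er.hom.app x)) ≫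
    η'.app (L.obj x) ≫ E'.map (δ.hom.app x)) (Category.id_comp _)

/-- The analogue of `exists_isLeftKanExtension_unit_left` for the unit on the right. -/
theorem exists_isLeftKanExtension_unit_right {T : X ⥤ Z} {L : X ⥤ Y} {R : Z ⥤ A} {S : Y ⥤ A}
    (w : TwoSquare T L R S) [w.GuitartExact] (hV : ∀ W : V, (tensorLeft W).IsLeftAdjoint)
    {q₂ R' : Y ⥤ A} {N : X ⥤ A} (er : N ≅ L ⋙ q₂) (δ : L ⋙ R' ≅ N) {φ E E' : A ⥤ V}
    (η : 𝟭 Z ⋙ (Functor.const Z).obj (𝟙_ V) ⟶ R ⋙ E)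
    (h : (Functor.LeftExtension.mk E η).IsPointwiseLeftKanExtension)
    (η' : q₂.prod' S ⋙ φ.prod E ⋙ tensor V ⟶ R' ⋙ E')
    (hη' : E'.IsLeftKanExtension η') :
    ∃ μ : N ⋙ φ ⟶ N ⋙ E',
      E'.IsLeftKanExtension μ ∧ ∀ (x : X) (b : A) (f : R.obj (T.obj x) ⟶ b)
        (g : b ⟶ S.obj (L.obj x)), f ≫ g = w.app x →
        (ρ_ (φ.obj (N.obj x))).hom ≫ μ.app x =
          φ.obj (N.obj x) ◁ (η.app (T.obj x) ≫ E.map f) ≫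
          (φ.map (er.hom.app x) ⊗ₘ E.map g) ≫ η'.app (L.obj x) ≫ E'.map (δ.hom.app x) := by
  obtain ⟨μ, h1, h2⟩ := exists_isLeftKanExtension_glue_tensorLeft w η h hV (q₂ ⋙ φ)
    (R' := R') (E' := E') η' hη' δ (F' := N ⋙ φ)
    (fun x => (ρ_ (φ.obj (N.obj x))).symm ≪≫ (φ.mapIso (er.app x) ⊗ᵢ Iso.refl (𝟙_ V)))
    (fun {x x'} u => by
      have h3 : φ.map (N.map u) ≫ φ.map (er.hom.app x') =
          φ.map (er.hom.app x) ≫ φ.map (q₂.map (L.map u)) := by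
        rw [← φ.map_comp, ← φ.map_comp]; exact congrArg φ.map (er.hom.naturality u)
      change φ.map (N.map u) ≫ (ρ_ _).inv ≫ (φ.map (er.hom.app x') ⊗ₘ 𝟙 (𝟙_ V)) =
        ((ρ_ _).inv ≫ (φ.map (er.hom.app x) ⊗ₘ 𝟙 (𝟙_ V))) ≫
          (φ.map (q₂.map (L.map u)) ⊗ₘ 𝟙 (𝟙_ V))
      rw [Category.assoc, rightUnitor_inv_naturality_assoc, ← tensorHom_id,
        tensorHom_comp_tensorHom, tensorHom_comp_tensorHom, h3])
  refine ⟨μ, h1, fun x b f g hw => ?_⟩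
  rw [h2]
  change (ρ_ _).hom ≫ ((ρ_ _).inv ≫ (φ.map (er.hom.app x) ⊗ₘ 𝟙 (𝟙_ V))) ≫
      φ.obj (q₂.obj (L.obj x)) ◁ (η.app (T.obj x) ≫ E.map (w.app x)) ≫
        η'.app (L.obj x) ≫ E'.map (δ.hom.app x) = _
  rw [← hw, E.map_comp, Category.assoc, Iso.hom_inv_id_assoc]
  refine (tensorHom_comp_whiskerLeft_assoc _ (φ.map (er.hom.app x)) (η.app (T.obj x)) (E.map f)
    (E.map g) _).trans ?_
  exact congrArg (φ.obj (N.obj x) ◁ · ≫ (φ.map (er.hom.app x) ⊗ₘ E.map g) ≫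
    η'.app (L.obj x) ≫ E'.map (δ.hom.app x)) (Category.id_comp _)

end Glue

/-! ### The structure maps of the tensor product and the unit -/

section

variable {C : Type u} [Category.{v} C]

/-- Restriction along a composite map is the composite of the restrictions. The components are
identities up to the propositional equality `e` of objects. -/
def restrictIso [HasZeroObject C] {l m n : ℕ} (f : Fin (l + 1) →o Fin (m + 1))
    (g : Fin (m + 1) →o Fin (n + 1)) (h : Fin (l + 1) →o Fin (n + 1)) (hc : h = g.comp f)
    (e : ∀ t : S C n, (restrict h).obj t = (restrict f).obj ((restrict g).obj t)) :
    restrict (C := C) h ≅ restrict g ⋙ restrict f :=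
  NatIso.ofComponents (fun t => eqToIso (e t))
    (fun {t t'} u => restrict_map_eqToHom (C := C) (g := g.comp f) hc u (e t) (e t'))

theorem comp_edgeMap_01 {n : ℕ} (i j k : Fin (n + 1)) (hij : i ≤ j) (hjk : j ≤ k) :
    edgeMap i j hij = (triangleMap i j k hij hjk).comp (edgeMap 0 1 (by decide)) := by
  ext x; fin_cases x <;> rfl

theorem comp_edgeMap_12 {n : ℕ} (i j k : Fin (n + 1)) (hij : i ≤ j) (hjk : j ≤ k) :
    edgeMap j k hjk = (triangleMap i j k hij hjk).comp (edgeMap 1 2 (by decide)) := by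
  ext x; fin_cases x <;> rfl

theorem comp_edgeMap_02 {n : ℕ} (i j k : Fin (n + 1)) (hij : i ≤ j) (hjk : j ≤ k) :
    edgeMap i k (hij.trans hjk) = (triangleMap i j k hij hjk).comp (edgeMap 0 2 (by decide)) := by
  ext x; fin_cases x <;> rfl

section

variable [HasZeroObject C] {n : ℕ} (i j k : Fin (n + 1)) (hij : i ≤ j) (hjk : j ≤ k)

/-- The edge `t_{ij}` of a flag as an edge of the triangle `t_{ijk}`. -/
def edgeIso₀₁ : restrict (C := C) (edgeMap i j hij) ≅
    restrict (triangleMap i j k hij hjk) ⋙ restrict (edgeMap 0 1 (by decide)) :=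
  restrictIso (edgeMap 0 1 (by decide)) (triangleMap i j k hij hjk) (edgeMap i j hij)
    (comp_edgeMap_01 i j k hij hjk) (fun t => (edge_triangle_01 t i j k hij hjk).symm)

/-- The edge `t_{jk}` of a flag as an edge of the triangle `t_{ijk}`. -/
def edgeIso₁₂ : restrict (C := C) (edgeMap j k hjk) ≅
    restrict (triangleMap i j k hij hjk) ⋙ restrict (edgeMap 1 2 (by decide)) :=
  restrictIso (edgeMap 1 2 (by decide)) (triangleMap i j k hij hjk) (edgeMap j k hjk)
    (comp_edgeMap_12 i j k hij hjk) (fun t => (edge_triangle_12 t i j k hij hjk).symm)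

/-- The edge `t_{ik}` of a flag as an edge of the triangle `t_{ijk}`. -/
def edgeIso₀₂ : restrict (C := C) (edgeMap i k (hij.trans hjk)) ≅
    restrict (triangleMap i j k hij hjk) ⋙ restrict (edgeMap 0 2 (by decide)) :=
  restrictIso (edgeMap 0 2 (by decide)) (triangleMap i j k hij hjk) (edgeMap i k (hij.trans hjk))
    (comp_edgeMap_02 i j k hij hjk) (fun t => (edge_triangle_02 t i j k hij hjk).symm)

end

variable [HasZeroObject C] (D : HallDatum C)

/-- The structure map of the Kan extension `φ ⊗ ψ`. -/
def tensUnit (φ ψ : Fun (S C 1)) :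
    (restrict (C := C) (edgeMap (n := 2) 0 1 (by decide))).prod'
        (restrict (edgeMap (n := 2) 1 2 (by decide))) ⋙ φ.obj.prod ψ.obj ⋙ tensor VectC ⟶
      restrict (edgeMap (n := 2) 0 2 (by decide)) ⋙ (D.tens φ ψ).obj :=
  D.mul.unit (boxObj φ ψ)

theorem isPointwiseLeftKanExtension_tensUnit (φ ψ : Fun (S C 1)) :
    Nonempty (Functor.LeftExtension.mk (D.tens φ ψ).obj
      (tensUnit D φ ψ)).IsPointwiseLeftKanExtension :=
  D.mul.isPointwiseLeftKanExtension (boxObj φ ψ)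

theorem isLeftKanExtension_tensUnit (φ ψ : Fun (S C 1)) :
    (D.tens φ ψ).obj.IsLeftKanExtension (tensUnit D φ ψ) :=
  (isPointwiseLeftKanExtension_tensUnit D φ ψ).some.isLeftKanExtension

theorem mulMap_eq (φ ψ : Fun (S C 1)) {n : ℕ} (t : S C n) (i j k : Fin (n + 1)) (hij : i ≤ j)
    (hjk : j ≤ k) :
    D.mulMap φ ψ t i j k hij hjk =
      (φ.obj.map ((edgeIso₀₁ i j k hij hjk).hom.app t) ⊗ₘ
        ψ.obj.map ((edgeIso₁₂ i j k hij hjk).hom.app t)) ≫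
      (tensUnit D φ ψ).app ((restrict (triangleMap i j k hij hjk)).obj t) ≫
      (D.tens φ ψ).obj.map ((edgeIso₀₂ i j k hij hjk).inv.app t) := rfl

/-- The structure map of the Kan extension `I`. -/
def oneUnit : 𝟭 (S C 0) ⋙ (Functor.const (S C 0)).obj (𝟙_ VectC) ⟶
    restrict (edgeMap 0 0 le_rfl) ⋙ D.unitObj.obj :=
  D.one.unit (scalars C)

theorem isPointwiseLeftKanExtension_oneUnit :
    Nonempty (Functor.LeftExtension.mk D.unitObj.obj
      (oneUnit D)).IsPointwiseLeftKanExtension :=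
  D.one.isPointwiseLeftKanExtension (scalars C)

theorem oneMap_eq {n : ℕ} (t : S C n) (i : Fin (n + 1)) :
    D.oneMap t i = (oneUnit D).app ((restrict (vertexMap i)).obj t) ≫
      D.unitObj.obj.map (eqToHom (degeneracy_vertex t i)) := rfl

end

/-! ### Threefold products and products with the unit as Kan extensions -/

section

variable {C : Type u} [Category.{v} C] [ProtoAbelian C] (D : HallDatum C)

theorem VectC.isLeftAdjoint_tensorLeft (W : VectC) : (tensorLeft W).IsLeftAdjoint := inferInstance

theorem VectC.isLeftAdjoint_tensorRight (W : VectC) : (tensorRight W).IsLeftAdjoint := inferInstance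

theorem edgeIso_comp_left (t : S C 3) :
    (edgeIso₀₂ 0 1 2 (by decide) (by decide)).inv.app t ≫
      (edgeIso₀₁ 0 2 3 (by decide) (by decide)).hom.app t = (squareLeft C).app t :=
  eqToHom_trans (edge_triangle_02 t 0 1 2 (by decide) (by decide))
    (edge_triangle_01 t 0 2 3 (by decide) (by decide)).symm

theorem edgeIso_comp_right (t : S C 3) :
    (edgeIso₀₂ 1 2 3 (by decide) (by decide)).inv.app t ≫
      (edgeIso₁₂ 0 1 3 (by decide) (by decide)).hom.app t = (squareRight C).app t :=
  eqToHom_trans (edge_triangle_02 t 1 2 3 (by decide) (by decide))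
    (edge_triangle_12 t 0 1 3 (by decide) (by decide)).symm

theorem edgeIso_comp_left_unit (a : S C 1) :
    eqToHom (degeneracy_vertex a 0) ≫
      (edgeIso₀₁ 0 0 1 (by decide) (by decide)).hom.app a = squareLeftUnit.app a :=
  eqToHom_trans (degeneracy_vertex a 0)
    (edge_triangle_01 a 0 0 1 (by decide) (by decide)).symm

theorem edgeIso_comp_right_unit (a : S C 1) :
    eqToHom (degeneracy_vertex a 1) ≫
      (edgeIso₁₂ 0 1 1 (by decide) (by decide)).hom.app a = squareRightUnit.app a :=
  eqToHom_trans (degeneracy_vertex a 1)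
    (edge_triangle_12 a 0 1 1 (by decide) (by decide)).symm

/-- The product `(φ ⊗ ψ) ⊗ ξ` is a left Kan extension along `S_3 ⥤ S_1`. -/
theorem exists_isLeftKanExtension_tens_left (φ ψ ξ : Fun (S C 1)) :
    ∃ μ : outerEdges₃ C ⋙ φ.obj.prod (ψ.obj.prod ξ.obj ⋙ tensor VectC) ⋙ tensor VectC ⟶
        restrict (edgeMap (n := 3) 0 3 (by decide)) ⋙ (D.tens (D.tens φ ψ) ξ).obj,
      (D.tens (D.tens φ ψ) ξ).obj.IsLeftKanExtension μ ∧ ∀ t, μ.app t =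
        (α_ _ _ _).inv ≫ (D.mulMap φ ψ t 0 1 2 (by decide) (by decide) ▷
          ξ.obj.obj ((restrict (edgeMap 2 3 (by decide))).obj t)) ≫
        D.mulMap (D.tens φ ψ) ξ t 0 2 3 (by decide) (by decide) := by
  obtain ⟨μ, h1, h2⟩ := exists_isLeftKanExtension_assoc_left (squareLeft C)
    VectC.isLeftAdjoint_tensorRight
    (edgeIso₀₁ 0 1 2 (by decide) (by decide)) (edgeIso₁₂ 0 1 2 (by decide) (by decide))
    (edgeIso₁₂ 0 2 3 (by decide) (by decide)) (edgeIso₀₂ 0 2 3 (by decide) (by decide)).symm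
    (tensUnit D φ ψ) (isPointwiseLeftKanExtension_tensUnit D φ ψ).some
    (tensUnit D (D.tens φ ψ) ξ) (isLeftKanExtension_tensUnit D (D.tens φ ψ) ξ)
  refine ⟨μ, h1, fun t => (h2 t _ _ _ (edgeIso_comp_left t)).trans ?_⟩
  rw [mulMap_eq, mulMap_eq]
  rfl

/-- The product `φ ⊗ (ψ ⊗ ξ)` is a left Kan extension along `S_3 ⥤ S_1`. -/
theorem exists_isLeftKanExtension_tens_right (φ ψ ξ : Fun (S C 1)) :
    ∃ μ : outerEdges₃ C ⋙ φ.obj.prod (ψ.obj.prod ξ.obj ⋙ tensor VectC) ⋙ tensor VectC ⟶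
        restrict (edgeMap (n := 3) 0 3 (by decide)) ⋙ (D.tens φ (D.tens ψ ξ)).obj,
      (D.tens φ (D.tens ψ ξ)).obj.IsLeftKanExtension μ ∧ ∀ t, μ.app t =
        (φ.obj.obj ((restrict (edgeMap 0 1 (by decide))).obj t) ◁
          D.mulMap ψ ξ t 1 2 3 (by decide) (by decide)) ≫
        D.mulMap φ (D.tens ψ ξ) t 0 1 3 (by decide) (by decide) := by
  obtain ⟨μ, h1, h2⟩ := exists_isLeftKanExtension_assoc_right (squareRight C)
    VectC.isLeftAdjoint_tensorLeft
    (edgeIso₀₁ 0 1 3 (by decide) (by decide)) (edgeIso₀₁ 1 2 3 (by decide) (by decide))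
    (edgeIso₁₂ 1 2 3 (by decide) (by decide)) (edgeIso₀₂ 0 1 3 (by decide) (by decide)).symm
    (tensUnit D ψ ξ) (isPointwiseLeftKanExtension_tensUnit D ψ ξ).some
    (tensUnit D φ (D.tens ψ ξ)) (isLeftKanExtension_tensUnit D φ (D.tens ψ ξ))
  refine ⟨μ, h1, fun t => (h2 t _ _ _ (edgeIso_comp_right t)).trans ?_⟩
  rw [mulMap_eq, mulMap_eq]
  rfl

/-- The product `I ⊗ φ` is a left Kan extension along `S_1 ⥤ S_1`, `a ↦ a_{01}`. -/
theorem exists_isLeftKanExtension_unit_tens (φ : Fun (S C 1)) :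
    ∃ μ : restrict (edgeMap (n := 1) 0 1 (by decide)) ⋙ φ.obj ⟶
        restrict (edgeMap (n := 1) 0 1 (by decide)) ⋙ (D.tens D.unitObj φ).obj,
      (D.tens D.unitObj φ).obj.IsLeftKanExtension μ ∧
      ∀ a, (λ_ (φ.obj.obj ((restrict (edgeMap 0 1 (by decide))).obj a))).hom ≫ μ.app a =
        (D.oneMap a 0 ▷ φ.obj.obj ((restrict (edgeMap 0 1 (by decide))).obj a)) ≫
          D.mulMap D.unitObj φ a 0 0 1 (by decide) (by decide) := by
  obtain ⟨μ, h1, h2⟩ := exists_isLeftKanExtension_unit_left (squareLeftUnit (C := C))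
    VectC.isLeftAdjoint_tensorRight
    (edgeIso₁₂ 0 0 1 (by decide) (by decide)) (edgeIso₀₂ 0 0 1 (by decide) (by decide)).symm
    (oneUnit D) (isPointwiseLeftKanExtension_oneUnit D).some
    (tensUnit D D.unitObj φ) (isLeftKanExtension_tensUnit D D.unitObj φ)
  refine ⟨μ, h1, fun a => (h2 a _ _ _ (edgeIso_comp_left_unit a)).trans ?_⟩
  rw [mulMap_eq, oneMap_eq]
  rfl

/-- The product `φ ⊗ I` is a left Kan extension along `S_1 ⥤ S_1`, `a ↦ a_{01}`. -/
theorem exists_isLeftKanExtension_tens_unit (φ : Fun (S C 1)) :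
    ∃ μ : restrict (edgeMap (n := 1) 0 1 (by decide)) ⋙ φ.obj ⟶
        restrict (edgeMap (n := 1) 0 1 (by decide)) ⋙ (D.tens φ D.unitObj).obj,
      (D.tens φ D.unitObj).obj.IsLeftKanExtension μ ∧
      ∀ a, (ρ_ (φ.obj.obj ((restrict (edgeMap 0 1 (by decide))).obj a))).hom ≫ μ.app a =
        (φ.obj.obj ((restrict (edgeMap 0 1 (by decide))).obj a) ◁ D.oneMap a 1) ≫
          D.mulMap φ D.unitObj a 0 1 1 (by decide) (by decide) := by
  obtain ⟨μ, h1, h2⟩ := exists_isLeftKanExtension_unit_right (squareRightUnit (C := C))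
    VectC.isLeftAdjoint_tensorLeft
    (edgeIso₀₁ 0 1 1 (by decide) (by decide)) (edgeIso₀₂ 0 1 1 (by decide) (by decide)).symm
    (oneUnit D) (isPointwiseLeftKanExtension_oneUnit D).some
    (tensUnit D φ D.unitObj) (isLeftKanExtension_tensUnit D φ D.unitObj)
  refine ⟨μ, h1, fun a => (h2 a _ _ _ (edgeIso_comp_right_unit a)).trans ?_⟩
  rw [mulMap_eq, oneMap_eq]
  rfl

end

/-! ### Associators and unitors -/

section

section

variable {A : Type u₁} [Category.{v₁} A]

/-- Two left Kan extensions which belong to `Fun(A)` are isomorphic in `Fun(A)`. -/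
def funIsoOfIsLeftKanExtension {X : Type u₂} [Category.{v₂} X] {N : X ⥤ A} {F : X ⥤ VectC}
    {E E' : Fun A} (μ : F ⟶ N ⋙ E.obj) (μ' : F ⟶ N ⋙ E'.obj) (_ : E.obj.IsLeftKanExtension μ)
    (_ : E'.obj.IsLeftKanExtension μ') : E ≅ E' :=
  ObjectProperty.isoMk _ (Functor.leftKanExtensionUnique E.obj μ E'.obj μ')

theorem app_comp_funIsoOfIsLeftKanExtension {X : Type u₂} [Category.{v₂} X] {N : X ⥤ A}
    {F : X ⥤ VectC} {E E' : Fun A} (μ : F ⟶ N ⋙ E.obj) (μ' : F ⟶ N ⋙ E'.obj)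
    (h : E.obj.IsLeftKanExtension μ) (h' : E'.obj.IsLeftKanExtension μ') (x : X) :
    μ.app x ≫ (funIsoOfIsLeftKanExtension μ μ' h h').hom.hom.app (N.obj x) = μ'.app x :=
  Functor.descOfIsLeftKanExtension_fac_app _ _ _ _ _ |>.trans (Category.id_comp _)

theorem fun_hom_ext_of_isLeftKanExtension {X : Type u₂} [Category.{v₂} X] {N : X ⥤ A}
    {F : X ⥤ VectC} {E E' : Fun A} (μ : F ⟶ N ⋙ E.obj) (h : E.obj.IsLeftKanExtension μ)
    {f g : E ⟶ E'} (hfg : ∀ x, μ.app x ≫ f.hom.app (N.obj x) = μ.app x ≫ g.hom.app (N.obj x)) :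
    f = g :=
  ObjectProperty.hom_ext _
    (E.obj.hom_ext_of_isLeftKanExtension μ _ _ (by ext1; ext1 x; exact hfg x))

end

variable {C : Type u} [Category.{v} C]

/-- The condition on an associator to be compatible with the structure maps at the faces of
tetrahedra: `a` identifies the products over `t_{012}`, `t_{023}` and over `t_{123}`, `t_{013}`. -/
def IsAssoc [HasZeroObject C] (D : HallDatum C) {φ ψ ξ : Fun (S C 1)}
    (a : D.tens (D.tens φ ψ) ξ ⟶ D.tens φ (D.tens ψ ξ)) : Prop :=
  ∀ t : S C 3, (α_ _ _ _).inv ≫ (D.mulMap φ ψ t 0 1 2 (by decide) (by decide) ▷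
          ξ.obj.obj ((restrict (edgeMap 2 3 (by decide))).obj t)) ≫
        D.mulMap (D.tens φ ψ) ξ t 0 2 3 (by decide) (by decide) ≫
        a.hom.app ((restrict (edgeMap 0 3 (by decide))).obj t) =
      (φ.obj.obj ((restrict (edgeMap 0 1 (by decide))).obj t) ◁
          D.mulMap ψ ξ t 1 2 3 (by decide) (by decide)) ≫
        D.mulMap φ (D.tens ψ ξ) t 0 1 3 (by decide) (by decide)

variable [ProtoAbelian C] (D : HallDatum C)

/-- Both bracketings are left Kan extensions of `φ ⊠ ψ ⊠ ξ` along `S_3 ⥤ S_1`, which gives the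
associator and its factorization through every choice of the threefold product. -/
theorem exists_associator (φ ψ ξ : Fun (S C 1)) :
    ∃ α : D.tens (D.tens φ ψ) ξ ≅ D.tens φ (D.tens ψ ξ),
      IsAssoc D α.hom ∧
      ∀ P : PullPush (outerEdges₃ C) (innerEdge₃ C),
        ∃ (α₁ : HallDatum.triple P φ ψ ξ ≅ D.tens (D.tens φ ψ) ξ)
          (α₂ : HallDatum.triple P φ ψ ξ ≅ D.tens φ (D.tens ψ ξ)),
          D.IsLeftComparison P φ ψ ξ α₁.hom ∧ D.IsRightComparison P φ ψ ξ α₂.hom ∧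
            α = α₁.symm ≪≫ α₂ := by
  obtain ⟨μ, h, hμ⟩ := exists_isLeftKanExtension_tens_left D φ ψ ξ
  obtain ⟨ν, h', hν⟩ := exists_isLeftKanExtension_tens_right D φ ψ ξ
  refine ⟨funIsoOfIsLeftKanExtension μ ν h h', fun t => ?_, fun P => ?_⟩
  · rw [← hν, ← app_comp_funIsoOfIsLeftKanExtension μ ν h h' t, hμ, Category.assoc, Category.assoc]
  · let π : outerEdges₃ C ⋙ φ.obj.prod (ψ.obj.prod ξ.obj ⋙ tensor VectC) ⋙ tensor VectC ⟶
        restrict (edgeMap (n := 3) 0 3 (by decide)) ⋙ (HallDatum.triple P φ ψ ξ).obj :=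
      P.unit (boxObj φ (boxObj ψ ξ))
    have hπ : (HallDatum.triple P φ ψ ξ).obj.IsLeftKanExtension π :=
      (P.isPointwiseLeftKanExtension (boxObj φ (boxObj ψ ξ))).some.isLeftKanExtension
    refine ⟨funIsoOfIsLeftKanExtension π μ hπ h, funIsoOfIsLeftKanExtension π ν hπ h',
      fun t => ?_, fun t => ?_, ?_⟩
    · exact (app_comp_funIsoOfIsLeftKanExtension π μ hπ h t).trans (hμ t)
    · exact (app_comp_funIsoOfIsLeftKanExtension π ν hπ h' t).trans (hν t)
    -- `α` and `α₁⁻¹ ≫ α₂` agree after composition with the structure map `π`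
    · rw [← Iso.symm_self_id_assoc (funIsoOfIsLeftKanExtension π μ hπ h)
        (funIsoOfIsLeftKanExtension μ ν h h')]
      congr 1
      ext1
      refine fun_hom_ext_of_isLeftKanExtension π hπ fun t => ?_
      refine Eq.trans ?_ (app_comp_funIsoOfIsLeftKanExtension π ν hπ h' t).symm
      refine Eq.trans ?_ (app_comp_funIsoOfIsLeftKanExtension μ ν h h' t)
      rw [← app_comp_funIsoOfIsLeftKanExtension π μ hπ h t]
      exact (Category.assoc _ _ _).symm

/-- The map `{0, 1} → {0, 1}` with values `0`, `1` is the identity, so that `a ↦ a_{01}` is an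
equivalence. -/
instance : (restrict (C := C) (edgeMap (n := 1) 0 1 (Fin.zero_le 1))).IsEquivalence := by
  have h : edgeMap (n := 1) 0 1 (Fin.zero_le 1) = OrderHom.id := by
    ext x; fin_cases x <;> rfl
  rw [h]
  let e : 𝟭 (S C 1) ≅ restrict (OrderHom.id : Fin 2 →o Fin 2) :=
    NatIso.ofComponents (fun t => Iso.refl t)
      (fun u => (Category.comp_id _).trans (Category.id_comp _).symm)
  exact Functor.isEquivalence_of_iso e

/-- Both `I ⊗ φ` and `φ` are left Kan extensions of `φ` along the equivalence `a ↦ a_{01}`. -/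
theorem exists_leftUnitor (φ : Fun (S C 1)) :
    ∃ l : D.tens D.unitObj φ ≅ φ, D.IsLeftUnit φ l.hom := by
  obtain ⟨μ, h, hμ⟩ := exists_isLeftKanExtension_unit_tens D φ
  let e : restrict (edgeMap (n := 1) 0 1 (by decide)) ⋙ φ.obj ⟶
    restrict (edgeMap (n := 1) 0 1 (by decide)) ⋙ φ.obj := 𝟙 _
  have he : φ.obj.IsLeftKanExtension e := inferInstance
  refine ⟨funIsoOfIsLeftKanExtension μ e h he, fun a => ?_⟩
  refine (Category.assoc _ _ _).symm.trans ?_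
  rw [← hμ, Category.assoc]
  refine (congrArg ((λ_ _).hom ≫ ·) (app_comp_funIsoOfIsLeftKanExtension μ e h he a)).trans ?_
  exact Category.comp_id _

/-- Both `φ ⊗ I` and `φ` are left Kan extensions of `φ` along the equivalence `a ↦ a_{01}`. -/
theorem exists_rightUnitor (φ : Fun (S C 1)) :
    ∃ r : D.tens φ D.unitObj ≅ φ, D.IsRightUnit φ r.hom := by
  obtain ⟨μ, h, hμ⟩ := exists_isLeftKanExtension_tens_unit D φ
  let e : restrict (edgeMap (n := 1) 0 1 (by decide)) ⋙ φ.obj ⟶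
    restrict (edgeMap (n := 1) 0 1 (by decide)) ⋙ φ.obj := 𝟙 _
  have he : φ.obj.IsLeftKanExtension e := inferInstance
  refine ⟨funIsoOfIsLeftKanExtension μ e h he, fun a => ?_⟩
  refine (Category.assoc _ _ _).symm.trans ?_
  rw [← hμ, Category.assoc]
  refine (congrArg ((ρ_ _).hom ≫ ·) (app_comp_funIsoOfIsLeftKanExtension μ e h he a)).trans ?_
  exact Category.comp_id _

end

/-! ### Structure maps at the faces of a flag -/

section

theorem map_id_tensorHom_map_id_comp {A : Type u₁} [Category.{v₁} A] {V : Type u₂}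
    [Category.{v₂} V] [MonoidalCategory V] (F G H : A ⥤ V) {x y z : A}
    (f : F.obj x ⊗ G.obj y ⟶ H.obj z) :
    (F.map (𝟙 x) ⊗ₘ G.map (𝟙 y)) ≫ f ≫ H.map (𝟙 z) = f := by
  simp

variable {C : Type u} [Category.{v} C]

theorem restrict_obj_restrict_obj [HasZeroObject C] {l m n : ℕ} (f : Fin (l + 1) →o Fin (m + 1))
    (g : Fin (m + 1) →o Fin (n + 1)) (h : Fin (l + 1) →o Fin (n + 1)) (hc : g.comp f = h)
    (t : S C n) : (restrict f).obj ((restrict g).obj t) = (restrict h).obj t :=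
  congrArg (fun k => (restrict k).obj t) hc

section

variable [HasZeroObject C] {m n : ℕ} (g : Fin (m + 1) →o Fin (n + 1)) (t : S C n)

theorem vertex_restrict (a : Fin (m + 1)) (i : Fin (n + 1)) (ha : g a = i) :
    (restrict (vertexMap a)).obj ((restrict g).obj t) = (restrict (vertexMap i)).obj t := by
  refine restrict_obj_restrict_obj _ _ _ ?_ t
  ext x; fin_cases x
  exact congrArg Fin.val ha

theorem edge_restrict (a b : Fin (m + 1)) (i j : Fin (n + 1)) (ha : g a = i) (hb : g b = j)
    (h : a ≤ b) (h' : i ≤ j) :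
    (restrict (edgeMap a b h)).obj ((restrict g).obj t) = (restrict (edgeMap i j h')).obj t := by
  refine restrict_obj_restrict_obj _ _ _ ?_ t
  ext x; fin_cases x
  exacts [congrArg Fin.val ha, congrArg Fin.val hb]

theorem triangle_restrict (a b c : Fin (m + 1)) (i j k : Fin (n + 1)) (ha : g a = i)
    (hb : g b = j) (hc : g c = k) (hab : a ≤ b) (hbc : b ≤ c) (hij : i ≤ j) (hjk : j ≤ k) :
    (restrict (triangleMap a b c hab hbc)).obj ((restrict g).obj t) =
      (restrict (triangleMap i j k hij hjk)).obj t := by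
  refine restrict_obj_restrict_obj _ _ _ ?_ t
  ext x; fin_cases x
  exacts [congrArg Fin.val ha, congrArg Fin.val hb, congrArg Fin.val hc]

end

section

variable [HasZeroObject C] (D : HallDatum C)

/-- The structure map of `φ ⊗ ψ` at a triangle `s` with edges `x`, `y` and `z`. Naming the edges by
variables turns the passage from a flag to its faces into rewriting with equalities of objects. -/
def triUnit (φ ψ : Fun (S C 1)) (s : S C 2) (x y z : S C 1)
    (hx : (restrict (edgeMap 0 1 (by decide))).obj s = x)
    (hy : (restrict (edgeMap 1 2 (by decide))).obj s = y)
    (hz : (restrict (edgeMap 0 2 (by decide))).obj s = z) :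
    φ.obj.obj x ⊗ ψ.obj.obj y ⟶ (D.tens φ ψ).obj.obj z :=
  (φ.obj.map (eqToHom hx.symm) ⊗ₘ ψ.obj.map (eqToHom hy.symm)) ≫
    (tensUnit D φ ψ).app s ≫ (D.tens φ ψ).obj.map (eqToHom hz)

theorem mulMap_eq_triUnit (φ ψ : Fun (S C 1)) {n : ℕ} (t : S C n) (i j k : Fin (n + 1))
    (hij : i ≤ j) (hjk : j ≤ k) :
    D.mulMap φ ψ t i j k hij hjk =
      triUnit D φ ψ ((restrict (triangleMap i j k hij hjk)).obj t)
        ((restrict (edgeMap i j hij)).obj t) ((restrict (edgeMap j k hjk)).obj t)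
        ((restrict (edgeMap i k (hij.trans hjk))).obj t)
        (edge_triangle_01 t i j k hij hjk) (edge_triangle_12 t i j k hij hjk)
        (edge_triangle_02 t i j k hij hjk) := rfl

theorem triUnit_rfl (φ ψ : Fun (S C 1)) (s : S C 2) :
    triUnit D φ ψ s _ _ _ rfl rfl rfl = (tensUnit D φ ψ).app s :=
  map_id_tensorHom_map_id_comp φ.obj ψ.obj (D.tens φ ψ).obj ((tensUnit D φ ψ).app s)

/-- The structure map of `I` at a vertex `s` with degenerate edge `x`. -/
def ptUnit (s : S C 0) (x : S C 1) (hx : (restrict (edgeMap 0 0 le_rfl)).obj s = x) :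
    𝟙_ VectC ⟶ D.unitObj.obj.obj x :=
  (oneUnit D).app s ≫ D.unitObj.obj.map (eqToHom hx)

theorem oneMap_eq_ptUnit {n : ℕ} (t : S C n) (i : Fin (n + 1)) :
    D.oneMap t i = ptUnit D ((restrict (vertexMap i)).obj t)
      ((restrict (edgeMap i i le_rfl)).obj t) (degeneracy_vertex t i) := rfl

/-- The structure maps are natural in `φ` and `ψ`. -/
theorem triUnit_naturality {φ ψ φ' ψ' : Fun (S C 1)} (f : φ ⟶ φ') (g : ψ ⟶ ψ') (s : S C 2)
    (x y z : S C 1) (hx hy hz) :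
    triUnit D φ ψ s x y z hx hy hz ≫ (D.tensorFunctor.map (Prod.mkHom f g)).hom.app z =
      (f.hom.app x ⊗ₘ g.hom.app y) ≫ triUnit D φ' ψ' s x y z hx hy hz := by
  subst hx hy hz
  rw [triUnit_rfl, triUnit_rfl]
  exact congrArg (fun τ => τ.app s) (D.mul.unit_naturality
    ((box (A := S C 1) (B := S C 1)).map (Prod.mkHom f g)))

theorem mulMap_naturality {φ ψ φ' ψ' : Fun (S C 1)} (f : φ ⟶ φ') (g : ψ ⟶ ψ') {n : ℕ}
    (t : S C n) (i j k : Fin (n + 1)) (hij : i ≤ j) (hjk : j ≤ k) :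
    D.mulMap φ ψ t i j k hij hjk ≫ (D.tensorFunctor.map (Prod.mkHom f g)).hom.app
        ((restrict (edgeMap i k (hij.trans hjk))).obj t) =
      (f.hom.app ((restrict (edgeMap i j hij)).obj t) ⊗ₘ
        g.hom.app ((restrict (edgeMap j k hjk)).obj t)) ≫ D.mulMap φ' ψ' t i j k hij hjk := by
  rw [mulMap_eq_triUnit, mulMap_eq_triUnit]
  exact triUnit_naturality D f g _ _ _ _ _ _ _

/-- The equation between structure maps which characterizes the associator, for the four triangles
of a tetrahedron. The incidence relations are quantified over in the statement, so that triangles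
and edges may be replaced by equal ones. -/
def AssocAt (φ ψ ξ : Fun (S C 1)) (a : D.tens (D.tens φ ψ) ξ ⟶ D.tens φ (D.tens ψ ξ))
    (s₀₁₂ s₀₂₃ s₁₂₃ s₀₁₃ : S C 2) (x y z xy yz w : S C 1) : Prop :=
  ∀ h₁ h₂ h₃ h₄ h₅ h₆ h₇ h₈ h₉ h₁₀ h₁₁ h₁₂,
    (α_ _ _ _).inv ≫ (triUnit D φ ψ s₀₁₂ x y xy h₁ h₂ h₃ ▷ ξ.obj.obj z) ≫
      triUnit D (D.tens φ ψ) ξ s₀₂₃ xy z w h₄ h₅ h₆ ≫ a.hom.app w =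
    (φ.obj.obj x ◁ triUnit D ψ ξ s₁₂₃ y z yz h₇ h₈ h₉) ≫
      triUnit D φ (D.tens ψ ξ) s₀₁₃ x yz w h₁₀ h₁₁ h₁₂

/-- The equation satisfied by an associator at all `t ∈ S_3` holds at all, possibly degenerate,
tetrahedra of flags. -/
theorem mulMap_assoc (φ ψ ξ : Fun (S C 1))
    (a : D.tens (D.tens φ ψ) ξ ⟶ D.tens φ (D.tens ψ ξ))
    (ha : IsAssoc D a)
    {n : ℕ} (t : S C n) (i j k l : Fin (n + 1)) (hij : i ≤ j) (hjk : j ≤ k) (hkl : k ≤ l) :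
    (D.mulMap φ ψ t i j k hij hjk ▷ ξ.obj.obj ((restrict (edgeMap k l hkl)).obj t)) ≫
        D.mulMap (D.tens φ ψ) ξ t i k l (hij.trans hjk) hkl ≫
        a.hom.app ((restrict (edgeMap i l ((hij.trans hjk).trans hkl))).obj t) =
      (α_ _ _ _).hom ≫ (φ.obj.obj ((restrict (edgeMap i j hij)).obj t) ◁
          D.mulMap ψ ξ t j k l hjk hkl) ≫
        D.mulMap φ (D.tens ψ ξ) t i j l hij (hjk.trans hkl) := by
  have key : ∀ t : S C 3, AssocAt D φ ψ ξ a
      ((restrict (triangleMap 0 1 2 (by decide) (by decide))).obj t)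
      ((restrict (triangleMap 0 2 3 (by decide) (by decide))).obj t)
      ((restrict (triangleMap 1 2 3 (by decide) (by decide))).obj t)
      ((restrict (triangleMap 0 1 3 (by decide) (by decide))).obj t)
      ((restrict (edgeMap 0 1 (by decide))).obj t) ((restrict (edgeMap 1 2 (by decide))).obj t)
      ((restrict (edgeMap 2 3 (by decide))).obj t) ((restrict (edgeMap 0 2 (by decide))).obj t)
      ((restrict (edgeMap 1 3 (by decide))).obj t)
      ((restrict (edgeMap 0 3 (by decide))).obj t) := by
    intro t _ _ _ _ _ _ _ _ _ _ _ _
    have := ha t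
    rw [mulMap_eq_triUnit, mulMap_eq_triUnit, mulMap_eq_triUnit, mulMap_eq_triUnit] at this
    exact this
  have h := key ((restrict (tetrahedronMap i j k l hij hjk hkl)).obj t)
  let g := tetrahedronMap i j k l hij hjk hkl
  have hik := hij.trans hjk
  have hjl := hjk.trans hkl
  rw [triangle_restrict g t 0 1 2 i j k rfl rfl rfl _ _ hij hjk,
    triangle_restrict g t 0 2 3 i k l rfl rfl rfl _ _ hik hkl,
    triangle_restrict g t 1 2 3 j k l rfl rfl rfl _ _ hjk hkl,
    triangle_restrict g t 0 1 3 i j l rfl rfl rfl _ _ hij hjl,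
    edge_restrict g t 0 1 i j rfl rfl _ hij, edge_restrict g t 1 2 j k rfl rfl _ hjk,
    edge_restrict g t 2 3 k l rfl rfl _ hkl, edge_restrict g t 0 2 i k rfl rfl _ hik,
    edge_restrict g t 1 3 j l rfl rfl _ hjl,
    edge_restrict g t 0 3 i l rfl rfl _ (hik.trans hkl)] at h
  rw [← Iso.inv_comp_eq, mulMap_eq_triUnit, mulMap_eq_triUnit, mulMap_eq_triUnit,
    mulMap_eq_triUnit]
  exact h _ _ _ _ _ _ _ _ _ _ _ _

/-- The equation between structure maps which characterizes the left unitor. -/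
def LeftUnitAt (φ : Fun (S C 1)) (l : D.tens D.unitObj φ ⟶ φ) (p : S C 0) (s : S C 2)
    (x y : S C 1) : Prop :=
  ∀ h₁ h₂ h₃ h₄, (ptUnit D p x h₁ ▷ φ.obj.obj y) ≫
    triUnit D D.unitObj φ s x y y h₂ h₃ h₄ ≫ l.hom.app y = (λ_ _).hom

/-- The equation between structure maps which characterizes the right unitor. -/
def RightUnitAt (φ : Fun (S C 1)) (r : D.tens φ D.unitObj ⟶ φ) (p : S C 0) (s : S C 2)
    (x y : S C 1) : Prop :=
  ∀ h₁ h₂ h₃ h₄, (φ.obj.obj y ◁ ptUnit D p x h₁) ≫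
    triUnit D φ D.unitObj s y x y h₂ h₃ h₄ ≫ r.hom.app y = (ρ_ _).hom

/-- The equation satisfied by a left unitor at all `a ∈ S_1` holds at all edges of flags. -/
theorem mulMap_leftUnit (φ : Fun (S C 1)) (l : D.tens D.unitObj φ ⟶ φ)
    (hl : D.IsLeftUnit φ l) {n : ℕ} (t : S C n) (i j : Fin (n + 1)) (hij : i ≤ j) :
    (D.oneMap t i ▷ φ.obj.obj ((restrict (edgeMap i j hij)).obj t)) ≫
        D.mulMap D.unitObj φ t i i j le_rfl hij ≫
        l.hom.app ((restrict (edgeMap i j hij)).obj t) =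
      (λ_ _).hom := by
  have key : ∀ t : S C 1, LeftUnitAt D φ l ((restrict (vertexMap 0)).obj t)
      ((restrict (triangleMap 0 0 1 le_rfl (Fin.zero_le 1))).obj t)
      ((restrict (edgeMap 0 0 le_rfl)).obj t)
      ((restrict (edgeMap 0 1 (Fin.zero_le 1))).obj t) := by
    intro t _ _ _ _
    have := hl t
    rw [mulMap_eq_triUnit, oneMap_eq_ptUnit] at this
    exact this
  have h := key ((restrict (edgeMap i j hij)).obj t)
  let g := edgeMap i j hij
  rw [vertex_restrict g t 0 i rfl, triangle_restrict g t 0 0 1 i i j rfl rfl rfl _ _ le_rfl hij,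
    edge_restrict g t 0 0 i i rfl rfl _ le_rfl, edge_restrict g t 0 1 i j rfl rfl _ hij] at h
  rw [mulMap_eq_triUnit, oneMap_eq_ptUnit]
  exact h _ _ _ _

/-- The equation satisfied by a right unitor at all `a ∈ S_1` holds at all edges of flags. -/
theorem mulMap_rightUnit (φ : Fun (S C 1)) (r : D.tens φ D.unitObj ⟶ φ)
    (hr : D.IsRightUnit φ r) {n : ℕ} (t : S C n) (i j : Fin (n + 1)) (hij : i ≤ j) :
    (φ.obj.obj ((restrict (edgeMap i j hij)).obj t) ◁ D.oneMap t j) ≫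
        D.mulMap φ D.unitObj t i j j hij le_rfl ≫
        r.hom.app ((restrict (edgeMap i j hij)).obj t) =
      (ρ_ _).hom := by
  have key : ∀ t : S C 1, RightUnitAt D φ r ((restrict (vertexMap 1)).obj t)
      ((restrict (triangleMap 0 1 1 (Fin.zero_le 1) le_rfl)).obj t)
      ((restrict (edgeMap 1 1 le_rfl)).obj t)
      ((restrict (edgeMap 0 1 (Fin.zero_le 1))).obj t) := by
    intro t _ _ _ _
    have := hr t
    rw [mulMap_eq_triUnit, oneMap_eq_ptUnit] at this
    exact this
  have h := key ((restrict (edgeMap i j hij)).obj t)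
  let g := edgeMap i j hij
  rw [vertex_restrict g t 1 j rfl, triangle_restrict g t 0 1 1 i j j rfl rfl rfl _ _ hij le_rfl,
    edge_restrict g t 1 1 j j rfl rfl _ le_rfl, edge_restrict g t 0 1 i j rfl rfl _ hij] at h
  rw [mulMap_eq_triUnit, oneMap_eq_ptUnit]
  exact h _ _ _ _

end

end

/-! ### Morphisms out of iterated products -/

section

/-- Let `E` be a pointwise left Kan extension with structure map `μ`, and `G` a left Kan extension
of `E ⊠ Z` with structure map `ν`. Morphisms out of `G` are determined by their composites with
`μ ⊗ Z` and `ν`, and it suffices to test on one representative of each gluing `e` up to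
isomorphism. -/
theorem hom_ext_glue_tensorRight {X : Type u₁} [Category.{v₁} X] {Y : Type u₂} [Category.{v₂} Y]
    {A : Type u₃} [Category.{v₃} A] {V : Type u₄} [Category.{v₄} V] [MonoidalCategory V]
    (hV : ∀ W : V, (tensorRight W).IsLeftAdjoint)
    {N : X ⥤ A} {F : X ⥤ V} {E : A ⥤ V} (μ : F ⟶ N ⋙ E)
    (hμ : (Functor.LeftExtension.mk E μ).IsPointwiseLeftKanExtension)
    {P Q R : Y ⥤ A} {Z G G' : A ⥤ V} (ν : P.prod' Q ⋙ E.prod Z ⋙ tensor V ⟶ R ⋙ G)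
    (hν : G.IsLeftKanExtension ν) (f g : G ⟶ G')
    (hfg : ∀ (t : X) (s : Y) (e : N.obj t ⟶ P.obj s), ∃ (t' : X) (s' : Y) (p : t' ⟶ t)
      (q : s' ⟶ s) (h : N.obj t' ⟶ P.obj s'), IsIso p ∧ IsIso q ∧ N.map p ≫ e = h ≫ P.map q ∧
      ((μ.app t' ≫ E.map h) ▷ Z.obj (Q.obj s')) ≫ ν.app s' ≫ f.app (R.obj s') =
        ((μ.app t' ≫ E.map h) ▷ Z.obj (Q.obj s')) ≫ ν.app s' ≫ g.app (R.obj s')) :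
    f = g := by
  refine G.hom_ext_of_isLeftKanExtension ν _ _ ?_
  ext1
  ext1 s
  have := hV (Z.obj (Q.obj s))
  refine (isColimitOfPreserves (tensorRight (Z.obj (Q.obj s)))
    (hμ (P.obj s))).hom_ext fun x => ?_
  obtain ⟨t', s', p, q, h, hp, hq, hc, hfg⟩ := hfg x.left s x.hom
  have key : ∀ f : G ⟶ G', (F.map p ⊗ₘ Z.map (Q.map q)) ≫
      ((μ.app x.left ≫ E.map x.hom) ▷ Z.obj (Q.obj s)) ≫ ν.app s ≫ f.app (R.obj s) =
        (((μ.app t' ≫ E.map h) ▷ Z.obj (Q.obj s')) ≫ ν.app s' ≫ f.app (R.obj s')) ≫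
          G'.map (R.map q) := by
    intro f
    have h₁ : F.map p ≫ μ.app x.left ≫ E.map x.hom =
        (μ.app t' ≫ E.map h) ≫ E.map (P.map q) := by
      rw [Category.assoc, ← E.map_comp, ← hc, E.map_comp]
      exact (Category.assoc _ _ _).symm.trans
        ((congrArg (· ≫ E.map x.hom) (μ.naturality p)).trans (Category.assoc _ _ _))
    have h₂ : (E.map (P.map q) ⊗ₘ Z.map (Q.map q)) ≫ ν.app s =
        ν.app s' ≫ G.map (R.map q) := ν.naturality q
    have h₃ : G.map (R.map q) ≫ f.app (R.obj s) = f.app (R.obj s') ≫ G'.map (R.map q) :=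
      f.naturality _
    rw [← tensorHom_id, tensorHom_comp_tensorHom_assoc, h₁, Category.comp_id,
      ← Category.id_comp (Z.map (Q.map q)), ← tensorHom_comp_tensorHom_assoc, tensorHom_id,
      ← Category.assoc (E.map (P.map q) ⊗ₘ Z.map (Q.map q)), h₂]
    simp only [Category.assoc, h₃]
  have : IsIso (F.map p ⊗ₘ Z.map (Q.map q)) := inferInstance
  exact (cancel_epi (F.map p ⊗ₘ Z.map (Q.map q))).1
    ((key f).trans ((congrArg (· ≫ G'.map (R.map q)) hfg).trans (key g).symm))

theorem map_id_whiskerRight_comp {A : Type u₁} [Category.{v₁} A] {V : Type u₂}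
    [Category.{v₂} V] [MonoidalCategory V] (F : A ⥤ V) {x : A} (W : V) {Z : V}
    (f : F.obj x ⊗ W ⟶ Z) : (F.map (𝟙 x) ▷ W) ≫ f = f := by
  simp

theorem comp_whiskerRight_agree {V : Type u₁} [Category.{v₁} V] [MonoidalCategory V]
    {P P' Q Q' R W G G' : V} {a : P ⟶ P'} {b : P' ⟶ Q} {m : Q ⟶ Q'} {μ : P ⟶ Q'}
    (hμ : μ = a ≫ b ≫ m) {e : Q' ⟶ R} {u : R ⊗ W ⟶ G} {f g : G ⟶ G'}
    (h : ((b ≫ m) ▷ W) ≫ (e ▷ W ≫ u) ≫ f = ((b ≫ m) ▷ W) ≫ (e ▷ W ≫ u) ≫ g) :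
    ((μ ≫ e) ▷ W) ≫ u ≫ f = ((μ ≫ e) ▷ W) ≫ u ≫ g := by
  subst hμ
  simp only [comp_whiskerRight, Category.assoc] at h ⊢
  rw [h]

variable {C : Type u} [Category.{v} C]

section

variable [HasZeroObject C] (D : HallDatum C)

/-- The condition that `f` and `g` agree on the structure map of `φ ⊗ ψ` at a triangle. -/
def AgreeAt (φ ψ : Fun (S C 1)) {ω : Fun (S C 1)} (f g : D.tens φ ψ ⟶ ω) (s : S C 2)
    (x y z : S C 1) : Prop :=
  ∀ h₁ h₂ h₃, triUnit D φ ψ s x y z h₁ h₂ h₃ ≫ f.hom.app z =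
    triUnit D φ ψ s x y z h₁ h₂ h₃ ≫ g.hom.app z

theorem triangle_self (s : S C 2) :
    (restrict (triangleMap 0 1 2 (Fin.zero_le 1) (by decide))).obj s = s := by
  have h : triangleMap (n := 2) 0 1 2 (Fin.zero_le 1) (by decide) = OrderHom.id := by
    ext x; fin_cases x <;> rfl
  exact congrArg (fun k => (restrict k).obj s) h

theorem triUnit_rfl_rfl (φ ψ : Fun (S C 1)) (s : S C 2) (x : S C 1)
    (hx : (restrict (edgeMap 0 1 (by decide))).obj s = x) :
    triUnit D φ ψ s x _ _ hx rfl rfl =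
      (φ.obj.map (eqToHom hx.symm) ▷ ψ.obj.obj ((restrict (edgeMap 1 2 (by decide))).obj s)) ≫
        (tensUnit D φ ψ).app s := by
  subst hx
  rw [triUnit_rfl]
  exact (map_id_whiskerRight_comp φ.obj _ _).symm

/-- Morphisms out of `φ ⊗ ψ` are determined by their composites with the structure maps. -/
theorem tens_hom_ext {φ ψ ω : Fun (S C 1)} {f g : D.tens φ ψ ⟶ ω}
    (h : ∀ s : S C 2, D.mulMap φ ψ s 0 1 2 (Fin.zero_le 1) (by decide) ≫
        f.hom.app ((restrict (edgeMap 0 2 (Fin.zero_le 2))).obj s) =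
      D.mulMap φ ψ s 0 1 2 (Fin.zero_le 1) (by decide) ≫
        g.hom.app ((restrict (edgeMap 0 2 (Fin.zero_le 2))).obj s)) : f = g := by
  refine fun_hom_ext_of_isLeftKanExtension (tensUnit D φ ψ) (isLeftKanExtension_tensUnit D φ ψ)
    fun s => ?_
  have key : AgreeAt D φ ψ f g
      ((restrict (triangleMap 0 1 2 (Fin.zero_le 1) (by decide))).obj s)
      ((restrict (edgeMap 0 1 (by decide))).obj s) ((restrict (edgeMap 1 2 (by decide))).obj s)
      ((restrict (edgeMap 0 2 (by decide))).obj s) := by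
    intro _ _ _
    have := h s
    rw [mulMap_eq_triUnit] at this
    exact this
  rw [triangle_self] at key
  rw [← triUnit_rfl]
  exact key _ _ _

end

section

variable [ProtoAbelian C] (D : HallDatum C)

/-- Morphisms out of `(φ ⊗ ψ) ⊗ ξ` are determined by their composites with the structure maps. -/
theorem tens_tens_hom_ext {φ ψ ξ ω : Fun (S C 1)} {f g : D.tens (D.tens φ ψ) ξ ⟶ ω}
    (h : ∀ t : S C 3, (D.mulMap φ ψ t 0 1 2 (by decide) (by decide) ▷
          ξ.obj.obj ((restrict (edgeMap 2 3 (by decide))).obj t)) ≫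
        D.mulMap (D.tens φ ψ) ξ t 0 2 3 (by decide) (by decide) ≫
          f.hom.app ((restrict (edgeMap 0 3 (by decide))).obj t) =
      (D.mulMap φ ψ t 0 1 2 (by decide) (by decide) ▷
          ξ.obj.obj ((restrict (edgeMap 2 3 (by decide))).obj t)) ≫
        D.mulMap (D.tens φ ψ) ξ t 0 2 3 (by decide) (by decide) ≫
          g.hom.app ((restrict (edgeMap 0 3 (by decide))).obj t)) : f = g := by
  obtain ⟨μ, hμ, hμ'⟩ := exists_isLeftKanExtension_tens_left D φ ψ ξ
  refine fun_hom_ext_of_isLeftKanExtension μ hμ fun t => ?_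
  rw [hμ', Category.assoc, Category.assoc, Category.assoc, Category.assoc]
  exact congrArg ((α_ _ _ _).inv ≫ ·) (h t)

/-- The condition that `f` and `g` agree on the composite of the structure maps of
`((φ ⊗ ψ) ⊗ ξ) ⊗ ζ` at three triangles. -/
def AgreeAt₃ (φ ψ ξ ζ : Fun (S C 1)) {ω : Fun (S C 1)}
    (f g : D.tens (D.tens (D.tens φ ψ) ξ) ζ ⟶ ω)
    (s₀₁₂ s₀₂₃ s₀₃₄ : S C 2) (x y z xy xyz w v : S C 1) : Prop :=
  ∀ h₁ h₂ h₃ h₄ h₅ h₆ h₇ h₈ h₉,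
    ((triUnit D φ ψ s₀₁₂ x y xy h₁ h₂ h₃ ▷ ξ.obj.obj z ≫
        triUnit D (D.tens φ ψ) ξ s₀₂₃ xy z xyz h₄ h₅ h₆) ▷ ζ.obj.obj w) ≫
      triUnit D (D.tens (D.tens φ ψ) ξ) ζ s₀₃₄ xyz w v h₇ h₈ h₉ ≫ f.hom.app v =
    ((triUnit D φ ψ s₀₁₂ x y xy h₁ h₂ h₃ ▷ ξ.obj.obj z ≫
        triUnit D (D.tens φ ψ) ξ s₀₂₃ xy z xyz h₄ h₅ h₆) ▷ ζ.obj.obj w) ≫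
      triUnit D (D.tens (D.tens φ ψ) ξ) ζ s₀₃₄ xyz w v h₇ h₈ h₉ ≫ g.hom.app v

/-- Left Kan extensions of `φ ⊠ ψ ⊠ ξ` along `S_3 ⥤ S_1` are pointwise because a pointwise one
exists. -/
theorem isPointwiseLeftKanExtension_of_fun [Finitary C] {φ ψ ξ ω : Fun (S C 1)}
    (μ : outerEdges₃ C ⋙ φ.obj.prod (ψ.obj.prod ξ.obj ⋙ tensor VectC) ⋙ tensor VectC ⟶
        restrict (edgeMap (n := 3) 0 3 (by decide)) ⋙ ω.obj) (hμ : ω.obj.IsLeftKanExtension μ) :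
    Nonempty (Functor.LeftExtension.mk ω.obj μ).IsPointwiseLeftKanExtension := by
  obtain ⟨P⟩ := nonempty_pullPush₃ C
  have := (P.isPointwiseLeftKanExtension
    (boxObj φ (boxObj ψ ξ))).some.hasPointwiseLeftKanExtension
  exact ⟨Functor.isPointwiseLeftKanExtensionOfIsLeftKanExtension ω.obj μ⟩

/-- Morphisms out of `((φ ⊗ ψ) ⊗ ξ) ⊗ ζ` are determined by their composites with the structure
maps. -/
theorem tens_tens_tens_hom_ext [Finitary C] {φ ψ ξ ζ ω : Fun (S C 1)}
    {f g : D.tens (D.tens (D.tens φ ψ) ξ) ζ ⟶ ω}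
    (h : ∀ T : S C 4,
      ((D.mulMap φ ψ T 0 1 2 (by decide) (by decide) ▷
            ξ.obj.obj ((restrict (edgeMap 2 3 (by decide))).obj T) ≫
          D.mulMap (D.tens φ ψ) ξ T 0 2 3 (by decide) (by decide)) ▷
            ζ.obj.obj ((restrict (edgeMap 3 4 (by decide))).obj T)) ≫
        D.mulMap (D.tens (D.tens φ ψ) ξ) ζ T 0 3 4 (by decide) (by decide) ≫
          f.hom.app ((restrict (edgeMap 0 4 (by decide))).obj T) =
      ((D.mulMap φ ψ T 0 1 2 (by decide) (by decide) ▷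
            ξ.obj.obj ((restrict (edgeMap 2 3 (by decide))).obj T) ≫
          D.mulMap (D.tens φ ψ) ξ T 0 2 3 (by decide) (by decide)) ▷
            ζ.obj.obj ((restrict (edgeMap 3 4 (by decide))).obj T)) ≫
        D.mulMap (D.tens (D.tens φ ψ) ξ) ζ T 0 3 4 (by decide) (by decide) ≫
          g.hom.app ((restrict (edgeMap 0 4 (by decide))).obj T)) : f = g := by
  obtain ⟨μ, hμ, hμ'⟩ := exists_isLeftKanExtension_tens_left D φ ψ ξ
  refine ObjectProperty.hom_ext _ (hom_ext_glue_tensorRight VectC.isLeftAdjoint_tensorRight μ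
    (isPointwiseLeftKanExtension_of_fun μ hμ).some (tensUnit D (D.tens (D.tens φ ψ) ξ) ζ)
    (isLeftKanExtension_tensUnit D _ _) f.hom g.hom fun t s e => ?_)
  obtain ⟨T, p, q, hT, hpq⟩ := exists_glue_four t s e
  refine ⟨_, _, p, q, eqToHom hT, inferInstance, inferInstance, hpq, ?_⟩
  have key : AgreeAt₃ D φ ψ ξ ζ f g
      ((restrict (triangleMap 0 1 2 (by decide) (by decide))).obj T)
      ((restrict (triangleMap 0 2 3 (by decide) (by decide))).obj T)
      ((restrict (triangleMap 0 3 4 (by decide) (by decide))).obj T)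
      ((restrict (edgeMap 0 1 (by decide))).obj T) ((restrict (edgeMap 1 2 (by decide))).obj T)
      ((restrict (edgeMap 2 3 (by decide))).obj T) ((restrict (edgeMap 0 2 (by decide))).obj T)
      ((restrict (edgeMap 0 3 (by decide))).obj T) ((restrict (edgeMap 3 4 (by decide))).obj T)
      ((restrict (edgeMap 0 4 (by decide))).obj T) := by
    intro _ _ _ _ _ _ _ _ _
    have := h T
    rw [mulMap_eq_triUnit, mulMap_eq_triUnit, mulMap_eq_triUnit] at this
    exact this
  -- pass to the faces `T_{0123}` and `T_{034}`, where `μ` and the structure map are evaluated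
  let d : Fin 4 →o Fin 5 := tetrahedronMap 0 1 2 3 (by decide) (by decide) (by decide)
  let c : Fin 3 →o Fin 5 := triangleMap 0 3 4 (by decide) (by decide)
  rw [← triangle_restrict d T 0 1 2 0 1 2 rfl rfl rfl (by decide) (by decide),
    ← triangle_restrict d T 0 2 3 0 2 3 rfl rfl rfl (by decide) (by decide),
    ← edge_restrict d T 0 1 0 1 rfl rfl (by decide),
    ← edge_restrict d T 1 2 1 2 rfl rfl (by decide),
    ← edge_restrict d T 2 3 2 3 rfl rfl (by decide),
    ← edge_restrict d T 0 2 0 2 rfl rfl (by decide),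
    ← edge_restrict d T 0 3 0 3 rfl rfl (by decide),
    ← edge_restrict c T 1 2 3 4 rfl rfl (by decide),
    ← edge_restrict c T 0 2 0 4 rfl rfl (by decide)] at key
  have key := key (edge_triangle_01 _ _ _ _ _ _) (edge_triangle_12 _ _ _ _ _ _)
    (edge_triangle_02 _ _ _ _ _ _) (edge_triangle_01 _ _ _ _ _ _) (edge_triangle_12 _ _ _ _ _ _)
    (edge_triangle_02 _ _ _ _ _ _) hT.symm rfl rfl
  rw [← mulMap_eq_triUnit, ← mulMap_eq_triUnit] at key
  rw [triUnit_rfl_rfl] at key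
  exact comp_whiskerRight_agree (hμ' ((restrict d).obj T)) key

end

end

/-! ### The axioms of a monoidal category -/

section

section

variable {V : Type u₁} [Category.{v₁} V] [MonoidalCategory V]

/-- The pentagon for elements: the maps `m` are the structure maps at the faces of a 4-simplex,
the hypotheses are the equations at its five tetrahedra and two naturality squares. -/
theorem pentagon_of_faces {a b c d ab bc cd abc abc' bcd bcd' w₁ w₂ w₃ w₄ w₅ : V}
    {m₀₁₂ : a ⊗ b ⟶ ab} {m₁₂₃ : b ⊗ c ⟶ bc} {m₂₃₄ : c ⊗ d ⟶ cd}
    {m₀₂₃ : ab ⊗ c ⟶ abc} {m₀₁₃ : a ⊗ bc ⟶ abc'} {m₁₃₄ : bc ⊗ d ⟶ bcd}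
    {m₁₂₄ : b ⊗ cd ⟶ bcd'} {m₀₃₄ : abc ⊗ d ⟶ w₁} {m₀₃₄' : abc' ⊗ d ⟶ w₂}
    {m₀₁₄ : a ⊗ bcd ⟶ w₃} {m₀₁₄' : a ⊗ bcd' ⟶ w₄} {m₀₂₄ : ab ⊗ cd ⟶ w₅}
    {α₀₃ : abc ⟶ abc'} {α₁₄ : bcd ⟶ bcd'} {f₁ : w₁ ⟶ w₂} {f₂ : w₂ ⟶ w₃} {f₃ : w₃ ⟶ w₄}
    {g₁ : w₁ ⟶ w₅} {g₂ : w₅ ⟶ w₄}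
    (h₀₁₂₃ : m₀₁₂ ▷ c ≫ m₀₂₃ ≫ α₀₃ = (α_ a b c).hom ≫ a ◁ m₁₂₃ ≫ m₀₁₃)
    (n₁ : m₀₃₄ ≫ f₁ = α₀₃ ▷ d ≫ m₀₃₄')
    (h₀₁₃₄ : m₀₁₃ ▷ d ≫ m₀₃₄' ≫ f₂ = (α_ a bc d).hom ≫ a ◁ m₁₃₄ ≫ m₀₁₄)
    (n₂ : m₀₁₄ ≫ f₃ = a ◁ α₁₄ ≫ m₀₁₄')
    (h₁₂₃₄ : m₁₂₃ ▷ d ≫ m₁₃₄ ≫ α₁₄ = (α_ b c d).hom ≫ b ◁ m₂₃₄ ≫ m₁₂₄)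
    (h₀₂₃₄ : m₀₂₃ ▷ d ≫ m₀₃₄ ≫ g₁ = (α_ ab c d).hom ≫ ab ◁ m₂₃₄ ≫ m₀₂₄)
    (h₀₁₂₄ : m₀₁₂ ▷ cd ≫ m₀₂₄ ≫ g₂ = (α_ a b cd).hom ≫ a ◁ m₁₂₄ ≫ m₀₁₄') :
    (m₀₁₂ ▷ c ≫ m₀₂₃) ▷ d ≫ m₀₃₄ ≫ f₁ ≫ f₂ ≫ f₃ = (m₀₁₂ ▷ c ≫ m₀₂₃) ▷ d ≫ m₀₃₄ ≫ g₁ ≫ g₂ := by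
  calc _ = (m₀₁₂ ▷ c ≫ m₀₂₃ ≫ α₀₃) ▷ d ≫ m₀₃₄' ≫ f₂ ≫ f₃ := by
        rw [reassoc_of% n₁]; simp only [comp_whiskerRight, Category.assoc]
    _ = (α_ a b c).hom ▷ d ≫ (a ◁ m₁₂₃) ▷ d ≫ (m₀₁₃ ▷ d ≫ m₀₃₄' ≫ f₂) ≫ f₃ := by
        rw [h₀₁₂₃]; simp only [comp_whiskerRight, Category.assoc]
    _ = (α_ a b c).hom ▷ d ≫ (α_ a (b ⊗ c) d).hom ≫ a ◁ (m₁₂₃ ▷ d ≫ m₁₃₄ ≫ α₁₄) ≫ m₀₁₄' := by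
        rw [h₀₁₃₄, Category.assoc, Category.assoc, n₂]
        simp only [whiskerLeft_comp, Category.assoc, associator_naturality_middle_assoc]
    _ = (m₀₁₂ ▷ c) ▷ d ≫ (α_ ab c d).hom ≫ ab ◁ m₂₃₄ ≫ m₀₂₄ ≫ g₂ := by
        rw [h₁₂₃₄, associator_naturality_left_assoc, ← whisker_exchange_assoc, h₀₁₂₄]
        simp only [whiskerLeft_comp, Category.assoc, pentagon_assoc,
          associator_naturality_right_assoc]
    _ = _ := by
        rw [comp_whiskerRight, Category.assoc, reassoc_of% h₀₂₃₄]

/-- The triangle for elements, at the degenerate tetrahedron `s_{0112}` of a triangle `s`. -/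
theorem triangle_of_faces {a b o ao ob w w₁ w₂ : V} {e : 𝟙_ V ⟶ o} {m₀₁₁ : a ⊗ o ⟶ ao}
    {m₁₁₂ : o ⊗ b ⟶ ob} {m₀₁₂ : a ⊗ b ⟶ w} {m₀₁₂' : ao ⊗ b ⟶ w₁} {m₀₁₂'' : a ⊗ ob ⟶ w₂}
    {r : ao ⟶ a} {r' : a ⟶ ao} {l : ob ⟶ b} {f : w ⟶ w₁} {α : w₁ ⟶ w₂} {g : w₂ ⟶ w}
    (hr : a ◁ e ≫ m₀₁₁ ≫ r = (ρ_ a).hom) (hr' : r ≫ r' = 𝟙 _)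
    (hl : e ▷ b ≫ m₁₁₂ ≫ l = (λ_ b).hom)
    (nf : m₀₁₂ ≫ f = r' ▷ b ≫ m₀₁₂') (ng : m₀₁₂'' ≫ g = a ◁ l ≫ m₀₁₂)
    (h₀₁₁₂ : m₀₁₁ ▷ b ≫ m₀₁₂' ≫ α = (α_ a o b).hom ≫ a ◁ m₁₁₂ ≫ m₀₁₂'') :
    m₀₁₂ ≫ f ≫ α ≫ g = m₀₁₂ := by
  have h : r' = (ρ_ a).inv ≫ a ◁ e ≫ m₀₁₁ := by
    rw [Iso.eq_inv_comp, ← hr, Category.assoc, Category.assoc, hr', Category.comp_id]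
  rw [reassoc_of% nf, h, comp_whiskerRight, comp_whiskerRight, Category.assoc, Category.assoc,
    reassoc_of% h₀₁₁₂, ng, associator_naturality_middle_assoc, ← whiskerLeft_comp_assoc,
    ← whiskerLeft_comp_assoc, Category.assoc, hl, triangle_assoc, inv_hom_whiskerRight_assoc]

/-- Naturality of the associator for elements, at a tetrahedron. -/
theorem associator_naturality_of_faces {a b c a' b' c' ab bc ab' bc' w w' w₁ w₁' : V}
    {m₀₁₂ : a ⊗ b ⟶ ab} {m₁₂₃ : b ⊗ c ⟶ bc} {m₀₂₃ : ab ⊗ c ⟶ w} {m₀₁₃ : a ⊗ bc ⟶ w₁}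
    {m₀₁₂' : a' ⊗ b' ⟶ ab'} {m₁₂₃' : b' ⊗ c' ⟶ bc'} {m₀₂₃' : ab' ⊗ c' ⟶ w'}
    {m₀₁₃' : a' ⊗ bc' ⟶ w₁'} {f : a ⟶ a'} {g : b ⟶ b'} {h : c ⟶ c'} {fg : ab ⟶ ab'}
    {gh : bc ⟶ bc'} {k : w ⟶ w'} {k₁ : w₁ ⟶ w₁'} {α : w ⟶ w₁} {α' : w' ⟶ w₁'}
    (hα : m₀₁₂ ▷ c ≫ m₀₂₃ ≫ α = (α_ a b c).hom ≫ a ◁ m₁₂₃ ≫ m₀₁₃)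
    (hα' : m₀₁₂' ▷ c' ≫ m₀₂₃' ≫ α' = (α_ a' b' c').hom ≫ a' ◁ m₁₂₃' ≫ m₀₁₃')
    (n₁ : m₀₁₂ ≫ fg = (f ⊗ₘ g) ≫ m₀₁₂') (n₂ : m₀₂₃ ≫ k = (fg ⊗ₘ h) ≫ m₀₂₃')
    (n₃ : m₁₂₃ ≫ gh = (g ⊗ₘ h) ≫ m₁₂₃') (n₄ : m₀₁₃ ≫ k₁ = (f ⊗ₘ gh) ≫ m₀₁₃') :
    m₀₁₂ ▷ c ≫ m₀₂₃ ≫ k ≫ α' = m₀₁₂ ▷ c ≫ m₀₂₃ ≫ α ≫ k₁ := by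
  have h₁ : m₀₁₂ ▷ c ≫ (fg ⊗ₘ h) = ((f ⊗ₘ g) ⊗ₘ h) ≫ m₀₁₂' ▷ c' := by
    rw [← tensorHom_id, ← tensorHom_id, tensorHom_comp_tensorHom, tensorHom_comp_tensorHom, n₁,
      Category.id_comp, Category.comp_id]
  have h₂ : a ◁ m₁₂₃ ≫ (f ⊗ₘ gh) = (f ⊗ₘ (g ⊗ₘ h)) ≫ a' ◁ m₁₂₃' := by
    rw [← id_tensorHom, ← id_tensorHom, tensorHom_comp_tensorHom, tensorHom_comp_tensorHom, n₃,
      Category.id_comp, Category.comp_id]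
  rw [reassoc_of% n₂, reassoc_of% h₁, hα', associator_naturality_assoc, reassoc_of% hα, n₄,
    reassoc_of% h₂]

theorem leftUnitor_naturality_of_faces {a a' o w w' : V} {e : 𝟙_ V ⟶ o} {m : o ⊗ a ⟶ w}
    {m' : o ⊗ a' ⟶ w'} {f : a ⟶ a'} {k : w ⟶ w'} {l : w ⟶ a} {l' : w' ⟶ a'}
    (hl : e ▷ a ≫ m ≫ l = (λ_ a).hom) (hl' : e ▷ a' ≫ m' ≫ l' = (λ_ a').hom)
    (n : m ≫ k = o ◁ f ≫ m') : (e ▷ a ≫ m) ≫ k ≫ l' = (e ▷ a ≫ m) ≫ l ≫ f := by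
  rw [Category.assoc, Category.assoc, reassoc_of% hl, reassoc_of% n, ← whisker_exchange_assoc, hl',
    leftUnitor_naturality]

theorem rightUnitor_naturality_of_faces {a a' o w w' : V} {e : 𝟙_ V ⟶ o} {m : a ⊗ o ⟶ w}
    {m' : a' ⊗ o ⟶ w'} {f : a ⟶ a'} {k : w ⟶ w'} {r : w ⟶ a} {r' : w' ⟶ a'}
    (hr : a ◁ e ≫ m ≫ r = (ρ_ a).hom) (hr' : a' ◁ e ≫ m' ≫ r' = (ρ_ a').hom)
    (n : m ≫ k = f ▷ o ≫ m') : (a ◁ e ≫ m) ≫ k ≫ r' = (a ◁ e ≫ m) ≫ r ≫ f := by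
  rw [Category.assoc, Category.assoc, reassoc_of% hr, reassoc_of% n, whisker_exchange_assoc, hr',
    rightUnitor_naturality]

end

variable {C : Type u} [Category.{v} C]

section

variable [HasZeroObject C] (D : HallDatum C) {n : ℕ} (t : S C n) (i j k : Fin (n + 1))
  (hij : i ≤ j) (hjk : j ≤ k)

theorem mulMap_naturality_left {φ φ' : Fun (S C 1)} (f : φ ⟶ φ') (ψ : Fun (S C 1)) :
    D.mulMap φ ψ t i j k hij hjk ≫ (D.tensorFunctor.map (Prod.mkHom f (𝟙 ψ))).hom.app
        ((restrict (edgeMap i k (hij.trans hjk))).obj t) =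
      (f.hom.app ((restrict (edgeMap i j hij)).obj t) ▷
        ψ.obj.obj ((restrict (edgeMap j k hjk)).obj t)) ≫ D.mulMap φ' ψ t i j k hij hjk := by
  rw [mulMap_naturality, ← tensorHom_id]
  rfl

theorem mulMap_naturality_right (φ : Fun (S C 1)) {ψ ψ' : Fun (S C 1)} (f : ψ ⟶ ψ') :
    D.mulMap φ ψ t i j k hij hjk ≫ (D.tensorFunctor.map (Prod.mkHom (𝟙 φ) f)).hom.app
        ((restrict (edgeMap i k (hij.trans hjk))).obj t) =
      (φ.obj.obj ((restrict (edgeMap i j hij)).obj t) ◁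
        f.hom.app ((restrict (edgeMap j k hjk)).obj t)) ≫ D.mulMap φ ψ' t i j k hij hjk := by
  rw [mulMap_naturality, ← id_tensorHom]
  rfl

end

section

variable [ProtoAbelian C] (D : HallDatum C)

theorem pentagon_of_isAssoc [Finitary C] {φ ψ ξ ζ : Fun (S C 1)}
    {a₁ : D.tens (D.tens φ ψ) ξ ⟶ D.tens φ (D.tens ψ ξ)} (h₁ : IsAssoc D a₁)
    {a₂ : D.tens (D.tens φ (D.tens ψ ξ)) ζ ⟶ D.tens φ (D.tens (D.tens ψ ξ) ζ)} (h₂ : IsAssoc D a₂)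
    {a₃ : D.tens (D.tens ψ ξ) ζ ⟶ D.tens ψ (D.tens ξ ζ)} (h₃ : IsAssoc D a₃)
    {b₁ : D.tens (D.tens (D.tens φ ψ) ξ) ζ ⟶ D.tens (D.tens φ ψ) (D.tens ξ ζ)}
    (k₁ : IsAssoc D b₁)
    {b₂ : D.tens (D.tens φ ψ) (D.tens ξ ζ) ⟶ D.tens φ (D.tens ψ (D.tens ξ ζ))}
    (k₂ : IsAssoc D b₂) :
    D.tensorFunctor.map (Prod.mkHom a₁ (𝟙 ζ)) ≫ a₂ ≫ D.tensorFunctor.map (Prod.mkHom (𝟙 φ) a₃) =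
      b₁ ≫ b₂ :=
  tens_tens_tens_hom_ext D fun T => pentagon_of_faces
    (mulMap_assoc D φ ψ ξ a₁ h₁ T 0 1 2 3 (by decide) (by decide) (by decide))
    (mulMap_naturality_left D T 0 3 4 (by decide) (by decide) a₁ ζ)
    (mulMap_assoc D φ (D.tens ψ ξ) ζ a₂ h₂ T 0 1 3 4 (by decide) (by decide) (by decide))
    (mulMap_naturality_right D T 0 1 4 (by decide) (by decide) φ a₃)
    (mulMap_assoc D ψ ξ ζ a₃ h₃ T 1 2 3 4 (by decide) (by decide) (by decide))
    (mulMap_assoc D (D.tens φ ψ) ξ ζ b₁ k₁ T 0 2 3 4 (by decide) (by decide) (by decide))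
    (mulMap_assoc D φ ψ (D.tens ξ ζ) b₂ k₂ T 0 1 2 4 (by decide) (by decide) (by decide))

theorem triangle_of_isAssoc {φ ψ : Fun (S C 1)}
    {a : D.tens (D.tens φ D.unitObj) ψ ⟶ D.tens φ (D.tens D.unitObj ψ)} (ha : IsAssoc D a)
    (l : D.tens D.unitObj ψ ≅ ψ) (hl : D.IsLeftUnit ψ l.hom)
    (r : D.tens φ D.unitObj ≅ φ) (hr : D.IsRightUnit φ r.hom) :
    a ≫ D.tensorFunctor.map (Prod.mkHom (𝟙 φ) l.hom) =
      D.tensorFunctor.map (Prod.mkHom r.hom (𝟙 ψ)) := by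
  -- after composition with `r⁻¹ ⊗ ψ` the identity can be tested on `φ ⊗ ψ`, that is, on triangles
  have key : D.tensorFunctor.map (Prod.mkHom r.inv (𝟙 ψ)) ≫ a ≫
      D.tensorFunctor.map (Prod.mkHom (𝟙 φ) l.hom) = 𝟙 _ := by
    refine tens_hom_ext D fun s => ?_
    refine (triangle_of_faces (mulMap_rightUnit D φ r.hom hr s 0 1 (Fin.zero_le 1)) ?_
      (mulMap_leftUnit D ψ l.hom hl s 1 2 (by decide))
      (mulMap_naturality_left D s 0 1 2 (Fin.zero_le 1) (by decide) r.inv ψ)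
      (mulMap_naturality_right D s 0 1 2 (Fin.zero_le 1) (by decide) φ l.hom)
      (mulMap_assoc D φ D.unitObj ψ a ha s 0 1 1 2 (Fin.zero_le 1) le_rfl (by decide))).trans ?_
    · exact congrArg (fun f : D.tens φ D.unitObj ⟶ _ => f.hom.app
        ((restrict (edgeMap 0 1 (Fin.zero_le 1))).obj s)) r.hom_inv_id
    · exact (Category.comp_id _).symm
  have h : D.tensorFunctor.map (Prod.mkHom r.hom (𝟙 ψ)) ≫
      D.tensorFunctor.map (Prod.mkHom r.inv (𝟙 ψ)) = 𝟙 (D.tens (D.tens φ D.unitObj) ψ) := by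
    rw [← D.tensorFunctor.map_comp]
    refine Eq.trans (congrArg D.tensorFunctor.map ?_) (D.tensorFunctor.map_id _)
    exact Prod.ext r.hom_inv_id (Category.comp_id _)
  rw [← Category.id_comp (a ≫ _), ← h, Category.assoc, key, Category.comp_id]

theorem associator_naturality_of_isAssoc {φ ψ ξ φ' ψ' ξ' : Fun (S C 1)}
    {a : D.tens (D.tens φ ψ) ξ ⟶ D.tens φ (D.tens ψ ξ)} (h : IsAssoc D a)
    {a' : D.tens (D.tens φ' ψ') ξ' ⟶ D.tens φ' (D.tens ψ' ξ')} (h' : IsAssoc D a')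
    (f : φ ⟶ φ') (g : ψ ⟶ ψ') (k : ξ ⟶ ξ') :
    D.tensorFunctor.map (Prod.mkHom (D.tensorFunctor.map (Prod.mkHom f g)) k) ≫ a' =
      a ≫ D.tensorFunctor.map (Prod.mkHom f (D.tensorFunctor.map (Prod.mkHom g k))) :=
  tens_tens_hom_ext D fun t => associator_naturality_of_faces
    (mulMap_assoc D φ ψ ξ a h t 0 1 2 3 (by decide) (by decide) (by decide))
    (mulMap_assoc D φ' ψ' ξ' a' h' t 0 1 2 3 (by decide) (by decide) (by decide))
    (mulMap_naturality D f g t 0 1 2 (by decide) (by decide))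
    (mulMap_naturality D (D.tensorFunctor.map (Prod.mkHom f g)) k t 0 2 3 (by decide) (by decide))
    (mulMap_naturality D g k t 1 2 3 (by decide) (by decide))
    (mulMap_naturality D f (D.tensorFunctor.map (Prod.mkHom g k)) t 0 1 3 (by decide) (by decide))

theorem leftUnitor_naturality_of_isLeftUnit {φ φ' : Fun (S C 1)}
    {l : D.tens D.unitObj φ ⟶ φ} (h : D.IsLeftUnit φ l)
    {l' : D.tens D.unitObj φ' ⟶ φ'} (h' : D.IsLeftUnit φ' l') (f : φ ⟶ φ') :
    D.tensorFunctor.map (Prod.mkHom (𝟙 D.unitObj) f) ≫ l' = l ≫ f := by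
  obtain ⟨μ, hμ, hμ'⟩ := exists_isLeftKanExtension_unit_tens D φ
  refine fun_hom_ext_of_isLeftKanExtension μ hμ fun a => ?_
  rw [← cancel_epi (λ_ (φ.obj.obj ((restrict (edgeMap 0 1 (Fin.zero_le 1))).obj a))).hom,
    ← Category.assoc, ← Category.assoc, hμ' a]
  exact leftUnitor_naturality_of_faces (h a) (h' a)
    (mulMap_naturality_right D a 0 0 1 le_rfl (Fin.zero_le 1) D.unitObj f)

theorem rightUnitor_naturality_of_isRightUnit {φ φ' : Fun (S C 1)}
    {r : D.tens φ D.unitObj ⟶ φ} (h : D.IsRightUnit φ r)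
    {r' : D.tens φ' D.unitObj ⟶ φ'} (h' : D.IsRightUnit φ' r') (f : φ ⟶ φ') :
    D.tensorFunctor.map (Prod.mkHom f (𝟙 D.unitObj)) ≫ r' = r ≫ f := by
  obtain ⟨μ, hμ, hμ'⟩ := exists_isLeftKanExtension_tens_unit D φ
  refine fun_hom_ext_of_isLeftKanExtension μ hμ fun a => ?_
  rw [← cancel_epi (ρ_ (φ.obj.obj ((restrict (edgeMap 0 1 (Fin.zero_le 1))).obj a))).hom,
    ← Category.assoc, ← Category.assoc, hμ' a]
  exact rightUnitor_naturality_of_faces (h a) (h' a)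
    (mulMap_naturality_left D a 0 1 1 (Fin.zero_le 1) le_rfl f D.unitObj)

theorem tensorFunctor_map_id (φ ψ : Fun (S C 1)) :
    D.tensorFunctor.map (Prod.mkHom (𝟙 φ) (𝟙 ψ)) = 𝟙 (D.tens φ ψ) :=
  D.tensorFunctor.map_id (φ, ψ)

theorem tensorFunctor_map_comp {φ₁ φ₂ φ₃ ψ₁ ψ₂ ψ₃ : Fun (S C 1)} (f : φ₁ ⟶ φ₂) (g : ψ₁ ⟶ ψ₂)
    (f' : φ₂ ⟶ φ₃) (g' : ψ₂ ⟶ ψ₃) :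
    D.tensorFunctor.map (Prod.mkHom f g) ≫ D.tensorFunctor.map (Prod.mkHom f' g') =
      D.tensorFunctor.map (Prod.mkHom (f ≫ f') (g ≫ g')) :=
  (D.tensorFunctor.map_comp (Prod.mkHom f g) (Prod.mkHom f' g')).symm

theorem tensorFunctor_map_eq {φ φ' ψ ψ' : Fun (S C 1)} (f : φ ⟶ φ') (g : ψ ⟶ ψ') :
    D.tensorFunctor.map (Prod.mkHom f g) = D.tensorFunctor.map (Prod.mkHom f (𝟙 ψ)) ≫
      D.tensorFunctor.map (Prod.mkHom (𝟙 φ') g) := by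
  rw [tensorFunctor_map_comp, Category.comp_id, Category.id_comp]

/-- Associators and unitors which are compatible with the structure maps make `Fun(S_1)` a monoidal
category. -/
@[reducible]
def monoidalOfIsAssoc [Finitary C]
    (α : ∀ φ ψ ξ : Fun (S C 1), D.tens (D.tens φ ψ) ξ ≅ D.tens φ (D.tens ψ ξ))
    (l : ∀ φ : Fun (S C 1), D.tens D.unitObj φ ≅ φ)
    (r : ∀ φ : Fun (S C 1), D.tens φ D.unitObj ≅ φ)
    (hα : ∀ φ ψ ξ, IsAssoc D (α φ ψ ξ).hom) (hl : ∀ φ, D.IsLeftUnit φ (l φ).hom)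
    (hr : ∀ φ, D.IsRightUnit φ (r φ).hom) : MonoidalCategory (Fun (S C 1)) where
  toMonoidalCategoryStruct := D.monoidalStruct α l r
  tensorHom_def f g := tensorFunctor_map_eq D f g
  id_tensorHom_id φ ψ := tensorFunctor_map_id D φ ψ
  tensorHom_comp_tensorHom f g f' g' := tensorFunctor_map_comp D f g f' g'
  whiskerLeft_id φ ψ := tensorFunctor_map_id D φ ψ
  id_whiskerRight φ ψ := tensorFunctor_map_id D φ ψ
  associator_naturality f g k :=
    associator_naturality_of_isAssoc D (hα _ _ _) (hα _ _ _) f g k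
  leftUnitor_naturality f := leftUnitor_naturality_of_isLeftUnit D (hl _) (hl _) f
  rightUnitor_naturality f := rightUnitor_naturality_of_isRightUnit D (hr _) (hr _) f
  pentagon _ _ _ _ := pentagon_of_isAssoc D (hα _ _ _) (hα _ _ _) (hα _ _ _) (hα _ _ _)
    (hα _ _ _)
  triangle φ ψ := triangle_of_isAssoc D (hα _ _ _) (l ψ) (hl ψ) (r φ) (hr φ)

end

end

end

end HallMonoidal

theorem mainTheorem4 (C : Type u) [Category.{v} C] [ProtoAbelian C] [Finitary C] :
    Nonempty (HallDatum C) ∧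
    Nonempty (PullPush (outerEdges₃ C) (innerEdge₃ C)) ∧
    ∀ D : HallDatum C,
      ∃ (α : ∀ φ ψ ξ : Fun (S C 1), D.tens (D.tens φ ψ) ξ ≅ D.tens φ (D.tens ψ ξ))
        (l : ∀ φ : Fun (S C 1), D.tens D.unitObj φ ≅ φ)
        (r : ∀ φ : Fun (S C 1), D.tens φ D.unitObj ≅ φ),
        (∃ M : MonoidalCategory (Fun (S C 1)),
          M.toMonoidalCategoryStruct = D.monoidalStruct α l r) ∧
        (∀ (P : PullPush (outerEdges₃ C) (innerEdge₃ C)) (φ ψ ξ : Fun (S C 1)),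
          ∃ (α₁ : HallDatum.triple P φ ψ ξ ≅ D.tens (D.tens φ ψ) ξ)
            (α₂ : HallDatum.triple P φ ψ ξ ≅ D.tens φ (D.tens ψ ξ)),
            D.IsLeftComparison P φ ψ ξ α₁.hom ∧ D.IsRightComparison P φ ψ ξ α₂.hom ∧
              α φ ψ ξ = α₁.symm ≪≫ α₂) ∧
        (∀ φ : Fun (S C 1), D.IsLeftUnit φ (l φ).hom ∧ D.IsRightUnit φ (r φ).hom) := by
  refine ⟨nonempty_hallDatum C, nonempty_pullPush₃ C, fun D => ?_⟩
  choose α hα hP using exists_associator D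
  choose l hl using exists_leftUnitor D
  choose r hr using exists_rightUnitor D
  exact ⟨α, l, r, ⟨monoidalOfIsAssoc D α l r hα hl hr, rfl⟩, fun P φ ψ ξ => hP φ ψ ξ P,
    fun φ => ⟨hl φ, hr φ⟩⟩
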